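/- **Definitions.** All graphs are finite, simple and undirected. The *feedback edge number* $\mathbf{fen}(G)$ is the minimum size of an edge set $F$ such that $G-F$ is acyclic. In a *polyline drawing* of $G$, the vertices are placed at distinct points of $\mathbb R^2$ and every edge is a simple polygonal curve joining its end points, whose interior contains no vertex that is not an end point of the edge; the points where consecutive segments of an edge meet (at an angle different from $180^\circ$) are its *bends*. The drawing is a *RAC drawing* if every common point of the interiors of two distinct edges lies in the relative interiors of two mutually orthogonal segments of these edges. For $b\in\mathbb N$ and $\beta:E(G)\to\{0,1,2,3\}$, it is *$\beta$-restricted* if every edge $e$ has at most $\beta(e)$ bends, and *$b$-bend* if there are at most $b$ bends in total. *Bend-Restricted RAC Drawing* (BRAC) asks, given $(G,b,\beta)$, whether $G$ has a $b$-bend $\beta$-restricted RAC drawing. **Theorem.** BRAC, parameterized by $\mathbf{fen}(G)$, admits a kernel of size at most $(36\cdot\mathbf{fen}(G))^{4\cdot\mathbf{fen}(G)}$ (with $0^0=1$), computable in linear time. That is, there is an algorithm that, given an instance $(G,b,\beta)$ with the edges of $G$ listed in arbitrary order, runs in $\mathcal O(|V(G)|+|E(G)|+1)$ steps on a word RAM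 with words of $\mathcal O(\log(|V(G)|+|E(G)|+b+2))$ bits and outputs an instance $(G',b',\beta')$ such that 1. $(G,b,\beta)$ is a yes-instance if and only if $(G',b',\beta')$ is; 2. $|V(G')|+|E(G')|\le(36\cdot\mathbf{fen}(G))^{4\cdot\mathbf{fen}(G)}$, $\ \mathbf{fen}(G')\le\mathbf{fen}(G)$ and $b'=\min(b,3|E(G')|)$; 3. $G'$ is (isomorphic to) a subgraph of $G$, $\beta'$ is the restriction of $\beta$ to it, and every $\beta'$-restricted RAC drawing of $G'$ extends to a $\beta$-restricted RAC drawing of $G$ with the same total number of bends. -/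

import Mathlib

namespace BRAC

/-! ### Polylines and RAC drawings -/

/-- The Euclidean plane. -/
abbrev Plane : Type := EuclideanSpace ℝ (Fin 2)

/-- A sequence of `bends + 2` points in the plane; consecutive points span the `bends + 1`
segments. Such a sequence is a polyline with exactly `bends` bends when it is `Proper`. -/
structure Polyline where
  bends : ℕ
  pt : Fin (bends + 2) → Plane

namespace Polyline

variable (P : Polyline)

def start : Plane := P.pt 0

def finish : Plane := P.pt (Fin.last (P.bends + 1))

/-- The `i`-th closed straight-line segment. -/
def seg (i : Fin (P.bends + 1)) : Set Plane := segment ℝ (P.pt i.castSucc) (P.pt i.succ)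

/-- The relative interior of the `i`-th segment. -/
def openSeg (i : Fin (P.bends + 1)) : Set Plane :=
  openSegment ℝ (P.pt i.castSucc) (P.pt i.succ)

/-- The direction vector of the `i`-th segment. -/
def dir (i : Fin (P.bends + 1)) : Plane := P.pt i.succ - P.pt i.castSucc

/-- The point set of the polyline. -/
def carrier : Set Plane := ⋃ i, P.seg i

/-- The image of the open parameter interval: for a simple curve with distinct end points this
is the point set without the two end points. -/
def interior : Set Plane := P.carrier \ {P.start, P.finish}

/-- The conditions on the segments of a polyline edge: segments are nondegenerate, consecutive
segments meet exactly in their shared end point and at an angle different from 180 degrees, and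
every other pair of segments is disjoint. -/
structure Proper : Prop where
  nondegenerate : ∀ i : Fin (P.bends + 1), P.pt i.castSucc ≠ P.pt i.succ
  consecutive : ∀ i j : Fin (P.bends + 1), (i : ℕ) + 1 = j → P.seg i ∩ P.seg j = {P.pt i.succ}
  angle_ne : ∀ i j : Fin (P.bends + 1), (i : ℕ) + 1 = j →
    EuclideanGeometry.angle (P.pt i.castSucc) (P.pt i.succ) (P.pt j.succ) ≠ Real.pi
  disjoint : ∀ i j : Fin (P.bends + 1), (i : ℕ) + 1 < j → Disjoint (P.seg i) (P.seg j)

end Polyline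

/-- A polyline drawing of a graph. -/
structure Drawing {V : Type*} (G : SimpleGraph V) where
  /-- The positions of the vertices. -/
  pos : V → Plane
  pos_injective : Function.Injective pos
  /-- The polylines representing the edges. -/
  curve : G.edgeSet → Polyline
  proper : ∀ e, (curve e).Proper
  /-- The curve of an edge connects the positions of its end points (in either direction). -/
  joins : ∀ e, s((curve e).start, (curve e).finish) = Sym2.map pos (e : Sym2 V)
  /-- No vertex lies in the interior of an edge that is not incident to it. -/
  avoids : ∀ (v : V) (e : G.edgeSet), v ∉ (e : Sym2 V) → pos v ∉ (curve e).interior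

namespace Drawing

variable {V V' : Type*} {G : SimpleGraph V} {H : SimpleGraph V'}

/-- Every crossing (a common point of the interiors of two different edges) is a right-angle
crossing: it lies in the relative interiors of a segment of either edge, and these two segments
are orthogonal. -/
def IsRAC (D : Drawing G) : Prop :=
  ∀ e f : G.edgeSet, e ≠ f → ∀ x ∈ (D.curve e).interior ∩ (D.curve f).interior,
    ∃ i j, x ∈ (D.curve e).openSeg i ∧ x ∈ (D.curve f).openSeg j ∧
      inner ℝ ((D.curve e).dir i) ((D.curve f).dir j) = 0

/-- The number of bends counted over all edges (used for finite graphs only). -/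
noncomputable def totalBends (D : Drawing G) : ℕ := ∑ᶠ e : G.edgeSet, (D.curve e).bends

/-- Every edge `e` has at most `β e` bends. -/
def Respects (D : Drawing G) (β : G.edgeSet → Fin 4) : Prop :=
  ∀ e, (D.curve e).bends ≤ (β e : ℕ)

/-- The drawing `D` of `G` restricts along `φ` to the drawing `D'` of `H`. -/
def Extends (D : Drawing G) (D' : Drawing H) (φ : H →g G) : Prop :=
  (∀ v, D.pos (φ v) = D'.pos v) ∧ ∀ e, D.curve (φ.mapEdgeSet e) = D'.curve e

end Drawing

/-! ### The feedback edge number and the problem -/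

/-- The feedback edge number: the least size of a set of edges whose deletion leaves an acyclic
graph. -/
noncomputable def fen {V : Type*} (G : SimpleGraph V) : ℕ :=
  sInf {k | ∃ F : Finset (Sym2 V),
    (F : Set (Sym2 V)) ⊆ G.edgeSet ∧ (G.deleteEdges (F : Set (Sym2 V))).IsAcyclic ∧ F.card = k}

/-- An instance of Bend-Restricted RAC Drawing: a finite simple graph, a bound `b` on the total
number of bends and an edge labelling `β` with values in `{0, 1, 2, 3}`. -/
structure Instance where
  n : ℕ
  graph : SimpleGraph (Fin n)
  b : ℕ
  β : graph.edgeSet → Fin 4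

namespace Instance

variable (I : Instance)

/-- The number of edges. -/
noncomputable def m : ℕ := I.graph.edgeSet.ncard

/-- The graph has a `b`-bend `β`-restricted RAC drawing. -/
def IsYes : Prop :=
  ∃ D : Drawing I.graph, D.IsRAC ∧ D.totalBends ≤ I.b ∧ D.Respects I.β

/-- The words `n, m, b, u₁, v₁, β(u₁v₁), …, uₘ, vₘ, β(uₘvₘ)`, where `u₁v₁, …, uₘvₘ` lists every
edge exactly once, in any order and with the end points of each edge in either order. -/
def IsEncoding (w : List ℕ) : Prop :=
  ∃ L : List I.graph.Dart,
    (L.map SimpleGraph.Dart.edge).Nodup ∧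
    (∀ e, e ∈ L.map SimpleGraph.Dart.edge ↔ e ∈ I.graph.edgeSet) ∧
    w = [I.n, L.length, I.b] ++
      L.flatMap fun d => [(d.fst : ℕ), (d.snd : ℕ), (I.β ⟨d.edge, d.edge_mem⟩ : ℕ)]

end Instance

/-! ### A word RAM

Programs work on registers and on an indirectly addressed memory; every register and memory cell
holds a machine word, which is a natural number at most `W`. Each elementary operation
(constant, register access, memory access, arithmetic operation, assignment, test) is one step. -/

structure State where
  reg : ℕ → ℕ
  mem : ℕ → ℕ

inductive Expr where
  | const (c : ℕ)
  | reg (x : ℕ)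
  | mem (a : Expr)
  | add (a b : Expr)
  | sub (a b : Expr)
  | mul (a b : Expr)
  | div (a b : Expr)

namespace Expr

/-- The value of an expression (truncated subtraction, rounded division). -/
def eval (s : State) : Expr → ℕ
  | const c => c
  | reg x => s.reg x
  | mem a => s.mem (a.eval s)
  | add a b => a.eval s + b.eval s
  | sub a b => a.eval s - b.eval s
  | mul a b => a.eval s * b.eval s
  | div a b => a.eval s / b.eval s

/-- The number of elementary operations in the evaluation of an expression. -/
def cost : Expr → ℕ
  | const _ => 1
  | reg _ => 1
  | mem a => a.cost + 1
  | add a b => a.cost + b.cost + 1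
  | sub a b => a.cost + b.cost + 1
  | mul a b => a.cost + b.cost + 1
  | div a b => a.cost + b.cost + 1

/-- All values and addresses that occur in the evaluation are words, that is, at most `W`. -/
def Fits (W : ℕ) (s : State) : Expr → Prop
  | const c => c ≤ W
  | reg x => s.reg x ≤ W
  | mem a => a.Fits W s ∧ s.mem (a.eval s) ≤ W
  | add a b => a.Fits W s ∧ b.Fits W s ∧ a.eval s + b.eval s ≤ W
  | sub a b => a.Fits W s ∧ b.Fits W s
  | mul a b => a.Fits W s ∧ b.Fits W s ∧ a.eval s * b.eval s ≤ W
  | div a b => a.Fits W s ∧ b.Fits W s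

end Expr

/-- Programs. A test succeeds when its expression is nonzero. -/
inductive Program where
  | skip
  | assign (x : ℕ) (e : Expr)
  | store (a e : Expr)
  | seq (p q : Program)
  | branch (t : Expr) (p q : Program)
  | loop (t : Expr) (p : Program)

/-- `Exec W p s T s'`: with words of size at most `W`, the program `p` started in the state `s`
halts after exactly `T` steps in the state `s'`. -/
inductive Exec (W : ℕ) : Program → State → ℕ → State → Prop
  | skip (s : State) : Exec W .skip s 1 s
  | assign (s : State) (x : ℕ) (e : Expr) (he : e.Fits W s) :
      Exec W (.assign x e) s (e.cost + 1) ⟨Function.update s.reg x (e.eval s), s.mem⟩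
  | store (s : State) (a e : Expr) (ha : a.Fits W s) (he : e.Fits W s) :
      Exec W (.store a e) s (a.cost + e.cost + 1)
        ⟨s.reg, Function.update s.mem (a.eval s) (e.eval s)⟩
  | seq {s s₁ s₂ : State} {p q : Program} {T₁ T₂ : ℕ}
      (hp : Exec W p s T₁ s₁) (hq : Exec W q s₁ T₂ s₂) :
      Exec W (.seq p q) s (T₁ + T₂) s₂
  | branch_true {s s₁ : State} {t : Expr} {p q : Program} {T : ℕ} (hf : t.Fits W s)
      (ht : t.eval s ≠ 0) (hp : Exec W p s T s₁) :
      Exec W (.branch t p q) s (t.cost + 1 + T) s₁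
  | branch_false {s s₁ : State} {t : Expr} {p q : Program} {T : ℕ} (hf : t.Fits W s)
      (ht : t.eval s = 0) (hq : Exec W q s T s₁) :
      Exec W (.branch t p q) s (t.cost + 1 + T) s₁
  | loop_true {s s₁ s₂ : State} {t : Expr} {p : Program} {T₁ T₂ : ℕ} (hf : t.Fits W s)
      (ht : t.eval s ≠ 0) (hp : Exec W p s T₁ s₁) (hl : Exec W (.loop t p) s₁ T₂ s₂) :
      Exec W (.loop t p) s (t.cost + 1 + T₁ + T₂) s₂
  | loop_false {s : State} {t : Expr} {p : Program} (hf : t.Fits W s) (ht : t.eval s = 0) :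
      Exec W (.loop t p) s (t.cost + 1) s

/-- The initial state for the input `w`: the words of `w` fill the first memory cells, everything
else is zero. -/
def State.input (w : List ℕ) : State := ⟨fun _ => 0, fun i => w.getD i 0⟩

/-- The first memory cells hold the words of `w`. -/
def State.Holds (s : State) (w : List ℕ) : Prop := ∀ i, ∀ h : i < w.length, s.mem i = w[i]

end BRAC

/-! The kernel is a subgraph, so a drawing of `G` restricts to it, and replacing `b` by `min b
(3m')` loses nothing because no edge has more than three bends. The content is the converse:
whatever was deleted can be added to any given drawing of the kernel by straight edges, hence
without a single new bend.

Two kinds of parts are deleted. A pendant edge can be redrawn as a very short straight edge at its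
end, off the finitely many directions of the drawing (`extendable_leaf`). Once no vertex of degree
one is left, the remaining edges split into maximal chains, that is, paths or closed paths with
inner vertices of degree two. A chain that is long compared with the rest can also be redrawn
(`RACOn.ears`). Its second and its second last vertex are placed near its ends so that the segment
between them is in general position: it meets the drawing in simple points in the relative interiors
of segments, never at a vertex or a bend, and transversally. The chain then follows this segment. At
each crossing four inner vertices make a small detour whose middle edge is orthogonal to the crossed
segment (`RACOn.hop`). If the kept chains have `M` edges in total and there are `q` chains, the
drawing has at most `4M` segments, the first and last edges of the long chains add at most `2q`, and
the long chains cross each other at most once per pair. So about `4(4M + 2q + q) = 16M + 12q` inner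
vertices suffice.

Accordingly, the kept chains are those shorter than a threshold `t`, the first `t` with `16M + 12q <
t`, where `M` is the total length of the chains shorter than `t`; if no `t` up to the number of
edges qualifies, all chains are kept. Before the threshold each new length is at most `16M + 12q`,
so every kept chain multiplies `4M + 3q` by at most `17`, whence `4M + 3q ≤ 3q · 17 ^ q`
(`sum_short_le`).

Finally `q ≤ 4 fen(G)` (`Decomp.card_le`). At most `fen(G)` chains contain an edge of a minimum
feedback edge set. Any other chain lies in a forest, so it has two distinct ends, both of degree at
least three, and the degrees of such vertices sum to at most `6 fen(G)` by the handshake lemma.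

For linear time, no adjacency lists are built. Each vertex stores its degree and the sum of the
indices of its edges; this sum is the edge itself at a leaf, and at a vertex of degree two it yields
the other edge by subtraction. Total chain lengths are collected in buckets indexed by length, so
that no sorting is needed. The programs are verified by a weakest-precondition calculus with a step
budget (`WP`). -/

namespace BRAC

open Set Function

/-! ### Straight polylines and proper polylines -/

/-- The cross product of two plane vectors; it vanishes exactly for parallel ones. -/
def cross (u v : Plane) : ℝ := u 0 * v 1 - u 1 * v 0

namespace Polyline

/-- The polyline without bends from `a` to `b`. -/
def straight (a b : Plane) : Polyline := ⟨0, ![a, b]⟩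

@[simp] theorem straight_bends (a b : Plane) : (straight a b).bends = 0 := rfl

@[simp] theorem straight_start (a b : Plane) : (straight a b).start = a := rfl

@[simp] theorem straight_finish (a b : Plane) : (straight a b).finish = b := rfl

theorem straight_seg (a b : Plane) (i) : (straight a b).seg i = segment ℝ a b := by
  obtain ⟨i, hi⟩ := i
  have : i = 0 := by simp at hi; omega
  subst this; rfl

theorem straight_openSeg (a b : Plane) (i) : (straight a b).openSeg i = openSegment ℝ a b := by
  obtain ⟨i, hi⟩ := i
  have : i = 0 := by simp at hi; omega
  subst this; rfl

theorem straight_dir (a b : Plane) (i) : (straight a b).dir i = b - a := by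
  obtain ⟨i, hi⟩ := i
  have : i = 0 := by simp at hi; omega
  subst this; rfl

@[simp] theorem straight_carrier (a b : Plane) : (straight a b).carrier = segment ℝ a b := by
  ext z
  simp only [carrier, mem_iUnion, straight_seg]
  exact ⟨fun ⟨_, h⟩ => h, fun h => ⟨0, h⟩⟩

theorem straight_proper {a b : Plane} (h : a ≠ b) : (straight a b).Proper := by
  have key : ∀ i : Fin ((straight a b).bends + 1), (i : ℕ) = 0 := by
    rintro ⟨i, hi⟩; simp at hi ⊢; omega
  refine ⟨?_, ?_, ?_, ?_⟩
  · rintro ⟨i, hi⟩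
    have : i = 0 := by simp at hi; omega
    subst this; exact h
  all_goals
    intro i j hij
    have := key i
    have := key j
    omega

theorem mem_seg_iff (P : Polyline) (i) (z : Plane) :
    z ∈ P.seg i ↔ z = P.pt i.castSucc ∨ z = P.pt i.succ ∨ z ∈ P.openSeg i := by
  unfold seg openSeg
  rw [← insert_endpoints_openSegment]; simp

theorem openSeg_subset_seg (P : Polyline) (i) : P.openSeg i ⊆ P.seg i :=
  openSegment_subset_segment ℝ _ _

theorem seg_subset_carrier (P : Polyline) (i) : P.seg i ⊆ P.carrier :=
  subset_iUnion P.seg i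

theorem isClosed_seg (P : Polyline) (i) : IsClosed (P.seg i) := by
  unfold seg
  rw [segment_eq_image_lineMap]
  exact (isCompact_Icc.image (by fun_prop)).isClosed

theorem isClosed_carrier (P : Polyline) : IsClosed P.carrier :=
  isClosed_iUnion_of_finite P.isClosed_seg

theorem pt_mem_carrier (P : Polyline) (k) : P.pt k ∈ P.carrier := by
  rcases Fin.eq_castSucc_or_eq_last k with ⟨j, rfl⟩ | rfl
  · exact P.seg_subset_carrier j (left_mem_segment ℝ _ _)
  · exact P.seg_subset_carrier (Fin.last _) (right_mem_segment ℝ _ _)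

theorem mem_carrier_cases (P : Polyline) {z : Plane} (h : z ∈ P.carrier) :
    (∃ k, z = P.pt k) ∨ ∃ i, z ∈ P.openSeg i := by
  obtain ⟨i, hi⟩ := mem_iUnion.1 h
  rcases (P.mem_seg_iff i z).1 hi with h | h | h
  exacts [.inl ⟨_, h⟩, .inl ⟨_, h⟩, .inr ⟨_, h⟩]

/-- An inner point of a segment is not one of its ends, consecutive segments share only an end, and
all other pairs are disjoint. This singles out the one segment of an edge that passes through a
crossing. -/
theorem Proper.eq_of_mem {P : Polyline} (hP : P.Proper) {i j} {z : Plane} (hi : z ∈ P.openSeg i)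
    (hj : z ∈ P.seg j) : i = j := by
  have hl : P.pt i.castSucc ∉ P.openSeg i := fun h =>
    hP.nondegenerate i ((left_mem_openSegment_iff (𝕜 := ℝ)).1 h)
  have hr : P.pt i.succ ∉ P.openSeg i := fun h =>
    hP.nondegenerate i ((right_mem_openSegment_iff (𝕜 := ℝ)).1 h)
  have his := P.openSeg_subset_seg i hi
  rcases lt_trichotomy (i : ℕ) j with h | h | h
  · rcases (Nat.succ_le_of_lt h).eq_or_lt with h | h
    · have := (hP.consecutive i j h).subset ⟨his, hj⟩
      rw [mem_singleton_iff] at this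
      exact absurd (this ▸ hi) hr
    · exact absurd hj (disjoint_left.1 (hP.disjoint i j h) his)
  · exact Fin.ext h
  · rcases (Nat.succ_le_of_lt h).eq_or_lt with h | h
    · have := (hP.consecutive j i h).subset ⟨hj, his⟩
      rw [mem_singleton_iff] at this
      have e : j.succ = i.castSucc := Fin.ext (by simpa using h)
      rw [e] at this
      exact absurd (this ▸ hi) hl
    · exact absurd his (disjoint_left.1 (hP.disjoint j i h) hj)

theorem start_mem_carrier (P : Polyline) : P.start ∈ P.carrier := P.pt_mem_carrier _

theorem finish_mem_carrier (P : Polyline) : P.finish ∈ P.carrier := P.pt_mem_carrier _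

end Polyline

open Polyline

/-! ### Drawings on a set of placed vertices -/

/-- The data `pos`, `curve` form a RAC drawing of the graph with vertex set `S` and
edge set `E`. -/
structure RACOn {V : Type*} (S : Set V) (E : Set (Sym2 V)) (pos : V → Plane)
    (curve : Sym2 V → Polyline) : Prop where
  inj : InjOn pos S
  mem : ∀ e ∈ E, ∀ v ∈ e, v ∈ S
  proper : ∀ e ∈ E, (curve e).Proper
  joins : ∀ e ∈ E, s((curve e).start, (curve e).finish) = Sym2.map pos e
  avoids : ∀ v ∈ S, ∀ e ∈ E, v ∉ e → pos v ∉ (curve e).carrier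
  rac : ∀ e ∈ E, ∀ f ∈ E, e ≠ f → ∀ z ∈ (curve e).interior ∩ (curve f).interior,
    ∃ i j, z ∈ (curve e).openSeg i ∧ z ∈ (curve f).openSeg j ∧
      inner ℝ ((curve e).dir i) ((curve f).dir j) = 0

namespace RACOn

variable {V : Type*} {S S' : Set V} {E : Set (Sym2 V)} {pos pos' : V → Plane}
  {curve curve' : Sym2 V → Polyline}

theorem mono (h : RACOn S E pos curve) (hS : S' ⊆ S) (hm : ∀ e ∈ E, ∀ v ∈ e, v ∈ S') :
    RACOn S' E pos curve :=
  ⟨h.inj.mono hS, hm, h.proper, h.joins, fun v hv => h.avoids v (hS hv), h.rac⟩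

theorem congr (h : RACOn S E pos curve) (hp : ∀ v ∈ S, pos' v = pos v)
    (hc : ∀ e ∈ E, curve' e = curve e) : RACOn S E pos' curve' where
  inj := h.inj.congr fun v hv => (hp v hv).symm
  mem := h.mem
  proper e he := hc e he ▸ h.proper e he
  joins e he := by
    rw [hc e he, h.joins e he]
    exact Sym2.map_congr fun v hv => (hp v (h.mem e he v hv)).symm
  avoids v hv e he hve := by rw [hc e he, hp v hv]; exact h.avoids v hv e he hve
  rac e he f hf := by rw [hc e he, hc f hf]; exact h.rac e he f hf

/-- The end points of an edge curve are the positions of the end points of the edge. -/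
theorem ends_eq_pos (h : RACOn S E pos curve) {e} (he : e ∈ E) {z}
    (hz : z = (curve e).start ∨ z = (curve e).finish) : ∃ v ∈ e, pos v = z := by
  have : z ∈ s((curve e).start, (curve e).finish) := by simpa using hz
  rw [h.joins e he] at this
  exact Sym2.mem_map.1 this

theorem mem_interior (h : RACOn S E pos curve) {e} (he : e ∈ E) {z}
    (hz : z ∈ (curve e).carrier) (hS : z ∉ pos '' S) : z ∈ (curve e).interior := by
  refine ⟨hz, fun hc => ?_⟩
  obtain ⟨v, hv, rfl⟩ := h.ends_eq_pos he (by simpa using hc)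
  exact hS ⟨v, h.mem e he v hv, rfl⟩

/-- Place a new vertex off the drawing. -/
theorem place [DecidableEq V] (h : RACOn S E pos curve) {x : V} {q : Plane} (hx : x ∉ S)
    (hq : q ∉ pos '' S) (hE : ∀ e ∈ E, q ∉ (curve e).carrier) :
    RACOn (insert x S) E (update pos x q) curve := by
  have h1 : RACOn S E (update pos x q) curve := h.congr
    (fun v hv => update_of_ne (ne_of_mem_of_not_mem hv hx) _ _) fun _ _ => rfl
  refine ⟨?_, fun e he v hv => mem_insert_of_mem _ (h.mem e he v hv), h1.proper, h1.joins, ?_,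
    h1.rac⟩
  · refine (injOn_insert hx).2 ⟨h1.inj, ?_⟩
    rw [update_self]
    rintro ⟨v, hv, e⟩
    rw [update_of_ne (ne_of_mem_of_not_mem hv hx)] at e
    exact hq ⟨v, hv, e⟩
  · rintro v (rfl | hv) e he hve
    · rw [update_self]; exact hE e he
    · exact h1.avoids v hv e he hve

/-- Join two placed vertices by a straight edge. -/
theorem join [DecidableEq V] (h : RACOn S E pos curve) {v w : V} (hv : v ∈ S) (hw : w ∈ S)
    (hvw : v ≠ w) (hn : s(v, w) ∉ E) (hS : ∀ u ∈ S, pos u ∉ openSegment ℝ (pos v) (pos w))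
    (hE : ∀ e ∈ E, ∀ z ∈ openSegment ℝ (pos v) (pos w), z ∈ (curve e).carrier →
      ∃ i, z ∈ (curve e).openSeg i ∧ inner ℝ ((curve e).dir i) (pos w - pos v) = 0) :
    RACOn S (insert s(v, w) E) pos (update curve s(v, w) (straight (pos v) (pos w))) := by
  have hp : pos v ≠ pos w := fun e => hvw (h.inj hv hw e)
  have hne : ∀ e ∈ E, e ≠ s(v, w) := fun e he hc => hn (hc ▸ he)
  set curve' := update curve s(v, w) (straight (pos v) (pos w)) with hc'
  have h0 : curve' s(v, w) = straight (pos v) (pos w) := update_self ..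
  have h1 : RACOn S E pos curve' := h.congr (fun _ _ => rfl)
    fun e he => update_of_ne (hne e he) _ _
  have hint : ∀ z ∈ (curve' s(v, w)).interior, z ∈ openSegment ℝ (pos v) (pos w) := by
    intro z hz
    rw [h0, Polyline.interior, straight_carrier, ← insert_endpoints_openSegment] at hz
    simp at hz
    tauto
  have hE' : ∀ e ∈ E, ∀ z ∈ openSegment ℝ (pos v) (pos w), z ∈ (curve' e).carrier →
      ∃ i, z ∈ (curve' e).openSeg i ∧ inner ℝ ((curve' e).dir i) (pos w - pos v) = 0 := by
    intro e he
    have : curve' e = curve e := update_of_ne (hne e he) _ _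
    rw [this]; exact hE e he
  have hdir : ∀ z ∈ openSegment ℝ (pos v) (pos w), ∃ i, z ∈ (curve' s(v, w)).openSeg i ∧
      (curve' s(v, w)).dir i = pos w - pos v := by
    rw [h0]; exact fun z hz => ⟨⟨0, by simp⟩, by rwa [straight_openSeg], straight_dir ..⟩
  refine ⟨h.inj, ?_, ?_, ?_, ?_, ?_⟩
  · rintro e (rfl | he) u hu
    · rcases Sym2.mem_iff.1 hu with rfl | rfl <;> assumption
    · exact h.mem e he u hu
  · rintro e (rfl | he)
    · rw [h0]; exact straight_proper hp
    · exact h1.proper e he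
  · rintro e (rfl | he)
    · rw [h0]; rfl
    · exact h1.joins e he
  · rintro u hu e (rfl | he) hue
    · rw [h0, straight_carrier, ← insert_endpoints_openSegment]
      simp only [Sym2.mem_iff, not_or] at hue
      rintro (h | h | h')
      · exact hue.1 (h1.inj hu hv h)
      · exact hue.2 (h1.inj hu hw h)
      · exact hS u hu h'
    · exact h1.avoids u hu e he hue
  · rintro e (rfl | he) f (rfl | hf) hef z ⟨hze, hzf⟩
    · exact absurd rfl hef
    · obtain ⟨i, hi, hi'⟩ := hE' f hf z (hint z hze) hzf.1
      obtain ⟨k, hk, hk'⟩ := hdir z (hint z hze)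
      exact ⟨k, i, hk, hi, by rw [hk', real_inner_comm, hi']⟩
    · obtain ⟨i, hi, hi'⟩ := hE' e he z (hint z hzf) hze.1
      obtain ⟨k, hk, hk'⟩ := hdir z (hint z hzf)
      exact ⟨i, k, hi, hk, by rw [hk', hi']⟩
    · exact h1.rac e he f hf hef z ⟨hze, hzf⟩

end RACOn

end BRAC

namespace BRAC

open Set Function Polyline

variable {V : Type*} {S S' S₁ S₂ : Set V} {E E' E₁ E₂ : Set (Sym2 V)}
  {pos pos' pos₁ pos₂ : V → Plane} {curve curve' curve₁ curve₂ : Sym2 V → Polyline} {a b : Plane}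

/-! ### Extensions by straight edges -/

/-- The second drawing extends the first one by straight edges. -/
structure StraightExt (S : Set V) (E : Set (Sym2 V)) (pos : V → Plane) (curve : Sym2 V → Polyline)
    (S' : Set V) (E' : Set (Sym2 V)) (pos' : V → Plane) (curve' : Sym2 V → Polyline) : Prop where
  sub : S ⊆ S'
  subE : E ⊆ E'
  pos_eq : ∀ v ∈ S, pos' v = pos v
  curve_eq : ∀ e ∈ E, curve' e = curve e
  straight : ∀ e ∈ E', e ∉ E → (curve' e).bends = 0

theorem StraightExt.refl : StraightExt S E pos curve S E pos curve :=
  ⟨Subset.rfl, Subset.rfl, fun _ _ => rfl, fun _ _ => rfl, fun _ h h' => absurd h h'⟩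

theorem StraightExt.trans (h : StraightExt S E pos curve S₁ E₁ pos₁ curve₁)
    (h' : StraightExt S₁ E₁ pos₁ curve₁ S₂ E₂ pos₂ curve₂) :
    StraightExt S E pos curve S₂ E₂ pos₂ curve₂ where
  sub := h.sub.trans h'.sub
  subE := h.subE.trans h'.subE
  pos_eq v hv := (h'.pos_eq v (h.sub hv)).trans (h.pos_eq v hv)
  curve_eq e he := (h'.curve_eq e (h.subE he)).trans (h.curve_eq e he)
  straight e he hne := by
    by_cases h1 : e ∈ E₁
    · rw [h'.curve_eq e h1]; exact h.straight e h1 hne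
    · exact h'.straight e he h1

theorem RACOn.leaf [DecidableEq V] (h : RACOn S E pos curve) {v w : V} {q : Plane} (hv : v ∈ S)
    (hw : w ∉ S) (hq : q ∉ pos '' S) (hqE : ∀ e ∈ E, q ∉ (curve e).carrier)
    (hS : ∀ u ∈ S, pos u ∉ openSegment ℝ (pos v) q)
    (hE : ∀ e ∈ E, ∀ z ∈ openSegment ℝ (pos v) q, z ∈ (curve e).carrier →
      ∃ i, z ∈ (curve e).openSeg i ∧ inner ℝ ((curve e).dir i) (q - pos v) = 0) :
    RACOn (insert w S) (insert s(v, w) E) (update pos w q)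
      (update curve s(v, w) (straight (pos v) q)) ∧
    StraightExt S E pos curve (insert w S) (insert s(v, w) E) (update pos w q)
      (update curve s(v, w) (straight (pos v) q)) := by
  have hvw : v ≠ w := ne_of_mem_of_not_mem hv hw
  have hn : s(v, w) ∉ E := fun hc => hw (h.mem _ hc w (by simp))
  have hpv : ∀ u ∈ S, update pos w q u = pos u := fun u hu =>
    update_of_ne (ne_of_mem_of_not_mem hu hw) _ _
  have hpw : update pos w q w = q := update_self ..
  have h1 := h.place hw hq hqE
  have h2 := h1.join (v := v) (w := w) (mem_insert_of_mem _ hv) (mem_insert _ _) hvw hn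
    (by
      rw [hpv v hv, hpw]
      rintro u (rfl | hu)
      · rw [hpw, right_mem_openSegment_iff]
        rintro rfl; exact hq ⟨v, hv, rfl⟩
      · rw [hpv u hu]; exact hS u hu)
    (by rw [hpv v hv, hpw]; exact hE)
  rw [hpv v hv, hpw] at h2
  refine ⟨h2, subset_insert _ _, subset_insert _ _, hpv, fun e he => ?_, ?_⟩
  · exact update_of_ne (ne_of_mem_of_not_mem he hn) _ _
  · rintro e (rfl | he) hne
    · rw [update_self]; rfl
    · exact absurd he hne

theorem mem_openSegment_iff' {a b z : Plane} :
    z ∈ openSegment ℝ a b ↔ ∃ s : ℝ, 0 < s ∧ s < 1 ∧ z = a + s • (b - a) := by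
  rw [openSegment_eq_image']
  exact ⟨fun ⟨s, hs, h⟩ => ⟨s, hs.1, hs.2, h.symm⟩, fun ⟨s, h0, h1, h⟩ => ⟨s, ⟨h0, h1⟩, h.symm⟩⟩

theorem mem_segment_iff' {a b z : Plane} :
    z ∈ segment ℝ a b ↔ ∃ s : ℝ, 0 ≤ s ∧ s ≤ 1 ∧ z = a + s • (b - a) := by
  rw [segment_eq_image']
  exact ⟨fun ⟨s, hs, h⟩ => ⟨s, hs.1, hs.2, h.symm⟩, fun ⟨s, h0, h1, h⟩ => ⟨s, ⟨h0, h1⟩, h.symm⟩⟩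

/-- The new part of an extension lies below the level `c` of the functional `f`. -/
structure Below (f : Plane →ₗ[ℝ] ℝ) (c : ℝ) (S : Set V) (E : Set (Sym2 V)) (S' : Set V)
    (E' : Set (Sym2 V)) (pos' : V → Plane) (curve' : Sym2 V → Polyline) : Prop where
  vertex : ∀ v ∈ S', v ∉ S → f (pos' v) ≤ c
  edge : ∀ e ∈ E', e ∉ E → ∀ z ∈ (curve' e).carrier, f z ≤ c

theorem Below.refl (f : Plane →ₗ[ℝ] ℝ) (c : ℝ) : Below f c S E S E pos curve :=
  ⟨fun _ h h' => absurd h h', fun _ h h' => absurd h h'⟩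

/-- Continue a path, which is monotone in the functional `f`, by a straight edge. -/
theorem RACOn.step [DecidableEq V] {f : Plane →ₗ[ℝ] ℝ} (h₁ : RACOn S₁ E₁ pos₁ curve₁)
    (hx : StraightExt S E pos curve S₁ E₁ pos₁ curve₁) {v w : V} {q : Plane}
    (hb : Below f (f (pos₁ v)) S E S₁ E₁ pos₁ curve₁) (hv : v ∈ S₁) (hw : w ∉ S₁)
    (hf : f (pos₁ v) < f q)
    (hq : ∀ u ∈ S, pos u ≠ q) (hqE : ∀ e ∈ E, q ∉ (curve e).carrier)
    (hS : ∀ u ∈ S, pos u ∉ openSegment ℝ (pos₁ v) q)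
    (hE : ∀ e ∈ E, ∀ z ∈ openSegment ℝ (pos₁ v) q, z ∈ (curve e).carrier →
      ∃ i, z ∈ (curve e).openSeg i ∧ inner ℝ ((curve e).dir i) (q - pos₁ v) = 0) :
    RACOn (insert w S₁) (insert s(v, w) E₁) (update pos₁ w q)
      (update curve₁ s(v, w) (Polyline.straight (pos₁ v) q)) ∧
    StraightExt S E pos curve (insert w S₁) (insert s(v, w) E₁) (update pos₁ w q)
      (update curve₁ s(v, w) (Polyline.straight (pos₁ v) q)) ∧
    Below f (f q) S E (insert w S₁) (insert s(v, w) E₁) (update pos₁ w q)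
      (update curve₁ s(v, w) (Polyline.straight (pos₁ v) q)) := by
  -- `f` increases strictly along the new edge, and everything added so far lies at or below the
  -- level `f (pos₁ v)`. Hence the new edge can only collide with the original drawing, where the
  -- hypotheses apply.
  have hseg : ∀ z ∈ openSegment ℝ (pos₁ v) q, f (pos₁ v) < f z ∧ f z < f q := by
    intro z hz
    obtain ⟨s, h0, h1, rfl⟩ := mem_openSegment_iff'.1 hz
    simp only [map_add, map_smul, map_sub, smul_eq_mul]
    constructor <;> nlinarith
  have key := h₁.leaf hv hw (q := q)
    (by
      rintro ⟨u, hu, rfl⟩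
      by_cases h : u ∈ S
      · exact hq u h (hx.pos_eq u h).symm
      · exact absurd (hb.vertex u hu h) (not_le.2 hf))
    (by
      intro e he hc
      by_cases h : e ∈ E
      · rw [hx.curve_eq e h] at hc; exact hqE e h hc
      · exact absurd (hb.edge e he h _ hc) (not_le.2 hf))
    (by
      intro u hu hc
      by_cases h : u ∈ S
      · rw [hx.pos_eq u h] at hc; exact hS u h hc
      · exact absurd (hb.vertex u hu h) (not_le.2 (hseg _ hc).1))
    (by
      intro e he z hz hc
      by_cases h : e ∈ E
      · rw [hx.curve_eq e h] at hc ⊢; exact hE e h z hz hc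
      · exact absurd (hb.edge e he h _ hc) (not_le.2 (hseg _ hz).1))
  refine ⟨key.1, hx.trans key.2, ?_, ?_⟩
  · rintro u (rfl | hu) hus
    · rw [update_self]
    · rw [update_of_ne (ne_of_mem_of_not_mem hu hw)]
      exact (hb.vertex u hu hus).trans hf.le
  · rintro e (rfl | he) hes z hz
    · rw [update_self, straight_carrier, ← insert_endpoints_openSegment] at hz
      rcases hz with rfl | rfl | hz
      exacts [hf.le, le_rfl, (hseg z hz).2.le]
    · rw [key.2.curve_eq e he] at hz
      exact (hb.edge e he hes z hz).trans hf.le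

/-! ### Transversal segments -/

/-- The open segment from `a` to `b` avoids the vertices and crosses the edges transversally, in
simple points. -/
structure Transversal (S : Set V) (E : Set (Sym2 V)) (pos : V → Plane) (curve : Sym2 V → Polyline)
    (a b : Plane) : Prop where
  ne : a ≠ b
  vertex : ∀ v ∈ S, pos v ∉ openSegment ℝ a b
  edge : ∀ z ∈ openSegment ℝ a b, ∀ e ∈ E, z ∈ (curve e).carrier →
    (∃ i, z ∈ (curve e).openSeg i ∧ cross ((curve e).dir i) (b - a) ≠ 0) ∧
      ∀ f ∈ E, f ≠ e → z ∉ (curve f).carrier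

/-- The points of the open segment from `a` to `b` on the drawing. -/
def crossings (E : Set (Sym2 V)) (curve : Sym2 V → Polyline) (a b : Plane) : Set Plane :=
  {z | z ∈ openSegment ℝ a b ∧ ∃ e ∈ E, z ∈ (curve e).carrier}

theorem cross_smul_left (s : ℝ) (u v : Plane) : cross (s • u) v = s * cross u v := by
  simp [cross]; ring

theorem cross_smul_right (s : ℝ) (u v : Plane) : cross u (s • v) = s * cross u v := by
  simp [cross]; ring

theorem cross_sub_left (u u' v : Plane) : cross (u - u') v = cross u v - cross u' v := by
  simp [cross]; ring

theorem cross_self (u : Plane) : cross u u = 0 := by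
  simp [cross]; ring

theorem cross_comm (u v : Plane) : cross u v = - cross v u := by
  simp [cross]; ring

/-- Nonparallel segments have at most one common point. -/
theorem eq_of_mem_segments {a b a' b' z z' : Plane} (h : cross (b' - a') (b - a) ≠ 0)
    (hz : z ∈ segment ℝ a b) (hz' : z' ∈ segment ℝ a b) (hw : z ∈ segment ℝ a' b')
    (hw' : z' ∈ segment ℝ a' b') : z = z' := by
  obtain ⟨s, -, -, hs⟩ := mem_segment_iff'.1 hz
  obtain ⟨s', -, -, hs'⟩ := mem_segment_iff'.1 hz'
  obtain ⟨t, -, -, ht⟩ := mem_segment_iff'.1 hw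
  obtain ⟨t', -, -, ht'⟩ := mem_segment_iff'.1 hw'
  have e1 : z - z' = (s - s') • (b - a) := by rw [hs, hs', sub_smul]; abel
  have e2 : z - z' = (t - t') • (b' - a') := by rw [ht, ht', sub_smul]; abel
  have e3 : (t - t') * cross (b' - a') (b - a) = 0 := by
    rw [← cross_smul_left, ← e2, e1, cross_smul_left, cross_self, mul_zero]
  rcases mul_eq_zero.1 e3 with h0 | h0
  · rw [h0, zero_smul, sub_eq_zero] at e2; exact e2
  · exact absurd h0 h

theorem openSegment_sub_segment {a b z : Plane} (h : z ∈ openSegment ℝ a b) : z ∈ segment ℝ a b :=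
  openSegment_subset_segment ℝ _ _ h

/-- A transversal segment has at most one crossing with each segment of the drawing. -/
theorem Transversal.crossings_ncard (h : Transversal S E pos curve a b) {F : Finset (Sym2 V)}
    (hF : (F : Set (Sym2 V)) = E) :
    (crossings E curve a b).Finite ∧
      (crossings E curve a b).ncard ≤ ∑ e ∈ F, ((curve e).bends + 1) := by
  classical
  have hex : ∀ z : crossings E curve a b, ∃ k : (Σ e : F, Fin ((curve e).bends + 1)),
      (z : Plane) ∈ (curve k.1).openSeg k.2 ∧ cross ((curve k.1).dir k.2) (b - a) ≠ 0 := by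
    rintro ⟨z, hz, e, he, hc⟩
    obtain ⟨⟨i, hi, hi'⟩, -⟩ := h.edge z hz e he hc
    exact ⟨⟨⟨e, by rw [← Finset.mem_coe, hF]; exact he⟩, i⟩, hi, hi'⟩
  choose g hg hg' using hex
  -- Two crossings assigned to the same segment of the drawing would be two common points of
  -- nonparallel segments.
  have hinj : Injective g := by
    intro z z' hzz
    have h1 := hg z
    have h2 := hg z'
    rw [← hzz] at h2
    exact Subtype.ext (eq_of_mem_segments (hg' z) (openSegment_sub_segment z.2.1)
      (openSegment_sub_segment z'.2.1) (openSegment_sub_segment h1) (openSegment_sub_segment h2))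
  have hfin : Finite (crossings E curve a b) := Finite.of_injective g hinj
  refine ⟨hfin, ?_⟩
  rw [← Nat.card_coe_set_eq]
  refine (Nat.card_le_card_of_injective g hinj).trans ?_
  rw [Nat.card_eq_fintype_card, Fintype.card_sigma]
  simp only [Fintype.card_fin]
  rw [Finset.sum_coe_sort F fun e => (curve e).bends + 1]

end BRAC

/-! ### Drawing an initial part of a transversal segment -/

namespace BRAC

open Set Function Polyline

variable {V : Type*} {S S' S₁ S₂ : Set V} {E E' E₁ E₂ : Set (Sym2 V)}
  {pos pos' pos₁ pos₂ : V → Plane} {curve curve' curve₁ curve₂ : Sym2 V → Polyline} {a b : Plane}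

/-- An extension by straight edges which, within the set `Z`, adds only parts of the segment
from `a` to `b`, and no vertices. -/
structure Routed (Z : Set Plane) (a b : Plane) (S : Set V) (E : Set (Sym2 V)) (pos : V → Plane)
    (curve : Sym2 V → Polyline) (S' : Set V) (E' : Set (Sym2 V)) (pos' : V → Plane)
    (curve' : Sym2 V → Polyline) : Prop extends StraightExt S E pos curve S' E' pos' curve' where
  rac : RACOn S' E' pos' curve'
  vertex : ∀ v ∈ S', v ∉ S → pos' v ∉ Z
  edge : ∀ e ∈ E', e ∉ E → (∀ z ∈ (curve' e).carrier, z ∉ Z) ∨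
    ∃ a' b', curve' e = Polyline.straight a' b' ∧ a' ∈ segment ℝ a b ∧ b' ∈ segment ℝ a b ∧
      ∃ c : ℝ, c ≠ 0 ∧ b' - a' = c • (b - a)

/-- The second routing starts at a point of the open segment, so its pieces stay on the original
segment; their directions change only by the factor `1 - s ≠ 0`. -/
theorem Routed.trans {Z : Set Plane} {a₁ : Plane}
    (h : Routed Z a b S E pos curve S₁ E₁ pos₁ curve₁)
    (h' : Routed Z a₁ b S₁ E₁ pos₁ curve₁ S₂ E₂ pos₂ curve₂) (ha : a₁ ∈ openSegment ℝ a b) :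
    Routed Z a b S E pos curve S₂ E₂ pos₂ curve₂ where
  toStraightExt := h.toStraightExt.trans h'.toStraightExt
  rac := h'.rac
  vertex v hv hvS := by
    by_cases h1 : v ∈ S₁
    · rw [h'.pos_eq v h1]; exact h.vertex v h1 hvS
    · exact h'.vertex v hv h1
  edge e he heE := by
    by_cases h1 : e ∈ E₁
    · rw [h'.curve_eq e h1]; exact h.edge e h1 heE
    · refine (h'.edge e he h1).imp id ?_
      rintro ⟨a', b', h2, h3, h4, c, hc, h5⟩
      have hsub : segment ℝ a₁ b ⊆ segment ℝ a b :=
        (convex_segment a b).segment_subset (openSegment_sub_segment ha) (right_mem_segment ℝ _ _)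
      obtain ⟨s, hs0, hs1, rfl⟩ := mem_openSegment_iff'.1 ha
      refine ⟨a', b', h2, hsub h3, hsub h4, c * (1 - s), mul_ne_zero hc (by linarith), ?_⟩
      rw [h5]; module

/-- What is left of a transversal segment after its first part has been drawn. -/
theorem Transversal.tail {f : Plane →ₗ[ℝ] ℝ} {q : Plane} (h : Transversal S E pos curve a b)
    (hx : StraightExt S E pos curve S₁ E₁ pos₁ curve₁)
    (hb : Below f (f q) S E S₁ E₁ pos₁ curve₁) (hq : q ∈ openSegment ℝ a b) (hf : f a < f b) :
    Transversal S₁ E₁ pos₁ curve₁ q b ∧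
      ∀ z ∈ crossings E₁ curve₁ q b, z ∈ crossings E curve a b ∧ f q < f z := by
  obtain ⟨s, hs0, hs1, hs⟩ := mem_openSegment_iff'.1 hq
  have e1 : b - q = (1 - s) • (b - a) := by rw [hs]; module
  have hpos : 0 < f b - f a := sub_pos.2 hf
  have hfq : f q < f b := by
    rw [hs]; simp only [map_add, map_smul, map_sub, smul_eq_mul]; nlinarith
  have hsub : ∀ z ∈ openSegment ℝ q b, z ∈ openSegment ℝ a b ∧ f q < f z := by
    intro z hz
    obtain ⟨t, ht0, ht1, rfl⟩ := mem_openSegment_iff'.1 hz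
    constructor
    · refine mem_openSegment_iff'.2 ⟨s + t * (1 - s), by nlinarith, by nlinarith, ?_⟩
      rw [e1, hs]; module
    · simp only [map_add, map_smul, map_sub, smul_eq_mul]; nlinarith
  -- The added part lies at or below the level `f q` and the rest of the segment strictly above it,
  -- so only old edges can meet the rest.
  have hold : ∀ z ∈ openSegment ℝ q b, ∀ e ∈ E₁, z ∈ (curve₁ e).carrier →
      e ∈ E ∧ z ∈ (curve e).carrier := by
    intro z hz e he hc
    by_cases h1 : e ∈ E
    · exact ⟨h1, by rwa [← hx.curve_eq e h1]⟩
    · exact absurd (hb.edge e he h1 z hc) (not_le.2 (hsub z hz).2)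
  refine ⟨⟨fun e => by rw [e] at hfq; exact lt_irrefl _ hfq, ?_, ?_⟩, ?_⟩
  · intro v hv hc
    by_cases h1 : v ∈ S
    · rw [hx.pos_eq v h1] at hc; exact h.vertex v h1 (hsub _ hc).1
    · exact absurd (hb.vertex v hv h1) (not_le.2 (hsub _ hc).2)
  · intro z hz e he hc
    obtain ⟨heE, hcE⟩ := hold z hz e he hc
    obtain ⟨⟨i, hi, hi'⟩, huniq⟩ := h.edge z (hsub z hz).1 e heE hcE
    refine ⟨?_, fun g hg hge hgz => ?_⟩
    · rw [hx.curve_eq e heE]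
      refine ⟨i, hi, ?_⟩
      rw [e1, cross_smul_right]
      exact mul_ne_zero (by linarith) hi'
    · obtain ⟨hgE, hgc⟩ := hold z hz g hg hgz
      exact huniq g hgE hge hgc
  · rintro z ⟨hz, e, he, hc⟩
    obtain ⟨heE, hcE⟩ := hold z hz e he hc
    exact ⟨⟨(hsub z hz).1, e, heE, hcE⟩, (hsub z hz).2⟩

/-- Draw an initial part of a transversal segment that is free of crossings. -/
theorem RACOn.advance [DecidableEq V] {Z : Set Plane} (h : RACOn S E pos curve) {x w : V}
    {q : Plane} (hx : x ∈ S) (hw : w ∉ S) (ht : Transversal S E pos curve (pos x) b)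
    (hq : q ∈ openSegment ℝ (pos x) b) (hqZ : q ∉ Z)
    (hc : ∀ z ∈ crossings E curve (pos x) b, z ≠ q ∧ z ∉ openSegment ℝ (pos x) q) :
    ∃ pos' curve', Routed Z (pos x) b S E pos curve (insert w S) (insert s(x, w) E) pos' curve' ∧
      pos' w = q ∧ Transversal (insert w S) (insert s(x, w) E) pos' curve' q b ∧
      crossings (insert s(x, w) E) curve' q b ⊆ crossings E curve (pos x) b := by
  set d := b - pos x with hd
  have hd0 : d ≠ 0 := sub_ne_zero.2 ht.ne.symm
  -- Progress is measured along the direction of the segment itself, which suffices as long as the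
  -- path does not leave it.
  let f : Plane →ₗ[ℝ] ℝ := innerₛₗ ℝ d
  have hfd : 0 < f d := by
    show 0 < inner ℝ d d
    exact real_inner_self_pos.2 hd0
  obtain ⟨s, hs0, hs1, hs⟩ := mem_openSegment_iff'.1 hq
  have hsub : ∀ z ∈ openSegment ℝ (pos x) q, z ∈ openSegment ℝ (pos x) b := by
    intro z hz
    obtain ⟨t, ht0, ht1, rfl⟩ := mem_openSegment_iff'.1 hz
    refine mem_openSegment_iff'.2 ⟨t * s, by positivity, by nlinarith, ?_⟩
    rw [hs]; module
  have hno : ∀ z ∈ openSegment ℝ (pos x) q, ∀ e ∈ E, z ∉ (curve e).carrier := fun z hz e he hze =>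
    (hc z ⟨hsub z hz, e, he, hze⟩).2 hz
  have hfq : f (pos x) < f q := by
    rw [hs, map_add, map_smul, smul_eq_mul]; nlinarith
  have hfb : f (pos x) < f b := by
    have : f b = f (pos x) + f d := by rw [hd, map_sub]; ring
    linarith
  obtain ⟨h1, h2, h3⟩ := h.step (f := f) StraightExt.refl (Below.refl f _) hx hw hfq
    (fun u hu e => ht.vertex u hu (e ▸ hq)) (fun e he hqe => (hc q ⟨hq, e, he, hqe⟩).1 rfl)
    (fun u hu hz => ht.vertex u hu (hsub _ hz))
    (fun e he z hz hze => absurd hze (hno z hz e he))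
  obtain ⟨h4, h5⟩ := ht.tail h2 h3 hq hfb
  refine ⟨_, _, ⟨h2, h1, ?_, ?_⟩, update_self .., h4, fun z hz => (h5 z hz).1⟩
  · rintro v (rfl | hv) hvS
    · rw [update_self]; exact hqZ
    · exact absurd hv hvS
  · rintro e (rfl | he) heE
    · right
      refine ⟨pos x, q, update_self .., left_mem_segment ℝ _ _, openSegment_sub_segment hq, s,
        hs0.ne', ?_⟩
      rw [hs]; module
    · exact absurd he heE

/-- The component of `d` orthogonal to `t`. -/
noncomputable def orthPart (d t : Plane) : Plane := d - (inner ℝ t d / inner ℝ t t) • t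

theorem inner_orthPart (d t : Plane) (ht : t ≠ 0) : inner ℝ t (orthPart d t) = 0 := by
  have : inner ℝ t t ≠ (0 : ℝ) := (real_inner_self_pos.2 ht).ne'
  rw [orthPart, inner_sub_right, inner_smul_right]; field_simp; ring

theorem orthPart_ne_zero {d t : Plane} (h : cross t d ≠ 0) : orthPart d t ≠ 0 := by
  intro h0
  apply h
  rw [cross_comm, sub_eq_zero.1 h0, cross_smul_left, cross_self]; simp

/-- The vector `d` and its orthogonal part differ by a multiple of `t`, which is orthogonal to the
latter. The functional that controls a detour therefore takes the same value on the two directions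
used there. -/
theorem inner_orthPart_left (d t : Plane) (ht : t ≠ 0) :
    inner ℝ (orthPart d t) d = inner ℝ (orthPart d t) (orthPart d t) := by
  have h := inner_orthPart d t ht
  rw [real_inner_comm] at h
  have e : d = orthPart d t + (inner ℝ t d / inner ℝ t t) • t := by rw [orthPart]; module
  have e' := congrArg (inner ℝ (orthPart d t)) e
  rw [inner_add_right, inner_smul_right, h, mul_zero, add_zero] at e'
  exact e'

/-- Near a simple crossing the drawing is a part of a line. -/
theorem Transversal.locally_line (h : RACOn S E pos curve) (ht : Transversal S E pos curve a b)
    (hS : S.Finite) (hE : E.Finite) {Z : Set Plane} (hZ : IsClosed Z) {p : Plane}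
    (hp : p ∈ openSegment ℝ a b) (hpZ : p ∉ Z) {e₀ : Sym2 V} (he₀ : e₀ ∈ E) {i₀}
    (hi₀ : p ∈ (curve e₀).openSeg i₀) {f : Plane →ₗ[ℝ] ℝ} (hf : f ((curve e₀).dir i₀) = 0) :
    ∃ ρ > 0, ∀ z, dist z p < ρ → z ∉ Z ∧ (∀ u ∈ S, pos u ≠ z) ∧
      ∀ e ∈ E, z ∈ (curve e).carrier → f z = f p := by
  have hpe : p ∈ (curve e₀).carrier :=
    (curve e₀).seg_subset_carrier i₀ ((curve e₀).openSeg_subset_seg i₀ hi₀)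
  have huniq := (ht.edge p hp e₀ he₀ hpe).2
  have h1 : ∀ᶠ z in nhds p, z ∉ Z := hZ.isOpen_compl.mem_nhds hpZ
  have h2 : ∀ᶠ z in nhds p, ∀ u ∈ S, pos u ≠ z := by
    rw [Filter.eventually_all_finite hS]
    intro u hu
    have : pos u ≠ p := fun e => ht.vertex u hu (e ▸ hp)
    filter_upwards [isOpen_ne.mem_nhds this.symm] with z hz using hz.symm
  have h3 : ∀ᶠ z in nhds p, ∀ e ∈ E, z ∈ (curve e).carrier → f z = f p := by
    rw [Filter.eventually_all_finite hE]
    intro e he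
    by_cases hee : e = e₀
    · subst hee
      -- All other segments of the crossed edge are closed sets that miss `p`, since `p` is an inner
      -- point of the segment `i₀`.
      have : ∀ᶠ z in nhds p, ∀ i, i ≠ i₀ → z ∉ (curve e).seg i := by
        rw [Filter.eventually_all]
        intro i
        by_cases hi : i = i₀
        · simp [hi]
        · have : p ∉ (curve e).seg i := fun hc => hi ((h.proper e he).eq_of_mem hi₀ hc).symm
          filter_upwards [((curve e).isClosed_seg i).isOpen_compl.mem_nhds this] with z hz _ using hz
      filter_upwards [this] with z hz hzc
      obtain ⟨i, hi⟩ := mem_iUnion.1 hzc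
      have hii : i = i₀ := by
        by_contra hne
        exact hz i hne hi
      subst hii
      obtain ⟨s, -, -, hs⟩ := mem_segment_iff'.1 hi
      obtain ⟨t, -, -, ht⟩ := mem_openSegment_iff'.1 hi₀
      have hf' : f ((curve e).pt i.succ - (curve e).pt i.castSucc) = 0 := hf
      rw [hs, ht, map_add, map_add, map_smul, map_smul, hf', smul_zero, smul_zero]
    · filter_upwards [((curve e).isClosed_carrier).isOpen_compl.mem_nhds (huniq e he hee)]
        with z hz hzc using absurd hzc hz
  obtain ⟨ρ, hρ, hball⟩ := Metric.eventually_nhds_iff.1 (h1.and (h2.and h3))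
  exact ⟨ρ, hρ, fun z hz => hball hz⟩

end BRAC

/-! ### The right-angle detour at a crossing -/

namespace BRAC

open Set Function Polyline

variable {V : Type*} {S S' S₁ S₂ : Set V} {E E' E₁ E₂ : Set (Sym2 V)}
  {pos pos' pos₁ pos₂ : V → Plane} {curve curve' curve₁ curve₂ : Sym2 V → Polyline} {a b : Plane}

theorem openSegment_subset_ball {p u v : Plane} {ρ : ℝ} (hu : dist u p < ρ) (hv : dist v p < ρ) :
    ∀ z ∈ openSegment ℝ u v, dist z p < ρ := fun _ hz =>
  (convex_ball p ρ).segment_subset hu hv (openSegment_sub_segment hz)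

set_option maxHeartbeats 1600000 in
/-- Draw a transversal segment up to a point behind its first crossing, at which the path makes a
detour through a right angle. -/
theorem RACOn.hop [DecidableEq V] {Z : Set Plane} (h : RACOn S E pos curve) (hSf : S.Finite)
    (hEf : E.Finite) (hZ : IsClosed Z) {x w₁ w₂ w₃ w₄ : V} (hx : x ∈ S)
    (hw : ([w₁, w₂, w₃, w₄] : List V).Nodup) (hwS : ∀ w ∈ ([w₁, w₂, w₃, w₄] : List V), w ∉ S)
    (ht : Transversal S E pos curve (pos x) b) {p : Plane} (hp : p ∈ crossings E curve (pos x) b)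
    (hmin : ∀ z ∈ crossings E curve (pos x) b, dist (pos x) p ≤ dist (pos x) z) (hpZ : p ∉ Z) :
    ∃ q pos' curve', Routed Z (pos x) b S E pos curve (insert w₄ (insert w₃ (insert w₂ (insert w₁ S))))
        (insert s(w₃, w₄) (insert s(w₂, w₃) (insert s(w₁, w₂) (insert s(x, w₁) E)))) pos' curve' ∧
      pos' w₄ = q ∧ q ∈ openSegment ℝ (pos x) b ∧
      Transversal (insert w₄ (insert w₃ (insert w₂ (insert w₁ S))))
        (insert s(w₃, w₄) (insert s(w₂, w₃) (insert s(w₁, w₂) (insert s(x, w₁) E)))) pos' curve' q b ∧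
      crossings (insert s(w₃, w₄) (insert s(w₂, w₃) (insert s(w₁, w₂) (insert s(x, w₁) E)))) curve' q b
        ⊆ crossings E curve (pos x) b \ {p} := by
  set a := pos x with ha
  set d := b - a with hd
  have hd0 : d ≠ 0 := sub_ne_zero.2 ht.ne.symm
  obtain ⟨hpo, e₀, he₀, hpe⟩ := hp
  obtain ⟨⟨i₀, hi₀, hcr⟩, huniq⟩ := ht.edge p hpo e₀ he₀ hpe
  set t := (curve e₀).dir i₀ with htdef
  have ht0 : t ≠ 0 := by
    intro h0; apply hcr; rw [h0]; simp [cross]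
  set d' := orthPart d t with hd'
  have hd'0 : d' ≠ 0 := orthPart_ne_zero hcr
  have horth : inner ℝ t d' = 0 := inner_orthPart d t ht0
  -- `f` vanishes on `t`, so the crossed segment lies on the level line of `p`. The path through
  -- `a`, `A`, `B`, `C`, `D` will be strictly increasing in `f`, which rules out self-crossings and
  -- leaves only the edge from `B` to `C` to pass that line.
  let f : Plane →ₗ[ℝ] ℝ := innerₛₗ ℝ d'
  have hft : f t = 0 := by
    show inner ℝ d' t = 0
    rw [real_inner_comm]; exact horth
  obtain ⟨ρ, hρ, hball⟩ := ht.locally_line h hSf hEf hZ hpo hpZ he₀ hi₀ (f := f) hft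
  set N := f d' with hN
  have hN0 : 0 < N := real_inner_self_pos.2 hd'0
  have hfd : f d = N := inner_orthPart_left d t ht0
  obtain ⟨τ, hτ0, hτ1, hτ⟩ := mem_openSegment_iff'.1 hpo
  -- `A`, `D` are displaced from `p` by `2δ` along `d` and `B`, `C` by `δ` along `d'`. As `f` agrees
  -- on `d` and `d'`, the factor two puts the levels of `B` and `C` strictly between those of `A`
  -- and `D`. The bounds by `τ` keep `A` and `D` on the segment, those by `ρ` keep all four corners
  -- near `p`.
  obtain ⟨δ, hδ0, hδτ, hδτ', hδd, hδd'⟩ : ∃ δ : ℝ, 0 < δ ∧ 2 * δ < τ ∧ 2 * δ < 1 - τ ∧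
      2 * δ * ‖d‖ < ρ ∧ δ * ‖d'‖ < ρ := by
    have hn := norm_nonneg d
    have hn' := norm_nonneg d'
    have hM : 0 < ‖d‖ + ‖d'‖ + 1 := by positivity
    set m := min (min τ (1 - τ)) (ρ / (‖d‖ + ‖d'‖ + 1)) with hm
    have h1 : m ≤ τ := (min_le_left _ _).trans (min_le_left _ _)
    have h2 : m ≤ 1 - τ := (min_le_left _ _).trans (min_le_right _ _)
    have h3 : m ≤ ρ / (‖d‖ + ‖d'‖ + 1) := min_le_right _ _
    have h0 : 0 < m := lt_min (lt_min hτ0 (by linarith)) (by positivity)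
    rw [le_div_iff₀ hM] at h3
    exact ⟨m / 4, by linarith, by linarith, by linarith, by nlinarith, by nlinarith⟩
  -- the four corners of the detour
  obtain ⟨A, hA⟩ : ∃ A, A = p - (2 * δ) • d := ⟨_, rfl⟩
  obtain ⟨B, hB⟩ : ∃ B, B = p - δ • d' := ⟨_, rfl⟩
  obtain ⟨C, hC⟩ : ∃ C, C = p + δ • d' := ⟨_, rfl⟩
  obtain ⟨D, hD⟩ : ∃ D, D = p + (2 * δ) • d := ⟨_, rfl⟩
  have fA : f A = f p - 2 * δ * N := by rw [hA, map_sub, map_smul, hfd]; simp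
  have fB : f B = f p - δ * N := by rw [hB, map_sub, map_smul]; simp [hN]
  have fC : f C = f p + δ * N := by rw [hC, map_add, map_smul]; simp [hN]
  have fD : f D = f p + 2 * δ * N := by rw [hD, map_add, map_smul, hfd]; simp
  have hδN : 0 < δ * N := mul_pos hδ0 hN0
  have hnd : ‖(2 * δ) • d‖ < ρ := by
    rw [norm_smul, Real.norm_of_nonneg (by linarith)]; exact hδd
  have hnd' : ‖δ • d'‖ < ρ := by
    rw [norm_smul, Real.norm_of_nonneg (by linarith)]; exact hδd'
  have bA : dist A p < ρ := by rw [hA, dist_eq_norm, sub_sub_cancel_left, norm_neg]; exact hnd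
  have bB : dist B p < ρ := by rw [hB, dist_eq_norm, sub_sub_cancel_left, norm_neg]; exact hnd'
  have bC : dist C p < ρ := by rw [hC, dist_eq_norm, add_sub_cancel_left]; exact hnd'
  have bD : dist D p < ρ := by rw [hD, dist_eq_norm, add_sub_cancel_left]; exact hnd
  have hAab : A ∈ openSegment ℝ a b := mem_openSegment_iff'.2
    ⟨τ - 2 * δ, by linarith, by linarith, by rw [hA, hτ]; module⟩
  have hDab : D ∈ openSegment ℝ a b := mem_openSegment_iff'.2
    ⟨τ + 2 * δ, by linarith, by linarith, by rw [hD, hτ]; module⟩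
  have hA_eq : A = a + (τ - 2 * δ) • d := by rw [hA, hτ]; module
  -- no crossing before `A`
  have hbefore : ∀ s : ℝ, 0 < s → s < τ → ∀ e ∈ E, a + s • d ∉ (curve e).carrier := by
    intro s hs0 hsτ e he hc
    have := hmin _ ⟨mem_openSegment_iff'.2 ⟨s, hs0, by linarith, rfl⟩, e, he, hc⟩
    rw [hτ, dist_self_add_right, dist_self_add_right, norm_smul, norm_smul,
      Real.norm_of_nonneg hτ0.le, Real.norm_of_nonneg hs0.le] at this
    have := le_of_mul_le_mul_right this (norm_pos_iff.2 hd0)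
    linarith
  have hoff : ∀ z, dist z p < ρ → f z ≠ f p → ∀ e ∈ E, z ∉ (curve e).carrier :=
    fun z hz hfz e he hc => hfz ((hball z hz).2.2 e he hc)
  have hseg : ∀ {u v z : Plane}, f u < f v → z ∈ openSegment ℝ u v → f u < f z ∧ f z < f v := by
    intro u v z huv hz
    obtain ⟨s, h0, h1, rfl⟩ := mem_openSegment_iff'.1 hz
    simp only [map_add, map_smul, map_sub, smul_eq_mul]
    constructor <;> nlinarith
  have hsub : ∀ z ∈ openSegment ℝ a A, ∃ s, 0 < s ∧ s < τ ∧ z = a + s • d := by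
    intro z hz
    obtain ⟨s, hs0, hs1, rfl⟩ := mem_openSegment_iff'.1 hz
    refine ⟨s * (τ - 2 * δ), mul_pos hs0 (by linarith), by nlinarith, ?_⟩
    rw [hA_eq]; module
  simp only [List.nodup_cons, List.mem_cons, List.not_mem_nil, or_false, not_or, not_false_eq_true,
    List.nodup_nil, and_true] at hw
  obtain ⟨⟨n12, n13, n14⟩, ⟨n23, n24⟩, n34⟩ := hw
  have hwS1 := hwS w₁ (by simp)
  have hwS2 := hwS w₂ (by simp)
  have hwS3 := hwS w₃ (by simp)
  have hwS4 := hwS w₄ (by simp)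
  have faA : f a < f A := by
    rw [hA_eq, map_add, map_smul, hfd, smul_eq_mul]; nlinarith
  have fab : f a < f b := by
    have : f b = f a + f d := by rw [hd, map_sub]; ring
    linarith
  obtain ⟨r1, x1, b1⟩ := h.step (f := f) StraightExt.refl (Below.refl f _) hx hwS1 (q := A) faA
    (fun u hu => (hball A bA).2.1 u hu) (hoff A bA (by linarith))
    (fun u hu hz => by
      obtain ⟨s, hs0, hs1, hs⟩ := hsub _ hz
      exact ht.vertex u hu (hs ▸ mem_openSegment_iff'.2 ⟨s, hs0, by linarith, rfl⟩))
    (fun e he z hz hc => by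
      obtain ⟨s, hs0, hs1, rfl⟩ := hsub _ hz
      exact absurd hc (hbefore s hs0 hs1 e he))
  have p1 : update pos w₁ A w₁ = A := update_self ..
  have hAB : f A < f B := by linarith
  obtain ⟨r2, x2, b2⟩ := r1.step (f := f) x1 (v := w₁) (w := w₂) (q := B) (by rw [p1]; exact b1)
    (mem_insert _ _) (by simp [hwS2, Ne.symm n12]) (by rw [p1]; exact hAB)
    (fun u hu => (hball B bB).2.1 u hu) (hoff B bB (by linarith))
    (fun u hu hz => by
      rw [p1] at hz
      exact (hball _ (openSegment_subset_ball bA bB _ hz)).2.1 u hu rfl)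
    (fun e he z hz hc => by
      rw [p1] at hz
      have := hseg hAB hz
      exact absurd hc (hoff z (openSegment_subset_ball bA bB _ hz) (by linarith) e he))
  rw [p1] at r2 x2 b2
  have p2 : update (update pos w₁ A) w₂ B w₂ = B := update_self ..
  have hBC : f B < f C := by linarith
  obtain ⟨r3, x3, b3⟩ := r2.step (f := f) x2 (v := w₂) (w := w₃) (q := C) (by rw [p2]; exact b2)
    (mem_insert _ _) (by simp [hwS3, Ne.symm n13, Ne.symm n23]) (by rw [p2]; exact hBC)
    (fun u hu => (hball C bC).2.1 u hu) (hoff C bC (by linarith))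
    (fun u hu hz => by
      rw [p2] at hz
      exact (hball _ (openSegment_subset_ball bB bC _ hz)).2.1 u hu rfl)
    (fun e he z hz hc => by
      rw [p2] at hz ⊢
      -- Near `p` the drawing lies on the level of `p`, which the edge from `B` to `C` attains only
      -- at its midpoint.
      have hzp : z = p := by
        have h1 := (hball z (openSegment_subset_ball bB bC _ hz)).2.2 e he hc
        obtain ⟨s, hs0, hs1, hs⟩ := mem_openSegment_iff'.1 hz
        have e1 : z = p + ((2 * s - 1) * δ) • d' := by rw [hs, hB, hC]; module
        rw [e1, map_add, map_smul, smul_eq_mul, ← hN] at h1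
        have h2 : (2 * s - 1) * (δ * N) = 0 := by linarith
        have h3 : 2 * s - 1 = 0 := (mul_eq_zero.1 h2).resolve_right hδN.ne'
        rw [e1, h3]; simp
      rw [hzp] at hc ⊢
      have hee : e = e₀ := by
        by_contra hne
        exact huniq e he hne hc
      rw [hee]
      refine ⟨i₀, hi₀, ?_⟩
      -- The middle edge of the detour has direction `d'`, which is orthogonal to the crossed
      -- segment.
      have : C - B = (2 * δ) • d' := by rw [hB, hC]; module
      rw [this, inner_smul_right, ← htdef, horth, mul_zero])
  rw [p2] at r3 x3 b3
  have p3 : update (update (update pos w₁ A) w₂ B) w₃ C w₃ = C := update_self ..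
  have hCD : f C < f D := by linarith
  obtain ⟨r4, x4, b4⟩ := r3.step (f := f) x3 (v := w₃) (w := w₄) (q := D) (by rw [p3]; exact b3)
    (mem_insert _ _) (by simp [hwS4, Ne.symm n14, Ne.symm n24, Ne.symm n34])
    (by rw [p3]; exact hCD)
    (fun u hu => (hball D bD).2.1 u hu) (hoff D bD (by linarith))
    (fun u hu hz => by
      rw [p3] at hz
      exact (hball _ (openSegment_subset_ball bC bD _ hz)).2.1 u hu rfl)
    (fun e he z hz hc => by
      rw [p3] at hz
      have := hseg hCD hz
      exact absurd hc (hoff z (openSegment_subset_ball bC bD _ hz) (by linarith) e he))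
  rw [p3] at r4 x4 b4
  obtain ⟨ht', hc'⟩ := ht.tail x4 b4 hDab fab
  refine ⟨D, _, _, ⟨x4, r4, ?_, ?_⟩, update_self .., hDab, ht', ?_⟩
  · have hZ' : ∀ q, dist q p < ρ → q ∉ Z := fun q hq => (hball q hq).1
    rintro v (rfl | rfl | rfl | rfl | hv) hvS
    · rw [update_self]; exact hZ' D bD
    · rw [update_of_ne n34, update_self]; exact hZ' C bC
    · rw [update_of_ne n24, update_of_ne n23, update_self]; exact hZ' B bB
    · rw [update_of_ne n14, update_of_ne n13, update_of_ne n12, update_self]; exact hZ' A bA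
    · exact absurd hv hvS
  · have hsegZ : ∀ u v, dist u p < ρ → dist v p < ρ →
        ∀ z ∈ (Polyline.straight u v).carrier, z ∉ Z := by
      intro u v hu hv z hz
      rw [straight_carrier] at hz
      exact (hball z ((convex_ball p ρ).segment_subset hu hv hz)).1
    have ne4 : ∀ e, w₄ ∉ e → e ≠ s(w₃, w₄) := fun e he hc => he (by rw [hc]; simp)
    have ne3 : ∀ e, w₃ ∉ e → e ≠ s(w₂, w₃) := fun e he hc => he (by rw [hc]; simp)
    have ne2 : ∀ e, w₂ ∉ e → e ≠ s(w₁, w₂) := fun e he hc => he (by rw [hc]; simp)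
    have nx : ∀ w, w ∉ S → w ≠ x := fun w hw hc => hw (hc ▸ hx)
    rintro e (rfl | rfl | rfl | rfl | he) heE
    · left
      rw [update_self]; exact hsegZ _ _ bC bD
    · left
      rw [update_of_ne (ne4 _ (by simp [Ne.symm n24, Ne.symm n34])), update_self]
      exact hsegZ _ _ bB bC
    · left
      rw [update_of_ne (ne4 _ (by simp [Ne.symm n14, Ne.symm n24])),
        update_of_ne (ne3 _ (by simp [Ne.symm n13, Ne.symm n23])), update_self]
      exact hsegZ _ _ bA bB
    · right
      rw [update_of_ne (ne4 _ (by simp [Ne.symm n14, nx _ hwS4])),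
        update_of_ne (ne3 _ (by simp [Ne.symm n13, nx _ hwS3])),
        update_of_ne (ne2 _ (by simp [Ne.symm n12, nx _ hwS2])), update_self]
      refine ⟨a, A, rfl, left_mem_segment ℝ _ _, openSegment_sub_segment hAab, τ - 2 * δ,
        by linarith, ?_⟩
      rw [hA_eq]; module
    · exact absurd he heE
  · intro z hz
    obtain ⟨h1, h2⟩ := hc' z hz
    refine ⟨h1, ?_⟩
    rintro rfl
    linarith

end BRAC

/-! ### Routing a whole path along a transversal segment -/

namespace BRAC

open Set Function Polyline

variable {V : Type*} {S S' S₁ S₂ : Set V} {E E' E₁ E₂ : Set (Sym2 V)}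
  {pos pos' pos₁ pos₂ : V → Plane} {curve curve' curve₁ curve₂ : Sym2 V → Polyline} {a b : Plane}

/-- The edges of the path from `x` through the vertices `ws` to `y`. -/
def chainEdges (x : V) : List V → V → Set (Sym2 V)
  | [], y => {s(x, y)}
  | w :: ws, y => insert s(x, w) (chainEdges w ws y)

theorem Transversal.finite (h : Transversal S E pos curve a b) (hE : E.Finite) :
    (crossings E curve a b).Finite :=
  (h.crossings_ncard hE.coe_toFinset).1

theorem exists_near_start {Z : Set Plane} (hZ : IsClosed Z) (ha : a ∉ Z) (d : Plane) :
    ∃ s : ℝ, 0 < s ∧ s < 1 ∧ a + s • d ∉ Z := by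
  have hc : Filter.Tendsto (fun s : ℝ => a + s • d) (nhdsWithin 0 (Ioi 0)) (nhds a) := by
    have : Continuous fun s : ℝ => a + s • d := by fun_prop
    have h := this.tendsto 0
    simp only [zero_smul, add_zero] at h
    exact h.mono_left nhdsWithin_le_nhds
  have h1 := hc.eventually (hZ.isOpen_compl.mem_nhds ha)
  have h2 : ∀ᶠ s : ℝ in nhdsWithin 0 (Ioi 0), s ∈ Ioo (0 : ℝ) 1 := Ioo_mem_nhdsGT one_pos
  obtain ⟨s, hs, hs'⟩ := (h1.and h2).exists
  exact ⟨s, hs'.1, hs'.2, hs⟩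

/-- Draw a path with inner vertices `ws` along a transversal segment, if there are at least four
inner vertices per crossing. -/
theorem RACOn.resolve [DecidableEq V] {Z : Set Plane} (hZ : IsClosed Z) {y : V} (n : ℕ) :
    ∀ (ws : List V) (S : Set V) (E : Set (Sym2 V)) (pos : V → Plane) (curve : Sym2 V → Polyline)
      (x : V), ws.length = n → S.Finite → E.Finite → RACOn S E pos curve → x ∈ S → y ∈ S →
      s(x, y) ∉ E → ws.Nodup → (∀ w ∈ ws, w ∉ S) → Transversal S E pos curve (pos x) (pos y) →
      pos x ∉ Z → (∀ z ∈ crossings E curve (pos x) (pos y), z ∉ Z) →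
      4 * (crossings E curve (pos x) (pos y)).ncard ≤ ws.length →
      ∃ pos' curve', Routed Z (pos x) (pos y) S E pos curve (S ∪ {w | w ∈ ws})
        (E ∪ chainEdges x ws y) pos' curve' := by
  induction n using Nat.strong_induction_on with
  | _ n ih =>
  intro ws S E pos curve x hn hSf hEf h hx hy hxy hws hwS ht hxZ hcZ hlen
  have hne : x ≠ y := fun e => ht.ne (by rw [e])
  have hfin := ht.finite hEf
  rcases (crossings E curve (pos x) (pos y)).eq_empty_or_nonempty with hemp | hnon
  · match ws with
    | [] =>
      have hno : ∀ z ∈ openSegment ℝ (pos x) (pos y), ∀ e ∈ E, z ∉ (curve e).carrier :=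
        fun z hz e he hc => by
          have : z ∈ crossings E curve (pos x) (pos y) := ⟨hz, e, he, hc⟩
          rw [hemp] at this; exact this
      have key := h.join hx hy hne hxy ht.vertex
        (fun e he z hz hc => absurd hc (hno z hz e he))
      have e1 : S ∪ {w | w ∈ ([] : List V)} = S := by simp
      have e2 : E ∪ chainEdges x [] y = insert s(x, y) E := by ext; simp [chainEdges]
      rw [e1, e2]
      refine ⟨_, _, ⟨⟨Subset.rfl, subset_insert _ _, fun _ _ => rfl, fun e he =>
        update_of_ne (ne_of_mem_of_not_mem he hxy) _ _, ?_⟩, key, fun v hv hv' => absurd hv hv', ?_⟩⟩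
      · rintro e (rfl | he) heE
        · rw [update_self]; rfl
        · exact absurd he heE
      · rintro e (rfl | he) heE
        · right
          exact ⟨_, _, update_self .., left_mem_segment ℝ _ _, right_mem_segment ℝ _ _, 1,
            one_ne_zero, (one_smul _ _).symm⟩
        · exact absurd he heE
    -- Surplus vertices are harmless: without crossings, the next one subdivides the segment so
    -- close to its start that it stays outside the closed set `Z`.
    | w :: ws =>
      obtain ⟨s, hs0, hs1, hsZ⟩ := exists_near_start hZ hxZ (pos y - pos x)
      have hq : pos x + s • (pos y - pos x) ∈ openSegment ℝ (pos x) (pos y) :=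
        mem_openSegment_iff'.2 ⟨s, hs0, hs1, rfl⟩
      have hwS' := hwS w (by simp)
      have hyw : y ≠ w := ne_of_mem_of_not_mem hy hwS'
      obtain ⟨pos₁, curve₁, r₁, hw₁, ht₁, hc₁⟩ := h.advance (w := w) hx hwS' ht hq hsZ
        (fun z hz => by rw [hemp] at hz; exact absurd hz (notMem_empty z))
      have hy₁ : pos₁ y = pos y := r₁.pos_eq y hy
      rw [List.nodup_cons] at hws
      have hc₁' : crossings (insert s(x, w) E) curve₁ (pos₁ w) (pos₁ y) = ∅ := by
        rw [hw₁, hy₁]; exact subset_empty_iff.1 (hc₁.trans hemp.subset)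
      obtain ⟨pos₂, curve₂, r₂⟩ := ih ws.length (by simp at hn; omega) ws (insert w S)
        (insert s(x, w) E) pos₁ curve₁ w rfl (hSf.insert _) (hEf.insert _) r₁.rac (mem_insert _ _)
        (mem_insert_of_mem _ hy)
        (by
          rintro (h0 | h0)
          · simp only [Sym2.eq_iff] at h0
            rcases h0 with ⟨rfl, -⟩ | ⟨-, rfl⟩
            exacts [hwS' hx, hne rfl]
          · exact hwS' (h.mem _ h0 w (by simp)))
        hws.2
        (by
          rintro v hv (rfl | hvS)
          · exact hws.1 hv
          · exact hwS v (by simp [hv]) hvS)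
        (by rw [hw₁, hy₁]; exact ht₁) (by rw [hw₁]; exact hsZ)
        (by rw [hc₁']; simp) (by rw [hc₁']; simp)
      rw [hw₁, hy₁] at r₂
      have e1 : S ∪ {v | v ∈ w :: ws} = insert w S ∪ {v | v ∈ ws} := by
        ext v; simp; tauto
      have e2 : E ∪ chainEdges x (w :: ws) y = insert s(x, w) E ∪ chainEdges w ws y := by
        ext v; simp [chainEdges]; tauto
      rw [e1, e2]
      exact ⟨pos₂, curve₂, r₁.trans r₂ hq⟩
  -- The crossing nearest to the start comes first, so that the way to it is free. Its detour spends
  -- four vertices and removes it from the set of crossings, which preserves the budget.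
  · obtain ⟨p, hp, hmin⟩ := exists_min_image _ (fun z => dist (pos x) z) hfin hnon
    have hcard : 1 ≤ (crossings E curve (pos x) (pos y)).ncard :=
      (ncard_pos hfin).2 hnon
    match ws with
    | [] | [_] | [_, _] | [_, _, _] => simp at hlen; omega
    | w₁ :: w₂ :: w₃ :: w₄ :: ws =>
      have hnd : ([w₁, w₂, w₃, w₄] ++ ws).Nodup := hws
      rw [List.nodup_append] at hnd
      have hwS4 : ∀ w ∈ ([w₁, w₂, w₃, w₄] : List V), w ∉ S := fun w hw => hwS w (by
        simp at hw ⊢; tauto)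
      obtain ⟨q, pos₁, curve₁, r₁, hw₁, hq, ht₁, hc₁⟩ := h.hop hSf hEf hZ hx hnd.1 hwS4 ht hp
        hmin (hcZ p hp)
      have hy₁ : pos₁ y = pos y := r₁.pos_eq y hy
      have hwS1 := hwS4 w₁ (by simp)
      have hwS2 := hwS4 w₂ (by simp)
      have hwS3 := hwS4 w₃ (by simp)
      have hwS4' := hwS4 w₄ (by simp)
      obtain ⟨pos₂, curve₂, r₂⟩ := ih ws.length (by simp at hn; omega) ws _ _ pos₁ curve₁ w₄ rfl
        ((((hSf.insert w₁).insert w₂).insert w₃).insert w₄)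
        ((((hEf.insert s(x, w₁)).insert s(w₁, w₂)).insert s(w₂, w₃)).insert s(w₃, w₄)) r₁.rac
        (mem_insert _ _) (by simp [hy])
        (by
          have h0 : s(w₄, y) ∉ E := fun h0 => hwS4' (h.mem _ h0 w₄ (by simp))
          have y1 : y ≠ w₁ := ne_of_mem_of_not_mem hy hwS1
          have y2 : y ≠ w₂ := ne_of_mem_of_not_mem hy hwS2
          have y3 : y ≠ w₃ := ne_of_mem_of_not_mem hy hwS3
          have y4 : y ≠ w₄ := ne_of_mem_of_not_mem hy hwS4'
          have y5 : y ≠ x := hne.symm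
          simp [h0, y1, y2, y3, y4, y5])
        (by simp at hws; tauto)
        (by
          intro v hv hvS
          have hv1 : ∀ w ∈ ([w₁, w₂, w₃, w₄] : List V), v ≠ w := fun w hw e =>
            hnd.2.2 w hw v hv e.symm
          have hv2 := hwS v (by simp [hv])
          simp only [List.mem_cons, List.not_mem_nil, or_false, forall_eq_or_imp, forall_eq] at hv1
          simp only [mem_insert_iff] at hvS
          tauto)
        (by rw [hw₁, hy₁]; exact ht₁)
        (by rw [hw₁, ← hw₁]; exact r₁.vertex w₄ (mem_insert _ _) hwS4')
        (by rw [hw₁, hy₁]; exact fun z hz => hcZ z (hc₁ hz).1)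
        (by
          rw [hw₁, hy₁]
          have h1 := ncard_le_ncard hc₁ (hfin.sdiff)
          rw [ncard_sdiff_singleton_of_mem hp] at h1
          simp only [List.length_cons] at hlen
          omega)
      rw [hw₁, hy₁] at r₂
      have e1 : S ∪ {v | v ∈ w₁ :: w₂ :: w₃ :: w₄ :: ws} =
          insert w₄ (insert w₃ (insert w₂ (insert w₁ S))) ∪ {v | v ∈ ws} := by
        ext v; simp; tauto
      have e2 : E ∪ chainEdges x (w₁ :: w₂ :: w₃ :: w₄ :: ws) y = (insert s(w₃, w₄)
          (insert s(w₂, w₃) (insert s(w₁, w₂) (insert s(x, w₁) E)))) ∪ chainEdges w₄ ws y := by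
        ext v; simp only [chainEdges, mem_union, mem_insert_iff]; tauto
      rw [e1, e2]
      exact ⟨pos₂, curve₂, r₁.trans r₂ hq⟩

end BRAC

namespace BRAC

open Set Function Polyline

variable {V : Type*} {S S' S₁ S₂ : Set V} {E E' E₁ E₂ : Set (Sym2 V)}
  {pos pos' pos₁ pos₂ : V → Plane} {curve curve' curve₁ curve₂ : Sym2 V → Polyline} {a b : Plane}

/-! ### Points in general position -/

/-- Finitely many lines do not cover a neighbourhood of a point. -/
theorem exists_off_lines (v : Plane) {ρ : ℝ} (hρ : 0 < ρ) {L : Set (Plane × Plane)} (hL : L.Finite)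
    (hL0 : ∀ l ∈ L, l.2 ≠ 0) : ∃ q, dist q v < ρ ∧ ∀ l ∈ L, cross (q - l.1) l.2 ≠ 0 := by
  -- A short arc of a parabola through `v`: a line equation restricted to it is a nonzero polynomial
  -- of degree at most two, so each line excludes only finitely many parameters.
  let g : ℝ → Plane := fun s => v + !₂[s, s ^ 2]
  have hcont : Continuous g := by
    refine continuous_const.add ?_
    refine (PiLp.continuous_toLp 2 _).comp ?_
    refine continuous_pi fun i => ?_
    fin_cases i <;> simp <;> fun_prop
  have hg0 : g 0 = v := by
    ext i
    fin_cases i <;> simp [g]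
  have hev : ∀ᶠ s in nhds (0 : ℝ), dist (g s) v < ρ := by
    have := hcont.tendsto 0
    rw [hg0] at this
    exact this.eventually (Metric.ball_mem_nhds v hρ)
  obtain ⟨δ, hδ, hball⟩ := Metric.eventually_nhds_iff.1 hev
  have hbad : ∀ l ∈ L, {s : ℝ | cross (g s - l.1) l.2 = 0}.Finite := by
    intro l hl
    let P : Polynomial ℝ := Polynomial.C (cross (v - l.1) l.2) + Polynomial.C (l.2 1) * Polynomial.X
      - Polynomial.C (l.2 0) * Polynomial.X ^ 2
    have hP : P ≠ 0 := by
      intro h0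
      apply hL0 l hl
      have h1 : P.coeff 1 = 0 := by rw [h0]; simp
      have h2 : P.coeff 2 = 0 := by rw [h0]; simp
      simp [P, Polynomial.coeff_C, Polynomial.coeff_X_pow] at h1 h2
      ext i
      fin_cases i
      · exact h2
      · exact h1
    refine (Polynomial.finite_setOfPred_isRoot hP).subset fun s hs => ?_
    rw [mem_ofPred_eq] at hs ⊢
    rw [Polynomial.IsRoot.def, ← hs]
    simp [P, g, cross]; ring
  obtain ⟨s, hs, hs'⟩ := (Ioo_infinite hδ).exists_notMem_finite (hL.biUnion hbad)
  refine ⟨g s, hball ?_, fun l hl h0 => hs' (mem_biUnion hl h0)⟩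
  rw [Real.dist_eq, sub_zero, abs_of_pos hs.1]; exact hs.2

/-- By Lagrange's identity, the squares of the inner product and of the cross product add up to the
product of the squared norms. -/
theorem cross_ne_zero_of_inner_eq_zero {t t' : Plane} (ht : t ≠ 0) (ht' : t' ≠ 0)
    (h : inner ℝ t t' = 0) : cross t t' ≠ 0 := by
  intro h0
  have h1 : (0 : ℝ) < inner ℝ t t := real_inner_self_pos.2 ht
  have h2 : (0 : ℝ) < inner ℝ t' t' := real_inner_self_pos.2 ht'
  simp only [PiLp.inner_apply, Fin.sum_univ_two, cross, RCLike.inner_apply, conj_trivial] at *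
  have : (t 0 * t 0 + t 1 * t 1) * (t' 0 * t' 0 + t' 1 * t' 1) = 0 := by
    have e : (t 0 * t 0 + t 1 * t 1) * (t' 0 * t' 0 + t' 1 * t' 1)
      = (t' 0 * t 0 + t' 1 * t 1) ^ 2 + (t 0 * t' 1 - t 1 * t' 0) ^ 2 := by ring
    rw [e, h, h0]; ring
  nlinarith [mul_pos h1 h2]

theorem Polyline.Proper.dir_ne_zero {P : Polyline} (h : P.Proper) (i) : P.dir i ≠ 0 :=
  sub_ne_zero.2 (h.nondegenerate i).symm

/-- Only finitely many points lie on several edges. -/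
theorem RACOn.finite_common (h : RACOn S E pos curve) (hS : S.Finite) (hE : E.Finite) :
    {z | ∃ e ∈ E, ∃ f ∈ E, e ≠ f ∧ z ∈ (curve e).carrier ∧ z ∈ (curve f).carrier}.Finite := by
  have hfin : (pos '' S ∪ ⋃ e ∈ E, ⋃ f ∈ E, ⋃ i : Fin ((curve e).bends + 1),
      ⋃ j : Fin ((curve f).bends + 1), {z | z ∈ (curve e).openSeg i ∧ z ∈ (curve f).openSeg j ∧
        inner ℝ ((curve e).dir i) ((curve f).dir j) = 0}).Finite := by
    refine (hS.image pos).union (hE.biUnion fun e he => hE.biUnion fun f hf =>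
      finite_iUnion fun i => finite_iUnion fun j => Set.Subsingleton.finite ?_)
    -- Right-angle crossings are between nonparallel segments, so every pair of segments contributes
    -- at most one point. In a drawing without the RAC property edges might overlap.
    rintro z ⟨hi, hj, h0⟩ z' ⟨hi', hj', -⟩
    exact eq_of_mem_segments (cross_ne_zero_of_inner_eq_zero ((h.proper e he).dir_ne_zero i)
      ((h.proper f hf).dir_ne_zero j) h0) (openSegment_sub_segment hj)
      (openSegment_sub_segment hj') (openSegment_sub_segment hi) (openSegment_sub_segment hi')
  refine hfin.subset ?_
  rintro z ⟨e, he, f, hf, hef, hze, hzf⟩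
  by_cases hz : z ∈ pos '' S
  · exact .inl hz
  · obtain ⟨i, j, hi, hj, h0⟩ := h.rac e he f hf hef z
      ⟨h.mem_interior he hze hz, h.mem_interior hf hzf hz⟩
    right
    simp only [mem_iUnion]
    exact ⟨e, he, f, hf, i, j, hi, hj, h0⟩

/-- Near a vertex `v`, leaves can be attached to `v` at all points off finitely many lines. -/
theorem RACOn.leaf_zone (h : RACOn S E pos curve) (hS : S.Finite) (hE : E.Finite) {Z : Set Plane}
    (hZ : IsClosed Z) {v : V} (hvZ : pos v ∉ Z) :
    ∃ ρ > 0, ∃ D : Set Plane, D.Finite ∧ (∀ d ∈ D, d ≠ 0) ∧ ∀ q, dist q (pos v) < ρ →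
      (∀ d ∈ D, cross (q - pos v) d ≠ 0) → q ≠ pos v ∧ ∀ z ∈ segment ℝ (pos v) q, z ∉ Z ∧
        (z ≠ pos v → (∀ u ∈ S, u ≠ v → pos u ≠ z) ∧ ∀ e ∈ E, z ∉ (curve e).carrier) := by
  have h1 : ∀ᶠ z in nhds (pos v), z ∉ Z := hZ.isOpen_compl.mem_nhds hvZ
  have h2 : ∀ᶠ z in nhds (pos v), ∀ u ∈ S, pos u ≠ pos v → pos u ≠ z := by
    rw [Filter.eventually_all_finite hS]
    intro u hu
    by_cases hu' : pos u = pos v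
    · simp [hu']
    · filter_upwards [isOpen_ne.mem_nhds (Ne.symm hu')] with z hz _ using Ne.symm hz
  have h3 : ∀ᶠ z in nhds (pos v), ∀ e ∈ E, ∀ i, pos v ∈ (curve e).seg i ∨ z ∉ (curve e).seg i := by
    rw [Filter.eventually_all_finite hE]
    intro e he
    rw [Filter.eventually_all]
    intro i
    by_cases hi : pos v ∈ (curve e).seg i
    · simp [hi]
    · filter_upwards [((curve e).isClosed_seg i).isOpen_compl.mem_nhds hi] with z hz using .inr hz
  obtain ⟨ρ, hρ, hball⟩ := Metric.eventually_nhds_iff.1 (h1.and (h2.and h3))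
  -- The direction `!₂[1, 0]` only serves to force `q ≠ pos v`, which the other directions would not
  -- do if there are no edges.
  refine ⟨ρ, hρ, insert !₂[1, 0] (⋃ e ∈ E, range (curve e).dir),
    (hE.biUnion fun e _ => finite_range _).insert _, ?_, ?_⟩
  · rintro d (rfl | hd)
    · intro h0
      have := congrArg (fun w : Plane => w 0) h0
      simp at this
    · simp only [mem_iUnion, mem_range] at hd
      obtain ⟨e, he, i, rfl⟩ := hd
      exact (h.proper e he).dir_ne_zero i
  · intro q hq hD
    have hqv : q ≠ pos v := by
      rintro rfl
      exact hD _ (mem_insert _ _) (by simp [cross])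
    refine ⟨hqv, fun z hz => ?_⟩
    have hzb : dist z (pos v) < ρ :=
      (convex_ball (pos v) ρ).segment_subset (Metric.mem_ball_self hρ) hq hz
    obtain ⟨hzZ, hzS, hzE⟩ := hball hzb
    refine ⟨hzZ, fun hzv => ⟨fun u hu huv huz => ?_, fun e he hc => ?_⟩⟩
    · by_cases hpu : pos u = pos v
      · exact hzv (huz.symm.trans hpu)
      · exact hzS u hu hpu huz
    · obtain ⟨i, hi⟩ := mem_iUnion.1 hc
      -- A segment of the drawing that comes this close to `pos v` contains `pos v`. A further
      -- common point with the leaf edge would make the two parallel, which the choice of `q`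
      -- excludes.
      have hvi := (hzE e he i).resolve_right (fun hn => hn hi)
      obtain ⟨s, -, -, hs⟩ := mem_segment_iff'.1 hz
      obtain ⟨t, -, -, ht⟩ := mem_segment_iff'.1 hi
      obtain ⟨t', -, -, ht'⟩ := mem_segment_iff'.1 hvi
      have e1 : z - pos v = s • (q - pos v) := by rw [hs]; abel
      have e2 : z - pos v = (t - t') • (curve e).dir i := by
        rw [Polyline.dir]
        conv_lhs => rw [ht, ht']
        module
      have e3 : s * cross (q - pos v) ((curve e).dir i) = 0 := by
        rw [← cross_smul_left, ← e1, e2, cross_smul_left, cross_self, mul_zero]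
      rcases mul_eq_zero.1 e3 with h0 | h0
      · rw [h0, zero_smul, sub_eq_zero] at e1; exact hzv e1
      · refine hD _ (mem_insert_of_mem _ ?_) h0
        simp only [mem_iUnion, mem_range]
        exact ⟨e, he, i, rfl⟩

/-- Attach a leaf at a point as provided by `RACOn.leaf_zone`. -/
theorem RACOn.attach [DecidableEq V] (h : RACOn S E pos curve) {Z : Set Plane} {v w : V}
    {q : Plane} (hv : v ∈ S) (hw : w ∉ S) (hqv : q ≠ pos v)
    (hq : ∀ z ∈ segment ℝ (pos v) q, z ∉ Z ∧
        (z ≠ pos v → (∀ u ∈ S, u ≠ v → pos u ≠ z) ∧ ∀ e ∈ E, z ∉ (curve e).carrier)) (a b : Plane) :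
    Routed Z a b S E pos curve (insert w S) (insert s(v, w) E) (update pos w q)
      (update curve s(v, w) (Polyline.straight (pos v) q)) := by
  have hv' : ∀ z ∈ openSegment ℝ (pos v) q, z ≠ pos v := by
    rintro z hz rfl
    exact hqv (left_mem_openSegment_iff.1 hz).symm
  obtain ⟨r, x⟩ := h.leaf hv hw (q := q)
    (by
      rintro ⟨u, hu, rfl⟩
      by_cases huv : u = v
      · exact hqv (by rw [huv])
      · exact ((hq _ (right_mem_segment ℝ _ _)).2 hqv).1 u hu huv rfl)
    (fun e he => ((hq _ (right_mem_segment ℝ _ _)).2 hqv).2 e he)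
    (by
      intro u hu hz
      by_cases huv : u = v
      · exact hv' _ hz (by rw [huv])
      · exact ((hq _ (openSegment_sub_segment hz)).2 (hv' _ hz)).1 u hu huv rfl)
    (fun e he z hz hc =>
      absurd hc (((hq _ (openSegment_sub_segment hz)).2 (hv' _ hz)).2 e he))
  refine ⟨x, r, ?_, ?_⟩
  · rintro u (rfl | hu) huS
    · rw [update_self]; exact (hq _ (right_mem_segment ℝ _ _)).1
    · exact absurd hu huS
  · rintro e (rfl | he) heE
    · left
      rw [update_self, straight_carrier]
      exact fun z hz => (hq z hz).1
    · exact absurd he heE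

end BRAC

namespace BRAC

open Set Function Polyline

variable {V : Type*} {S S' S₁ S₂ : Set V} {E E' E₁ E₂ : Set (Sym2 V)}
  {pos pos' pos₁ pos₂ : V → Plane} {curve curve' curve₁ curve₂ : Sym2 V → Polyline} {a b : Plane}

/-! ### Families of segments still to be drawn -/

/-- The segment between two vertices. -/
def vseg (pos : V → Plane) (x : V × V) : Set Plane := segment ℝ (pos x.1) (pos x.2)

/-- The segments between the given pairs of vertices are in general position with respect to the
drawing and to each other. -/
def General (S : Set V) (E : Set (Sym2 V)) (pos : V → Plane) (curve : Sym2 V → Polyline) :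
    List (V × V) → Prop
  | [] => True
  | x :: l => (Transversal S E pos curve (pos x.1) (pos x.2) ∧ x.1 ∈ S ∧ x.2 ∈ S ∧
      s(x.1, x.2) ∉ E ∧ ∀ y ∈ l, cross (pos x.2 - pos x.1) (pos y.2 - pos y.1) ≠ 0 ∧
        pos x.1 ∉ vseg pos y ∧ pos x.2 ∉ vseg pos y ∧ pos y.1 ∉ vseg pos x ∧
        pos y.2 ∉ vseg pos x ∧ ∀ z ∈ vseg pos x, z ∈ vseg pos y →
          (∀ e ∈ E, z ∉ (curve e).carrier) ∧ ∀ y' ∈ l, y' ≠ y → z ∉ vseg pos y') ∧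
    General S E pos curve l

theorem General.of_mem {l : List (V × V)} (h : General S E pos curve l) {x} (hx : x ∈ l) :
    Transversal S E pos curve (pos x.1) (pos x.2) ∧ x.1 ∈ S ∧ x.2 ∈ S ∧ s(x.1, x.2) ∉ E := by
  induction l with
  | nil => simp at hx
  | cons y l ih =>
    rcases List.mem_cons.1 hx with rfl | hx
    · exact ⟨h.1.1, h.1.2.1, h.1.2.2.1, h.1.2.2.2.1⟩
    · exact ih h.2 hx

theorem General.cross_ne {l : List (V × V)} (h : General S E pos curve l) {x y} (hx : x ∈ l)
    (hy : y ∈ l) (hxy : x ≠ y) : cross (pos x.2 - pos x.1) (pos y.2 - pos y.1) ≠ 0 := by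
  induction l with
  | nil => simp at hx
  | cons w l ih =>
    rcases List.mem_cons.1 hx with rfl | hx' <;> rcases List.mem_cons.1 hy with rfl | hy'
    · exact absurd rfl hxy
    · exact (h.1.2.2.2.2 y hy').1
    · rw [cross_comm, neg_ne_zero]; exact (h.1.2.2.2.2 x hx').1
    · exact ih h.2 hx' hy'

/-- The union of the segments between the given pairs of vertices. -/
def vsegs (pos : V → Plane) (l : List (V × V)) : Set Plane := {z | ∃ y ∈ l, z ∈ vseg pos y}

theorem isClosed_vsegs (pos : V → Plane) (l : List (V × V)) : IsClosed (vsegs pos l) := by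
  have : vsegs pos l = ⋃ y ∈ {y | y ∈ l}, vseg pos y := by
    ext z; simp [vsegs]
  rw [this]
  refine (List.finite_toSet l).isClosed_biUnion fun y _ => ?_
  rw [vseg, segment_eq_image_lineMap]
  exact (isCompact_Icc.image (by fun_prop)).isClosed

/-- Routing along a segment that meets the family in general position preserves the general
position of the family. -/
theorem General.routed {l₀ l : List (V × V)} (h : General S E pos curve l) (hl : l ⊆ l₀)
    (hr : Routed (vsegs pos l₀) a b S E pos curve S' E' pos' curve')
    (hE' : ∀ y ∈ l, s(y.1, y.2) ∉ E')
    (hab : ∀ z ∈ segment ℝ a b, ∀ y ∈ l₀, z ∈ vseg pos y → cross (b - a) (pos y.2 - pos y.1) ≠ 0 ∧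
      (∀ e ∈ E, z ∉ (curve e).carrier) ∧ ∀ y' ∈ l₀, y' ≠ y → z ∉ vseg pos y') :
    General S' E' pos' curve' l := by
  have hsub : ∀ {e a' b'}, curve' e = Polyline.straight a' b' → a' ∈ segment ℝ a b →
      b' ∈ segment ℝ a b → (curve' e).carrier ⊆ segment ℝ a b := by
    intro e a' b' he ha hb
    rw [he, straight_carrier]
    exact (convex_segment a b).segment_subset ha hb
  -- a new edge that meets a segment of the family does so inside the segment from `a` to `b`
  have hnew : ∀ e ∈ E', e ∉ E → ∀ z ∈ (curve' e).carrier, ∀ y ∈ l₀, z ∈ vseg pos y →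
      z ∈ segment ℝ a b ∧ ∃ a' b', curve' e = Polyline.straight a' b' ∧
        ∃ c : ℝ, c ≠ 0 ∧ b' - a' = c • (b - a) := by
    intro e he heE z hz y hy hzy
    rcases hr.edge e he heE with h0 | ⟨a', b', h1, h2, h3, c, hc, h4⟩
    · exact absurd ⟨y, hy, hzy⟩ (h0 z hz)
    · exact ⟨hsub h1 h2 h3 hz, a', b', h1, c, hc, h4⟩
  induction l with
  | nil => trivial
  | cons x l ih =>
    have hx0 : x ∈ l₀ := hl (by simp)
    have hx := h.of_mem (x := x) (by simp)
    obtain ⟨ht, hx1, hx2, hxE⟩ := hx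
    have p1 := hr.pos_eq _ hx1
    have p2 := hr.pos_eq _ hx2
    refine ⟨⟨?_, hr.sub hx1, hr.sub hx2, hE' x (by simp), ?_⟩,
      ih h.2 (fun y hy => hl (by simp [hy])) (fun y hy => hE' y (by simp [hy]))⟩
    · rw [p1, p2]
      have hvert : ∀ v ∈ S', pos' v ∉ openSegment ℝ (pos x.1) (pos x.2) := by
        intro v hv hz
        by_cases hvS : v ∈ S
        · rw [hr.pos_eq v hvS] at hz; exact ht.vertex v hvS hz
        · exact hr.vertex v hv hvS ⟨x, hx0, openSegment_sub_segment hz⟩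
      refine ⟨ht.ne, hvert, ?_⟩
      intro z hz e he hc
      have hzx : z ∈ vseg pos x := openSegment_sub_segment hz
      by_cases heE : e ∈ E
      · rw [hr.curve_eq e heE] at hc ⊢
        obtain ⟨hi, hu⟩ := ht.edge z hz e heE hc
        refine ⟨hi, fun f hf hfe hfc => ?_⟩
        by_cases hfE : f ∈ E
        · rw [hr.curve_eq f hfE] at hfc; exact hu f hfE hfe hfc
        · obtain ⟨hzab, -⟩ := hnew f hf hfE z hfc x hx0 hzx
          exact (hab z hzab x hx0 hzx).2.1 e heE hc
      · obtain ⟨hzab, a', b', hst, c, hc0, hcd⟩ := hnew e he heE z hc x hx0 hzx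
        obtain ⟨hcr, hno, -⟩ := hab z hzab x hx0 hzx
        have hpos : z ∉ pos' '' S' := by
          rintro ⟨v, hv, rfl⟩
          exact hvert v hv hz
        have hint := hr.rac.mem_interior he hc hpos
        have hopen : z ∈ openSegment ℝ a' b' := by
          rw [hst, Polyline.interior, straight_carrier, ← insert_endpoints_openSegment] at hint
          simp at hint
          tauto
        refine ⟨?_, fun f hf hfe hfc => ?_⟩
        · rw [hst]
          refine ⟨⟨0, by simp⟩, by rwa [straight_openSeg], ?_⟩
          rw [straight_dir, hcd, cross_smul_left]
          exact mul_ne_zero hc0 hcr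
        · by_cases hfE : f ∈ E
          · rw [hr.curve_eq f hfE] at hfc; exact hno f hfE hfc
          · obtain ⟨-, a'', b'', hst', c', hc0', hcd'⟩ := hnew f hf hfE z hfc x hx0 hzx
            -- Two new edges through `z` would both be parallel to `b - a`, but the RAC property
            -- makes them orthogonal; so their common direction would be zero.
            obtain ⟨i, j, -, -, h0⟩ := hr.rac.rac e he f hf hfe.symm z
              ⟨hint, hr.rac.mem_interior hf hfc hpos⟩
            rw [show (curve' e).dir i = b' - a' by
                revert i; rw [hst]; exact fun i _ => straight_dir a' b' i,
              show (curve' f).dir j = b'' - a'' by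
                revert j; rw [hst']; exact fun j _ => straight_dir a'' b'' j,
              hcd, hcd', inner_smul_left, inner_smul_right] at h0
            have hab0 : b - a ≠ 0 := by
              intro h1; rw [h1] at hcr; simp [cross] at hcr
            simp [hc0, hc0'] at h0
            exact hab0 h0
    · intro y hy
      have hy0 : y ∈ l₀ := hl (by simp [hy])
      obtain ⟨-, hy1, hy2, -⟩ := h.of_mem (x := y) (by simp [hy])
      have q1 := hr.pos_eq _ hy1
      have q2 := hr.pos_eq _ hy2
      obtain ⟨g1, g2, g3, g4, g5, g6⟩ := h.1.2.2.2.2 y hy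
      have hvx : vseg pos' x = vseg pos x := by rw [vseg, p1, p2]; rfl
      have hvy : ∀ y ∈ l, vseg pos' y = vseg pos y := by
        intro y hy
        obtain ⟨-, hy1, hy2, -⟩ := h.of_mem (x := y) (by simp [hy])
        rw [vseg, hr.pos_eq _ hy1, hr.pos_eq _ hy2]; rfl
      rw [p1, p2, q1, q2, hvx, hvy y hy]
      refine ⟨g1, g2, g3, g4, g5, fun z hz hzy => ⟨fun e he hc => ?_, fun y' hy' hne => ?_⟩⟩
      · by_cases heE : e ∈ E
        · rw [hr.curve_eq e heE] at hc; exact (g6 z hz hzy).1 e heE hc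
        · obtain ⟨hzab, -⟩ := hnew e he heE z hc x hx0 hz
          refine (hab z hzab x hx0 hz).2.2 y hy0 ?_ hzy
          rintro rfl
          exact g2 (left_mem_segment ℝ _ _)
      · rw [hvy y' hy']; exact (g6 z hz hzy).2 y' hy' hne

theorem mem_chainEdges {x y v : V} {ws : List V} {e : Sym2 V} (he : e ∈ chainEdges x ws y)
    (hv : v ∈ e) : v = x ∨ v ∈ ws ∨ v = y := by
  induction ws generalizing x with
  | nil =>
    simp only [chainEdges, mem_singleton_iff] at he
    subst he
    simpa using hv
  | cons w ws ih =>
    rcases he with rfl | he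
    · rcases Sym2.mem_iff.1 hv with rfl | rfl <;> simp
    · rcases ih he with rfl | h | rfl <;> simp_all

/-- Draw all segments of a family in general position as paths. -/
theorem RACOn.resolve_all [DecidableEq V] (l : List (V × List V × V)) :
    ∀ (S : Set V) (E : Set (Sym2 V)) (pos : V → Plane) (curve : Sym2 V → Polyline),
      S.Finite → E.Finite → RACOn S E pos curve →
      General S E pos curve (l.map fun t => (t.1, t.2.2)) →
      (l.flatMap fun t => t.2.1).Nodup → (∀ t ∈ l, ∀ w ∈ t.2.1, w ∉ S) →
      (∀ t ∈ l, 4 * ((crossings E curve (pos t.1) (pos t.2.2)).ncard + l.length) ≤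
        t.2.1.length + 4) →
      ∃ pos' curve', RACOn (S ∪ {w | ∃ t ∈ l, w ∈ t.2.1})
          (E ∪ {e | ∃ t ∈ l, e ∈ chainEdges t.1 t.2.1 t.2.2}) pos' curve' ∧
        StraightExt S E pos curve (S ∪ {w | ∃ t ∈ l, w ∈ t.2.1})
          (E ∪ {e | ∃ t ∈ l, e ∈ chainEdges t.1 t.2.1 t.2.2}) pos' curve' := by
  induction l with
  | nil =>
    intro S E pos curve _ _ h _ _ _ _
    have e1 : S ∪ {w | ∃ t ∈ ([] : List (V × List V × V)), w ∈ t.2.1} = S := by simp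
    have e2 : E ∪ {e | ∃ t ∈ ([] : List (V × List V × V)), e ∈ chainEdges t.1 t.2.1 t.2.2} = E := by
      simp
    rw [e1, e2]
    exact ⟨pos, curve, h, StraightExt.refl⟩
  | cons t l ih =>
    obtain ⟨x, ws, y⟩ := t
    intro S E pos curve hSf hEf h hG hnd hwS hlen
    rw [List.map_cons] at hG
    obtain ⟨⟨ht, hxS, hyS, hxyE, hind⟩, hG'⟩ := hG
    simp only at ht hxS hyS hxyE hind
    rw [List.flatMap_cons, List.nodup_append] at hnd
    set l' := l.map fun t => (t.1, t.2.2) with hl'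
    have hopen : ∀ z ∈ crossings E curve (pos x) (pos y), z ∉ vsegs pos l' := by
      rintro z ⟨hz, e, he, hc⟩ ⟨y', hy', hzy⟩
      exact ((hind y' hy').2.2.2.2.2 z (openSegment_sub_segment hz) hzy).1 e he hc
    -- The budget reserves four vertices for each crossing with the present drawing and four for
    -- each other path of the list; the summand `4` on the right accounts for the path itself, which
    -- is included in the length of the list.
    have hlen0 := hlen (x, ws, y) (by simp)
    -- The set to be avoided is the union of the segments still to be drawn. Detours and new
    -- vertices keep away from it, so these segments meet the new path only on its own segment.
    obtain ⟨pos₁, curve₁, r₁⟩ := h.resolve (isClosed_vsegs pos l') ws.length ws S E pos curve x rfl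
      hSf hEf hxS hyS hxyE hnd.1 (hwS (x, ws, y) (by simp)) ht
      (fun ⟨y', hy', hzy⟩ => (hind y' hy').2.1 hzy) hopen (by simp at hlen0; omega)
    have hsub : ∀ t ∈ l, t.1 ∈ S ∧ t.2.2 ∈ S := fun t ht' =>
      ⟨(hG'.of_mem (List.mem_map_of_mem ht')).2.1, (hG'.of_mem (List.mem_map_of_mem ht')).2.2.1⟩
    have hG1 : General (S ∪ {w | w ∈ ws}) (E ∪ chainEdges x ws y) pos₁ curve₁ l' := by
      refine hG'.routed (List.Subset.refl _) r₁ ?_ ?_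
      · rintro y' hy' (he | he)
        · exact (hG'.of_mem hy').2.2.2 he
        · rcases mem_chainEdges he (v := y'.1) (by simp) with h0 | h0 | h0
          · apply (hind y' hy').2.1
            rw [← h0]; exact left_mem_segment ℝ _ _
          · exact hwS (x, ws, y) (by simp) _ h0 (hG'.of_mem hy').2.1
          · apply (hind y' hy').2.2.1
            rw [← h0]; exact left_mem_segment ℝ _ _
      · intro z hz y' hy' hzy
        exact ⟨(hind y' hy').1, (hind y' hy').2.2.2.2.2 z hz hzy⟩
    obtain ⟨pos₂, curve₂, r₂, x₂⟩ := ih _ _ pos₁ curve₁ (hSf.union (List.finite_toSet ws))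
      ((hEf.union (by
        clear * -
        induction ws generalizing x with
        | nil => exact finite_singleton _
        | cons w ws ih => exact (ih _).insert _))) r₁.rac hG1 hnd.2.1
      (by
        rintro t ht w hw (h0 | h0)
        · exact hwS t (by simp [ht]) w hw h0
        · exact hnd.2.2 w h0 w (List.mem_flatMap.2 ⟨t, ht, hw⟩) rfl)
      (by
        intro t ht'
        have h0 := hlen t (by simp [ht'])
        obtain ⟨ht1, ht2⟩ := hsub t ht'
        rw [r₁.pos_eq _ ht1, r₁.pos_eq _ ht2]
        have hmem : (t.1, t.2.2) ∈ l' := List.mem_map_of_mem ht'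
        obtain ⟨htr, -⟩ := hG'.of_mem hmem
        have hind' := hind _ hmem
        simp only at htr hind'
        -- The new path thus adds at most one crossing to any other segment, and this is paid for by
        -- the list becoming shorter.
        have hss : (crossings (E ∪ chainEdges x ws y) curve₁ (pos t.1) (pos t.2.2)) ⊆
            crossings E curve (pos t.1) (pos t.2.2) ∪
              (segment ℝ (pos x) (pos y) ∩ segment ℝ (pos t.1) (pos t.2.2)) := by
          rintro z ⟨hz, e, he, hc⟩
          by_cases heE : e ∈ E
          · left
            rw [r₁.curve_eq e heE] at hc
            exact ⟨hz, e, heE, hc⟩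
          · right
            have hzt := openSegment_sub_segment hz
            rcases r₁.edge e he heE with h1 | ⟨a', b', h1, h2, h3, -⟩
            · exact absurd ⟨_, hmem, hzt⟩ (h1 z hc)
            · rw [h1, straight_carrier] at hc
              exact ⟨(convex_segment _ _).segment_subset h2 h3 hc, hzt⟩
        have hsing : (segment ℝ (pos x) (pos y) ∩ segment ℝ (pos t.1) (pos t.2.2)).Subsingleton :=
          fun z hz z' hz' => eq_of_mem_segments hind'.1 hz.2 hz'.2 hz.1 hz'.1
        have h1 := ncard_le_ncard hss ((htr.finite hEf).union hsing.finite)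
        have h2 := ncard_union_le (crossings E curve (pos t.1) (pos t.2.2))
          (segment ℝ (pos x) (pos y) ∩ segment ℝ (pos t.1) (pos t.2.2))
        have h3 : (segment ℝ (pos x) (pos y) ∩ segment ℝ (pos t.1) (pos t.2.2)).ncard ≤ 1 :=
          (ncard_le_one hsing.finite).2 fun z hz z' hz' => hsing hz hz'
        simp only [List.length_cons] at h0
        omega)
    have e1 : S ∪ {w | ∃ t ∈ (x, ws, y) :: l, w ∈ t.2.1} =
        S ∪ {w | w ∈ ws} ∪ {w | ∃ t ∈ l, w ∈ t.2.1} := by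
      ext w; simp [or_assoc]
    have e2 : E ∪ {e | ∃ t ∈ (x, ws, y) :: l, e ∈ chainEdges t.1 t.2.1 t.2.2} =
        E ∪ chainEdges x ws y ∪ {e | ∃ t ∈ l, e ∈ chainEdges t.1 t.2.1 t.2.2} := by
      ext w; simp [or_assoc]
    rw [e1, e2]
    exact ⟨pos₂, curve₂, r₂, r₁.toStraightExt.trans x₂⟩

end BRAC

namespace BRAC

open Set Function Polyline

variable {V : Type*} {S S' S₁ S₂ : Set V} {E E' E₁ E₂ : Set (Sym2 V)}
  {pos pos' pos₁ pos₂ : V → Plane} {curve curve' curve₁ curve₂ : Sym2 V → Polyline} {a b : Plane}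

theorem General.notMem_vsegs {l : List (V × V)} (h : General S E pos curve l)
    (hinj : InjOn pos S) {w : V} (hw : w ∈ S) (hwl : ∀ y ∈ l, y.1 ≠ w ∧ y.2 ≠ w) :
    pos w ∉ vsegs pos l := by
  rintro ⟨y, hy, hz⟩
  obtain ⟨ht, h1, h2, -⟩ := h.of_mem hy
  rw [vseg, ← insert_endpoints_openSegment] at hz
  rcases hz with hz | hz | hz
  · exact (hwl y hy).1 (hinj hw h1 hz).symm
  · exact (hwl y hy).2 (hinj hw h2 hz).symm
  · exact ht.vertex w hw hz

/-- The points which a new segment in general position has to avoid. -/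
theorem General.finite_special {l : List (V × V)} (h : RACOn S E pos curve)
    (hG : General S E pos curve l) (hS : S.Finite) (hE : E.Finite) :
    (pos '' S ∪ {z | ∃ e ∈ E, ∃ k, z = (curve e).pt k} ∪
      {z | ∃ e ∈ E, ∃ f ∈ E, e ≠ f ∧ z ∈ (curve e).carrier ∧ z ∈ (curve f).carrier} ∪
      {z | ∃ y ∈ l, z ∈ vseg pos y ∧ ∃ e ∈ E, z ∈ (curve e).carrier} ∪
      {z | ∃ y ∈ l, ∃ y' ∈ l, y' ≠ y ∧ z ∈ vseg pos y ∧ z ∈ vseg pos y'}).Finite := by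
  have hl : {y | y ∈ l}.Finite := List.finite_toSet l
  refine ((((hS.image pos).union ?_).union (h.finite_common hS hE)).union ?_).union ?_
  · refine (hE.biUnion (t := fun e => range (curve e).pt) fun e _ => finite_range _).subset ?_
    rintro z ⟨e, he, k, rfl⟩
    simp only [mem_iUnion]
    exact ⟨e, he, k, rfl⟩
  · refine (hl.biUnion (t := fun y => crossings E curve (pos y.1) (pos y.2) ∪ {pos y.1, pos y.2})
      fun y hy => ((hG.of_mem hy).1.finite hE).union (toFinite _)).subset ?_
    rintro z ⟨y, hy, hz, e, he, hc⟩
    simp only [mem_iUnion]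
    refine ⟨y, hy, ?_⟩
    rw [vseg, ← insert_endpoints_openSegment] at hz
    rcases hz with rfl | rfl | hz
    · right; simp
    · right; simp
    · exact .inl ⟨hz, e, he, hc⟩
  · refine (hl.biUnion (t := fun y => ⋃ y' ∈ {y' | y' ∈ l}, {z | y' ≠ y ∧ z ∈ vseg pos y ∧
      z ∈ vseg pos y'}) fun y hy => hl.biUnion fun y' hy' => Set.Subsingleton.finite ?_).subset ?_
    · rintro z ⟨hne, hz, hz'⟩ w ⟨-, hw, hw'⟩
      exact eq_of_mem_segments (hG.cross_ne hy' hy hne) hz hw hz' hw'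
    · rintro z ⟨y, hy, y', hy', h3⟩
      simp only [mem_iUnion]
      exact ⟨y, hy, y', hy', h3⟩

/-- Attach leaves to two vertices such that the segment between them is in general position. -/
theorem General.add [DecidableEq V] {l : List (V × V)} (h : RACOn S E pos curve)
    (hG : General S E pos curve l) (hS : S.Finite) (hE : E.Finite) {u v f g : V} (hu : u ∈ S)
    (hv : v ∈ S) (hf : f ∉ S) (hg : g ∉ S) (hfg : f ≠ g)
    (hul : ∀ y ∈ l, y.1 ≠ u ∧ y.2 ≠ u) (hvl : ∀ y ∈ l, y.1 ≠ v ∧ y.2 ≠ v) :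
    ∃ pos' curve', RACOn (insert g (insert f S)) (insert s(v, g) (insert s(u, f) E)) pos' curve' ∧
      StraightExt S E pos curve (insert g (insert f S)) (insert s(v, g) (insert s(u, f) E))
        pos' curve' ∧
      General (insert g (insert f S)) (insert s(v, g) (insert s(u, f) E)) pos' curve'
        ((f, g) :: l) := by
  have huf : u ≠ f := ne_of_mem_of_not_mem hu hf
  have hvf : v ≠ f := ne_of_mem_of_not_mem hv hf
  have hug : u ≠ g := ne_of_mem_of_not_mem hu hg
  have hvg : v ≠ g := ne_of_mem_of_not_mem hv hg
  have hlS : ∀ y ∈ l, y.1 ∈ S ∧ y.2 ∈ S := fun y hy =>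
    ⟨(hG.of_mem hy).2.1, (hG.of_mem hy).2.2.1⟩
  have huZ := hG.notMem_vsegs h.inj hu hul
  have hvZ := hG.notMem_vsegs h.inj hv hvl
  -- the first leaf
  obtain ⟨ρ, hρ, D, hD, hD0, hzone⟩ := h.leaf_zone hS hE (isClosed_vsegs pos l) huZ
  obtain ⟨p, hp, hpD⟩ := exists_off_lines (pos u) hρ (hD.image fun d => (pos u, d))
    (by rintro _ ⟨d, hd, rfl⟩; exact hD0 d hd)
  obtain ⟨hpu, hpz⟩ := hzone p hp fun d hd => hpD _ ⟨d, hd, rfl⟩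
  -- The leaf edge avoids the family entirely, so the segment of the routing can be chosen
  -- degenerate. Its only point `pos u` is not on the family, which settles the last condition of
  -- `General.routed`.
  have r₁ := h.attach hu hf hpu hpz (pos u) (pos u)
  set pos₁ := update pos f p with hpos₁
  set curve₁ := update curve s(u, f) (Polyline.straight (pos u) p)
  have hnoE : ∀ w ∉ S, ∀ x, s(x, w) ∉ E := fun w hw x hx => hw (h.mem _ hx w (by simp))
  have hG₁ : General (insert f S) (insert s(u, f) E) pos₁ curve₁ l := by
    refine hG.routed (List.Subset.refl _) r₁ ?_ ?_
    · rintro y hy (h0 | h0)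
      · rcases Sym2.eq_iff.1 h0 with ⟨h1, -⟩ | ⟨-, h1⟩
        · exact (hul y hy).1 h1
        · exact (hul y hy).2 h1
      · exact (hG.of_mem hy).2.2.2 h0
    · intro z hz y hy hzy
      rw [segment_same, mem_singleton_iff] at hz
      subst hz
      exact absurd ⟨y, hy, hzy⟩ huZ
  have h₁ := r₁.rac
  have hS₁ := hS.insert f
  have hE₁ := hE.insert s(u, f)
  have hp₁ : pos₁ f = p := update_self ..
  have hvp : pos₁ v = pos v := r₁.pos_eq v hv
  have hvseg : ∀ y ∈ l, vseg pos₁ y = vseg pos y := fun y hy => by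
    rw [vseg, r₁.pos_eq _ (hlS y hy).1, r₁.pos_eq _ (hlS y hy).2]; rfl
  have hvsegs : vsegs pos₁ l = vsegs pos l := by
    ext z
    exact ⟨fun ⟨y, hy, hz⟩ => ⟨y, hy, hvseg y hy ▸ hz⟩,
      fun ⟨y, hy, hz⟩ => ⟨y, hy, (hvseg y hy).symm ▸ hz⟩⟩
  have hpZ : p ∉ vsegs pos₁ l := by rw [hvsegs]; exact (hpz p (right_mem_segment ℝ _ _)).1
  -- the second leaf
  obtain ⟨ρ', hρ', D', hD', hD0', hzone'⟩ := h₁.leaf_zone hS₁ hE₁ (isClosed_vsegs pos₁ l)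
    (v := v) (by rw [hvsegs, hvp]; exact hvZ)
  obtain ⟨B, hB, hBdef⟩ : ∃ B : Set Plane, B.Finite ∧ B = _ :=
    ⟨_, hG₁.finite_special h₁ hS₁ hE₁, rfl⟩
  have hT : (⋃ e ∈ insert s(u, f) E, range (curve₁ e).dir).Finite :=
    hE₁.biUnion fun e _ => finite_range _
  have hT' : ((fun y : V × V => pos₁ y.2 - pos₁ y.1) '' {y | y ∈ l}).Finite :=
    (List.finite_toSet l).image _
  -- The excluded lines are those that would make the leaf edge at `v` bad, those joining `p` to
  -- another special point, and those through `p` parallel to a segment of the drawing or of the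
  -- family. The point `p` itself is special, being a vertex, and must be left out of the second
  -- kind.
  obtain ⟨q, hq, hqL⟩ := exists_off_lines (pos₁ v) hρ'
    (((hD'.image fun d => (pos₁ v, d)).union ((hB.sdiff (t := {p})).image fun z => (p, z - p))).union
      ((hT.union hT').image fun t => (p, t)))
    (by
      rintro _ ((⟨d, hd, rfl⟩ | ⟨z, hz, rfl⟩) | ⟨t, ht, rfl⟩)
      · exact hD0' d hd
      · exact sub_ne_zero.2 hz.2
      · rcases ht with ht | ⟨y, hy, rfl⟩
        · simp only [mem_iUnion, mem_range] at ht
          obtain ⟨e, he, i, rfl⟩ := ht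
          exact (h₁.proper e he).dir_ne_zero i
        · exact sub_ne_zero.2 (hG₁.of_mem hy).1.ne.symm)
  obtain ⟨hqv, hqz⟩ := hzone' q hq fun d hd => hqL _ (.inl (.inl ⟨d, hd, rfl⟩))
  have hqB : ∀ z ∈ B, z ≠ p → cross (q - p) (z - p) ≠ 0 := fun z hz hzp =>
    hqL _ (.inl (.inr ⟨z, ⟨hz, hzp⟩, rfl⟩))
  have hqT : ∀ e ∈ insert s(u, f) E, ∀ i, cross (q - p) ((curve₁ e).dir i) ≠ 0 := fun e he i =>
    hqL _ (.inr ⟨_, .inl (by simp only [mem_iUnion, mem_range]; exact ⟨e, he, i, rfl⟩), rfl⟩)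
  have hql : ∀ y ∈ l, cross (q - p) (pos₁ y.2 - pos₁ y.1) ≠ 0 := fun y hy =>
    hqL _ (.inr ⟨_, .inr ⟨y, hy, rfl⟩, rfl⟩)
  have hv₁ : v ∈ insert f S := mem_insert_of_mem _ hv
  have hg₁ : g ∉ insert f S := by simp [hg, Ne.symm hfg]
  have r₂ := h₁.attach hv₁ hg₁ hqv hqz (pos₁ v) (pos₁ v)
  set pos₂ := update pos₁ g q with hpos₂
  set curve₂ := update curve₁ s(v, g) (Polyline.straight (pos₁ v) q) with hcurve₂
  have hG₂ : General (insert g (insert f S)) (insert s(v, g) (insert s(u, f) E)) pos₂ curve₂ l := by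
    refine hG₁.routed (List.Subset.refl _) r₂ ?_ ?_
    · rintro y hy (h0 | h0)
      · rcases Sym2.eq_iff.1 h0 with ⟨h1, -⟩ | ⟨-, h1⟩
        · exact (hvl y hy).1 h1
        · exact (hvl y hy).2 h1
      · exact (hG₁.of_mem hy).2.2.2 h0
    · intro z hz y hy hzy
      rw [segment_same, mem_singleton_iff] at hz
      subst hz
      rw [hvp, hvseg y hy] at hzy
      exact absurd ⟨y, hy, hzy⟩ hvZ
  have hBS : ∀ w ∈ insert f S, pos₁ w ∈ B := fun w hw => by
    rw [hBdef]; exact .inl (.inl (.inl (.inl ⟨w, hw, rfl⟩)))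
  have hpos₂f : pos₂ f = p := by rw [hpos₂, update_of_ne hfg, hp₁]
  have hpos₂g : pos₂ g = q := update_self ..
  have hqS : ∀ w ∈ insert f S, pos₁ w ≠ q := fun w hw h0 => by
    by_cases hwv : w = v
    · exact hqv (by rw [← h0, hwv])
    · exact ((hqz q (right_mem_segment ℝ _ _)).2 hqv).1 w hw hwv h0
  have hpq : p ≠ q := by rw [← hp₁]; exact hqS f (mem_insert _ _)
  have hqZ : q ∉ vsegs pos₁ l := (hqz q (right_mem_segment ℝ _ _)).1
  have hvpne : pos₁ v ≠ p := by
    rw [← hp₁]; exact fun h0 => hvf (h₁.inj hv₁ (mem_insert _ _) h0)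
  have hvcr : cross (q - p) (pos₁ v - p) ≠ 0 := hqB _ (hBS v hv₁) hvpne
  -- the special points are off the new segment
  have hoff : ∀ z ∈ segment ℝ p q, z ≠ p → z ∉ B := by
    intro z hz hzp hzB
    apply hqB z hzB hzp
    obtain ⟨s, -, -, hs⟩ := mem_segment_iff'.1 hz
    have : z - p = s • (q - p) := by rw [hs]; abel
    rw [this, cross_smul_right, cross_self, mul_zero]
  have hopen : ∀ z ∈ openSegment ℝ p q, z ∈ segment ℝ p q ∧ z ≠ p ∧ z ≠ q := by
    intro z hz
    refine ⟨openSegment_sub_segment hz, ?_, ?_⟩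
    · rintro rfl; exact hpq (left_mem_openSegment_iff.1 hz)
    · rintro rfl; exact hpq (right_mem_openSegment_iff.1 hz)
  -- The vertex `v` is a special point, hence off the line through `p` and `q`; so the second leaf
  -- edge leaves this line at `q`.
  have hleaf : ∀ z ∈ segment ℝ p q, z ∈ segment ℝ (pos₁ v) q → z = q := by
    intro z hz hz'
    refine eq_of_mem_segments (a := p) (b := q) (a' := pos₁ v) (b' := q) ?_ hz
      (right_mem_segment ℝ _ _) hz' (right_mem_segment ℝ _ _)
    have : q - pos₁ v = (q - p) - (pos₁ v - p) := by abel
    rw [this, cross_sub_left, cross_self, zero_sub, neg_ne_zero, cross_comm, neg_ne_zero]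
    exact hvcr
  have hc₂ : ∀ e ∈ insert s(u, f) E, curve₂ e = curve₁ e := r₂.curve_eq
  have hcg : (curve₂ s(v, g)).carrier = segment ℝ (pos₁ v) q := by
    rw [hcurve₂, update_self, straight_carrier]
  refine ⟨pos₂, curve₂, r₂.rac, r₁.toStraightExt.trans r₂.toStraightExt, ⟨⟨?_, ?_, ?_⟩, ?_, ?_, ?_, ?_⟩,
    hG₂⟩
  · simp only [hpos₂f, hpos₂g]; exact hpq
  · simp only [hpos₂f, hpos₂g]
    rintro w (rfl | hw) hz
    · rw [hpos₂g] at hz; exact (hopen _ hz).2.2 rfl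
    · rw [r₂.pos_eq w hw] at hz
      exact hoff _ (hopen _ hz).1 (hopen _ hz).2.1 (hBS w hw)
  · simp only [hpos₂f, hpos₂g]
    intro z hz e he hc
    obtain ⟨hz1, hzp, hzq⟩ := hopen z hz
    have hzB := hoff z hz1 hzp
    have hng : z ∉ (curve₂ s(v, g)).carrier := by
      rw [hcg]; exact fun h0 => hzq (hleaf z hz1 h0)
    rcases he with rfl | he
    · exact absurd hc hng
    · rw [hc₂ e he] at hc ⊢
      refine ⟨?_, ?_⟩
      · rcases (curve₁ e).mem_carrier_cases hc with ⟨k, hk⟩ | ⟨i, hi⟩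
        · exact absurd (by rw [hBdef]; exact .inl (.inl (.inl (.inr ⟨e, he, k, hk⟩)))) hzB
        · refine ⟨i, hi, ?_⟩
          rw [cross_comm, neg_ne_zero]; exact hqT e he i
      · rintro f' (rfl | hf') hne hc'
        · exact hng hc'
        · rw [hc₂ f' hf'] at hc'
          exact hzB (by rw [hBdef]; exact .inl (.inl (.inr ⟨e, he, f', hf', hne.symm, hc, hc'⟩)))
  · exact mem_insert_of_mem _ (mem_insert _ _)
  · exact mem_insert _ _
  · rintro (h0 | h0 | h0)
    · rcases Sym2.eq_iff.1 h0 with ⟨h1, -⟩ | ⟨h1, -⟩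
      · exact hvf h1.symm
      · exact hfg h1
    · rcases Sym2.eq_iff.1 h0 with ⟨h1, -⟩ | ⟨-, h1⟩
      · exact huf h1.symm
      · exact hug h1.symm
    · exact hnoE g hg f h0
  · intro y hy
    have hy1 := mem_insert_of_mem f (hlS y hy).1
    have hy2 := mem_insert_of_mem f (hlS y hy).2
    have hvy : ∀ y ∈ l, vseg pos₂ y = vseg pos₁ y := fun y hy => by
      rw [vseg, r₂.pos_eq _ (mem_insert_of_mem f (hlS y hy).1),
        r₂.pos_eq _ (mem_insert_of_mem f (hlS y hy).2)]; rfl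
    have hvx : vseg pos₂ (f, g) = segment ℝ p q := by rw [vseg, hpos₂f, hpos₂g]
    have hend : ∀ w ∈ S, pos₁ w ∉ segment ℝ p q := fun w hw hz => by
      refine hoff _ hz ?_ (hBS w (mem_insert_of_mem _ hw))
      rw [← hp₁]
      exact fun h0 => hf (h₁.inj (mem_insert_of_mem _ hw) (mem_insert _ _) h0 ▸ hw)
    simp only [hpos₂f, hpos₂g, hvx, r₂.pos_eq _ hy1, r₂.pos_eq _ hy2, hvy y hy]
    refine ⟨hql y hy, fun h0 => hpZ ⟨y, hy, h0⟩, fun h0 => hqZ ⟨y, hy, h0⟩, hend _ (hlS y hy).1,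
      hend _ (hlS y hy).2, fun z hz hzy => ?_⟩
    have hzp : z ≠ p := by rintro rfl; exact hpZ ⟨y, hy, hzy⟩
    have hzq : z ≠ q := by rintro rfl; exact hqZ ⟨y, hy, hzy⟩
    have hzB := hoff z hz hzp
    refine ⟨?_, ?_⟩
    · rintro e (rfl | he) hc
      · rw [hcg] at hc; exact hzq (hleaf z hz hc)
      · rw [hc₂ e he] at hc
        exact hzB (by rw [hBdef]; exact .inl (.inr ⟨y, hy, hzy, e, he, hc⟩))
    · intro y' hy' hne hzy'
      rw [hvy y' hy'] at hzy'
      exact hzB (by rw [hBdef]; exact .inr ⟨y, hy, y', hy', hne, hzy, hzy'⟩)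

end BRAC

namespace BRAC

open Set Function Polyline

variable {V : Type*} {S S' S₁ S₂ : Set V} {E E' E₁ E₂ : Set (Sym2 V)}
  {pos pos' pos₁ pos₂ : V → Plane} {curve curve' curve₁ curve₂ : Sym2 V → Polyline} {a b : Plane}

/-! ### Drawing long ears -/

/-- A path with end vertices `src`, `tgt` and the inner vertices `fst`, `mid`, `lst`. -/
structure Ear (V : Type*) where
  src : V
  fst : V
  mid : List V
  lst : V
  tgt : V

/-- The inner vertices of an ear. -/
def Ear.inner (t : Ear V) : List V := t.fst :: t.lst :: t.mid

/-- The first and the last edge of an ear. -/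
def Ear.leaves (t : Ear V) : Set (Sym2 V) := {s(t.src, t.fst), s(t.tgt, t.lst)}

/-- The edges of an ear. -/
def Ear.edges (t : Ear V) : Set (Sym2 V) := t.leaves ∪ chainEdges t.fst t.mid t.lst

/-- Draw the first and last edges of a family of ears such that the rest can be drawn along
segments in general position. -/
theorem RACOn.ear_leaves [DecidableEq V] (h : RACOn S E pos curve) (hS : S.Finite) (hE : E.Finite)
    (l : List (Ear V)) (hst : ∀ t ∈ l, t.src ∈ S ∧ t.tgt ∈ S)
    (hnd : (l.flatMap Ear.inner).Nodup) (hout : ∀ t ∈ l, ∀ w ∈ t.inner, w ∉ S) :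
    ∃ pos' curve', RACOn (S ∪ {w | ∃ t ∈ l, w = t.fst ∨ w = t.lst}) (E ∪ {e | ∃ t ∈ l, e ∈ t.leaves})
        pos' curve' ∧
      StraightExt S E pos curve (S ∪ {w | ∃ t ∈ l, w = t.fst ∨ w = t.lst})
        (E ∪ {e | ∃ t ∈ l, e ∈ t.leaves}) pos' curve' ∧
      General (S ∪ {w | ∃ t ∈ l, w = t.fst ∨ w = t.lst}) (E ∪ {e | ∃ t ∈ l, e ∈ t.leaves})
        pos' curve' (l.map fun t => (t.fst, t.lst)) := by
  induction l with
  | nil =>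
    have e1 : S ∪ {w | ∃ t ∈ ([] : List (Ear V)), w = t.fst ∨ w = t.lst} = S := by simp
    have e2 : E ∪ {e | ∃ t ∈ ([] : List (Ear V)), e ∈ t.leaves} = E := by simp
    rw [e1, e2]
    exact ⟨pos, curve, h, StraightExt.refl, trivial⟩
  | cons t l ih =>
    rw [List.flatMap_cons, List.nodup_append] at hnd
    obtain ⟨pos₁, curve₁, r₁, x₁, g₁⟩ := ih (fun t ht => hst t (by simp [ht])) hnd.2.1
      (fun t ht => hout t (by simp [ht]))
    have hfl : t.fst ≠ t.lst := by
      have := hnd.1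
      simp only [Ear.inner, List.nodup_cons, List.mem_cons, not_or] at this
      exact this.1.1
    have hfin1 : {w | ∃ t ∈ l, w = t.fst ∨ w = t.lst}.Finite := by
      refine ((List.finite_toSet (l.map Ear.fst)).union (List.finite_toSet (l.map Ear.lst))).subset ?_
      rintro w ⟨t, ht, rfl | rfl⟩
      · exact .inl (List.mem_map_of_mem ht)
      · exact .inr (List.mem_map_of_mem ht)
    have hfin2 : {e | ∃ t ∈ l, e ∈ t.leaves}.Finite := by
      refine ((List.finite_toSet l).biUnion (t := Ear.leaves) fun t _ => by
        unfold Ear.leaves; exact toFinite _).subset ?_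
      rintro e ⟨t, ht, he⟩
      simp only [mem_iUnion]; exact ⟨t, ht, he⟩
    have hnew : ∀ w ∈ t.inner, w ∉ S ∪ {w | ∃ t ∈ l, w = t.fst ∨ w = t.lst} := by
      rintro w hw (h0 | ⟨t', ht', h0⟩)
      · exact hout t (by simp) w hw h0
      · refine hnd.2.2 w hw w (List.mem_flatMap.2 ⟨t', ht', ?_⟩) rfl
        rcases h0 with rfl | rfl <;> simp [Ear.inner]
    have hdist : ∀ w ∈ S, ∀ y ∈ l.map (fun t => (t.fst, t.lst)), y.1 ≠ w ∧ y.2 ≠ w := by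
      intro w hw y hy
      obtain ⟨t', ht', rfl⟩ := List.mem_map.1 hy
      have := hout t' (by simp [ht'])
      constructor
      · rintro rfl; exact this _ (by simp [Ear.inner]) hw
      · rintro rfl; exact this _ (by simp [Ear.inner]) hw
    obtain ⟨hs, ht⟩ := hst t (by simp)
    obtain ⟨pos₂, curve₂, r₂, x₂, g₂⟩ := g₁.add r₁ (hS.union hfin1) (hE.union hfin2)
      (.inl hs) (.inl ht) (hnew t.fst (by simp [Ear.inner])) (hnew t.lst (by simp [Ear.inner])) hfl
      (hdist _ hs) (hdist _ ht)
    have e1 : S ∪ {w | ∃ t' ∈ t :: l, w = t'.fst ∨ w = t'.lst} =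
        insert t.lst (insert t.fst (S ∪ {w | ∃ t ∈ l, w = t.fst ∨ w = t.lst})) := by
      clear * -
      ext w; simp; grind
    have e2 : E ∪ {e | ∃ t' ∈ t :: l, e ∈ t'.leaves} =
        insert s(t.tgt, t.lst) (insert s(t.src, t.fst) (E ∪ {e | ∃ t ∈ l, e ∈ t.leaves})) := by
      clear * -
      ext w; simp [Ear.leaves]; grind
    rw [e1, e2]
    exact ⟨pos₂, curve₂, r₂, x₁.trans x₂, g₂⟩

/-- A family of ears that are long in comparison to the size of a drawing can be added to it. -/
theorem RACOn.ears [DecidableEq V] (h : RACOn S E pos curve) (hS : S.Finite) {F : Finset (Sym2 V)}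
    (hF : (F : Set (Sym2 V)) = E) (hbend : ∀ e ∈ E, (curve e).bends ≤ 3)
    (l : List (Ear V)) (hst : ∀ t ∈ l, t.src ∈ S ∧ t.tgt ∈ S)
    (hnd : (l.flatMap Ear.inner).Nodup) (hout : ∀ t ∈ l, ∀ w ∈ t.inner, w ∉ S)
    (hlen : ∀ t ∈ l, 16 * F.card + 12 * l.length ≤ t.mid.length + 4) :
    ∃ pos' curve', RACOn (S ∪ {w | ∃ t ∈ l, w ∈ t.inner}) (E ∪ {e | ∃ t ∈ l, e ∈ t.edges})
        pos' curve' ∧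
      StraightExt S E pos curve (S ∪ {w | ∃ t ∈ l, w ∈ t.inner}) (E ∪ {e | ∃ t ∈ l, e ∈ t.edges})
        pos' curve' := by
  have hE : E.Finite := hF ▸ F.finite_toSet
  obtain ⟨pos₁, curve₁, r₁, x₁, g₁⟩ := h.ear_leaves hS hE l hst hnd hout
  let leaf : Finset (Sym2 V) := (l.map fun t => s(t.src, t.fst)).toFinset ∪
    (l.map fun t => s(t.tgt, t.lst)).toFinset
  have hleaf : leaf.card ≤ 2 * l.length := by
    refine (Finset.card_union_le _ _).trans ?_
    have h1 := List.toFinset_card_le (l.map fun t => s(t.src, t.fst))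
    have h2 := List.toFinset_card_le (l.map fun t => s(t.tgt, t.lst))
    simp only [List.length_map] at h1 h2
    omega
  have hF₁ : ((F ∪ leaf : Finset (Sym2 V)) : Set (Sym2 V)) = E ∪ {e | ∃ t ∈ l, e ∈ t.leaves} := by
    rw [Finset.coe_union, hF]
    congr 1
    ext e
    simp only [leaf, Ear.leaves, Finset.coe_union, List.coe_toFinset, List.mem_map, mem_union,
      mem_insert_iff, mem_singleton_iff]
    constructor
    · rintro (⟨t, ht, rfl⟩ | ⟨t, ht, rfl⟩)
      · exact ⟨t, ht, .inl rfl⟩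
      · exact ⟨t, ht, .inr rfl⟩
    · rintro ⟨t, ht, rfl | rfl⟩
      · exact .inl ⟨t, ht, rfl⟩
      · exact .inr ⟨t, ht, rfl⟩
  -- An old edge has at most four segments, and a new leaf edge has one.
  have hsum : ∑ e ∈ F ∪ leaf, ((curve₁ e).bends + 1) ≤ 4 * F.card + 2 * l.length := by
    rw [← Finset.union_sdiff_self_eq_union, Finset.sum_union Finset.disjoint_sdiff]
    have h1 : ∑ e ∈ F, ((curve₁ e).bends + 1) ≤ F.card * 4 := by
      refine Finset.sum_le_card_nsmul _ _ _ fun e he => ?_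
      have heE : e ∈ E := hF ▸ he
      rw [x₁.curve_eq e heE]
      have := hbend e heE
      omega
    have h2 : ∑ e ∈ leaf \ F, ((curve₁ e).bends + 1) ≤ (leaf \ F).card * 1 := by
      refine Finset.sum_le_card_nsmul _ _ _ fun e he => ?_
      rw [Finset.mem_sdiff] at he
      rw [x₁.straight e (hF₁ ▸ by simp [he.1]) (hF ▸ he.2)]
    have h3 := Finset.card_le_card (Finset.sdiff_subset (s := leaf) (t := F))
    omega
  have hmap : ((l.map fun t => (t.fst, t.mid, t.lst)).map fun t => (t.1, t.2.2)) =
      l.map fun t => (t.fst, t.lst) := by simp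
  have hfm : ((l.map fun t => (t.fst, t.mid, t.lst)).flatMap fun t => t.2.1) =
      l.flatMap Ear.mid := by
    simp [List.flatMap_map]
  have hnd' : (l.flatMap Ear.mid).Nodup ∧
      ∀ t ∈ l, ∀ w ∈ t.mid, ∀ t' ∈ l, w ≠ t'.fst ∧ w ≠ t'.lst := by
    clear * - hnd
    induction l with
    | nil => simp
    | cons t l ih =>
      rw [List.flatMap_cons, List.nodup_append] at hnd
      obtain ⟨n1, n2, n3⟩ := hnd
      obtain ⟨i1, i2⟩ := ih n2
      simp only [Ear.inner, List.nodup_cons, List.mem_cons, not_or] at n1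
      have n4 : ∀ a ∈ t.inner, ∀ t' ∈ l, ∀ b ∈ t'.inner, a ≠ b := fun a ha t' ht' b hb =>
        n3 a ha b (List.mem_flatMap.2 ⟨t', ht', hb⟩)
      refine ⟨?_, ?_⟩
      · rw [List.flatMap_cons, List.nodup_append]
        refine ⟨n1.2.2, i1, fun a ha b hb => ?_⟩
        obtain ⟨t', ht', hb⟩ := List.mem_flatMap.1 hb
        exact n4 a (by simp [Ear.inner, ha]) t' ht' b (by simp [Ear.inner, hb])
      · intro t₁ ht₁ w hw t₂ ht₂
        rcases List.mem_cons.1 ht₁ with rfl | ht₁' <;> rcases List.mem_cons.1 ht₂ with rfl | ht₂'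
        · exact ⟨fun e => n1.1.2 (e ▸ hw), fun e => n1.2.1 (e ▸ hw)⟩
        · exact ⟨n4 w (by simp [Ear.inner, hw]) t₂ ht₂' _ (by simp [Ear.inner]),
            n4 w (by simp [Ear.inner, hw]) t₂ ht₂' _ (by simp [Ear.inner])⟩
        · exact ⟨(n4 _ (by simp [Ear.inner]) t₁ ht₁' w (by simp [Ear.inner, hw])).symm,
            (n4 _ (by simp [Ear.inner]) t₁ ht₁' w (by simp [Ear.inner, hw])).symm⟩
        · exact i2 t₁ ht₁' w hw t₂ ht₂'
  obtain ⟨pos₂, curve₂, r₂, x₂⟩ := RACOn.resolve_all (l.map fun t => (t.fst, t.mid, t.lst)) _ _ pos₁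
    curve₁ (hS.union (by
      refine ((List.finite_toSet (l.map Ear.fst)).union (List.finite_toSet (l.map Ear.lst))).subset ?_
      rintro w ⟨t, ht, rfl | rfl⟩
      · exact .inl (List.mem_map_of_mem ht)
      · exact .inr (List.mem_map_of_mem ht)))
    (hF₁ ▸ Finset.finite_toSet _) r₁ (by rw [hmap]; exact g₁) (by rw [hfm]; exact hnd'.1)
    (by
      intro t' ht' w hw
      obtain ⟨t, ht, rfl⟩ := List.mem_map.1 ht'
      rintro (h0 | ⟨t', ht', h0⟩)
      · exact hout t ht w (by simp only at hw; simp [Ear.inner, hw]) h0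
      · have := hnd'.2 t ht w hw t' ht'
        tauto)
    (by
      intro t' ht'
      obtain ⟨t, ht, rfl⟩ := List.mem_map.1 ht'
      have hmem : (t.fst, t.lst) ∈ l.map fun t => (t.fst, t.lst) :=
        List.mem_map_of_mem (f := fun t : Ear V => (t.fst, t.lst)) ht
      -- With at most `4|F| + 2|l|` crossings with the drawing and `|l|` paths in the list, the
      -- budget `4(4|F| + 3|l|)` of `RACOn.resolve_all` is exactly the hypothesis `hlen`.
      have := ((g₁.of_mem hmem).1.crossings_ncard hF₁).2
      have h0 := hlen t ht
      simp only [List.length_map]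
      simp only at this
      omega)
  have e1 : S ∪ {w | ∃ t ∈ l, w ∈ t.inner} = S ∪ {w | ∃ t ∈ l, w = t.fst ∨ w = t.lst} ∪
      {w | ∃ t ∈ l.map fun t => (t.fst, t.mid, t.lst), w ∈ t.2.1} := by
    rw [union_assoc]; congr 1
    ext w
    simp only [Ear.inner, List.mem_cons, List.mem_map, mem_union, mem_ofPred_eq]
    constructor
    · rintro ⟨t, ht, h0 | h0 | h0⟩
      exacts [.inl ⟨t, ht, .inl h0⟩, .inl ⟨t, ht, .inr h0⟩, .inr ⟨_, ⟨t, ht, rfl⟩, h0⟩]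
    · rintro (⟨t, ht, h0 | h0⟩ | ⟨_, ⟨t, ht, rfl⟩, h0⟩)
      exacts [⟨t, ht, .inl h0⟩, ⟨t, ht, .inr (.inl h0)⟩, ⟨t, ht, .inr (.inr h0)⟩]
  have e2 : E ∪ {e | ∃ t ∈ l, e ∈ t.edges} = E ∪ {e | ∃ t ∈ l, e ∈ t.leaves} ∪
      {e | ∃ t ∈ l.map fun t => (t.fst, t.mid, t.lst), e ∈ chainEdges t.1 t.2.1 t.2.2} := by
    rw [union_assoc]; congr 1
    ext w
    simp only [Ear.edges, List.mem_map, mem_union, mem_ofPred_eq]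
    constructor
    · rintro ⟨t, ht, h0 | h0⟩
      exacts [.inl ⟨t, ht, h0⟩, .inr ⟨_, ⟨t, ht, rfl⟩, h0⟩]
    · rintro (⟨t, ht, h0⟩ | ⟨_, ⟨t, ht, rfl⟩, h0⟩)
      exacts [⟨t, ht, .inl h0⟩, ⟨t, ht, .inr h0⟩]
  rw [e1, e2]
  exact ⟨pos₂, curve₂, r₂, x₁.trans x₂⟩

/-! ### Extendability of drawings -/

/-- The vertices that are incident to an edge of a set. -/
def verts (E : Set (Sym2 V)) : Set V := {v | ∃ e ∈ E, v ∈ e}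

/-- Every RAC drawing of the graph with edge set `E` with at most three bends per edge extends
to the edge set `E'` by means of straight edges. -/
def Extendable (E E' : Set (Sym2 V)) : Prop :=
  ∀ pos curve, RACOn (verts E) E pos curve → (∀ e ∈ E, (curve e).bends ≤ 3) →
    ∃ pos' curve', RACOn (verts E') E' pos' curve' ∧
      StraightExt (verts E) E pos curve (verts E') E' pos' curve'

theorem Extendable.refl (E : Set (Sym2 V)) : Extendable E E := fun pos curve h _ =>
  ⟨pos, curve, h, StraightExt.refl⟩

/-- The bound of three bends per edge is inherited by the intermediate drawing because the edges
added to it are straight. -/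
theorem Extendable.trans (h : Extendable E E₁) (h' : Extendable E₁ E₂) : Extendable E E₂ := by
  intro pos curve hr hb
  obtain ⟨pos₁, curve₁, r₁, x₁⟩ := h pos curve hr hb
  obtain ⟨pos₂, curve₂, r₂, x₂⟩ := h' pos₁ curve₁ r₁ (by
    intro e he
    by_cases heE : e ∈ E
    · rw [x₁.curve_eq e heE]; exact hb e heE
    · rw [x₁.straight e he heE]; omega)
  exact ⟨pos₂, curve₂, r₂, x₁.trans x₂⟩

theorem finite_verts (hE : E.Finite) : (verts E).Finite := by
  refine (hE.biUnion (t := fun e => {v | v ∈ e}) fun e _ => ?_).subset ?_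
  · induction e with
    | _ x y =>
      refine (toFinite {x, y}).subset fun v hv => ?_
      simpa using hv
  · rintro v ⟨e, he, hv⟩
    simp only [mem_iUnion]; exact ⟨e, he, hv⟩

/-- A finite set of points may be placed anew off the drawing. -/
theorem RACOn.place_finite [DecidableEq V] (h : RACOn S E pos curve) (hS : S.Finite)
    (hE : E.Finite) {T : Set V} (hT : T.Finite) :
    ∃ pos', RACOn (S ∪ T) E pos' curve ∧ ∀ v ∈ S, pos' v = pos v := by
  induction T, hT using Set.Finite.induction_on with
  | empty => exact ⟨pos, by simpa using h, fun _ _ => rfl⟩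
  | @insert x T _ hT ih =>
    obtain ⟨pos₁, h₁, hp₁⟩ := ih
    by_cases hx : x ∈ S ∪ T
    · refine ⟨pos₁, ?_, hp₁⟩
      rwa [union_insert, insert_eq_of_mem hx]
    · have hL : ∀ P : Polyline, ∃ L : Set (Plane × Plane), L.Finite ∧ (∀ l ∈ L, l.2 ≠ 0) ∧
          ∀ q ∈ P.carrier, ∃ l ∈ L, cross (q - l.1) l.2 = 0 := by
        intro P
        -- Degenerate segments are not excluded for an arbitrary polyline; they receive an arbitrary
        -- nonzero direction.
        refine ⟨range fun i => (P.pt i.castSucc, if P.dir i = 0 then !₂[1, 0] else P.dir i),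
          finite_range _, ?_, ?_⟩
        · rintro _ ⟨i, rfl⟩
          dsimp only
          split_ifs with h0
          · intro h1
            have := congrArg (fun w : Plane => w 0) h1
            simp at this
          · exact h0
        · intro q hq
          obtain ⟨i, hi⟩ := mem_iUnion.1 hq
          refine ⟨_, ⟨i, rfl⟩, ?_⟩
          obtain ⟨s, -, -, hs⟩ := mem_segment_iff'.1 hi
          have e1 : q - P.pt i.castSucc = s • P.dir i := by rw [hs, Polyline.dir]; abel
          dsimp only
          rw [e1, cross_smul_left]
          split_ifs with h0
          · rw [h0]; simp [cross]
          · rw [cross_self, mul_zero]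
      choose L hLf hL0 hLc using hL
      obtain ⟨q, -, hq⟩ := exists_off_lines 0 one_pos
        (((hE.biUnion fun e _ => hLf (curve e))).union
          (((hS.union hT).image pos₁).image fun z => (z, !₂[(1 : ℝ), 0])))
        (by
          rintro l (hl | ⟨z, hz, rfl⟩)
          · simp only [mem_iUnion] at hl
            obtain ⟨e, he, hl⟩ := hl
            exact hL0 _ l hl
          · intro h1
            have := congrArg (fun w : Plane => w 0) h1
            simp at this)
      refine ⟨update pos₁ x q, ?_, fun v hv => ?_⟩
      · rw [union_insert]
        refine h₁.place hx (fun hq' => ?_) fun e he hc => ?_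
        · exact hq _ (.inr ⟨q, hq', rfl⟩) (by simp [cross])
        · obtain ⟨l, hl, h0⟩ := hLc _ q hc
          refine hq l (.inl ?_) h0
          simp only [mem_iUnion]
          exact ⟨e, he, hl⟩
      · rw [update_of_ne (fun h0 : v = x => hx (.inl (by rwa [h0] at hv)))]
        exact hp₁ v hv

/-- Adding a leaf. -/
theorem extendable_leaf [DecidableEq V] (hE : E.Finite) {x y : V} (hxy : x ≠ y)
    (hy : y ∉ verts E) : Extendable E (insert s(x, y) E) := by
  intro pos curve h _
  -- The vertex `x` need not be incident to any edge of `E`; if it is not, it first gets a position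
  -- of its own.
  obtain ⟨pos₁, h₁, hp₁⟩ := h.place_finite (finite_verts hE) hE (finite_singleton x)
  have hx : x ∈ verts E ∪ {x} := by simp
  have hy' : y ∉ verts E ∪ {x} := by
    rintro (h0 | h0)
    exacts [hy h0, hxy h0.symm]
  obtain ⟨ρ, hρ, D, hD, hD0, hzone⟩ := h₁.leaf_zone ((finite_verts hE).union (finite_singleton x))
    hE isClosed_empty (v := x) (by simp)
  obtain ⟨p, hp, hpD⟩ := exists_off_lines (pos₁ x) hρ (hD.image fun d => (pos₁ x, d))
    (by rintro _ ⟨d, hd, rfl⟩; exact hD0 d hd)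
  obtain ⟨hpu, hpz⟩ := hzone p hp fun d hd => hpD _ ⟨d, hd, rfl⟩
  have r := h₁.attach hx hy' hpu hpz 0 0
  have hv : verts (insert s(x, y) E) = insert y (verts E ∪ {x}) := by
    ext v
    constructor
    · rintro ⟨e, rfl | he, hve⟩
      · rcases Sym2.mem_iff.1 hve with rfl | rfl <;> simp
      · exact .inr (.inl ⟨e, he, hve⟩)
    · rintro (rfl | ⟨e, he, hve⟩ | rfl)
      · exact ⟨s(x, v), by simp, by simp⟩
      · exact ⟨e, .inr he, hve⟩
      · exact ⟨s(v, y), by simp, by simp⟩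
  rw [hv]
  refine ⟨_, _, r.rac, ?_⟩
  have x0 : StraightExt (verts E) E pos curve (verts E ∪ {x}) E pos₁ curve :=
    ⟨subset_union_left, Subset.rfl, hp₁, fun _ _ => rfl, fun _ h h' => absurd h h'⟩
  exact x0.trans r.toStraightExt

/-- Adding long ears. -/
theorem extendable_ears [DecidableEq V] {F : Finset (Sym2 V)} (l : List (Ear V))
    (hst : ∀ t ∈ l, ∀ t' ∈ l, ∀ w ∈ t'.inner, t.src ≠ w ∧ t.tgt ≠ w)
    (hnd : (l.flatMap Ear.inner).Nodup) (hout : ∀ t ∈ l, ∀ w ∈ t.inner, w ∉ verts (F : Set (Sym2 V)))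
    (hlen : ∀ t ∈ l, 16 * F.card + 12 * l.length ≤ t.mid.length + 4) :
    Extendable (F : Set (Sym2 V)) (F ∪ {e | ∃ t ∈ l, e ∈ t.edges}) := by
  intro pos curve h hb
  have hE : (F : Set (Sym2 V)).Finite := F.finite_toSet
  have hT : {v | v ∈ l.map Ear.src ++ l.map Ear.tgt}.Finite := List.finite_toSet _
  -- The ends of the ears may be isolated after the removal of all long chains, so they are placed
  -- beforehand.
  obtain ⟨pos₁, h₁, hp₁⟩ := h.place_finite (finite_verts hE) hE hT
  obtain ⟨pos₂, curve₂, r₂, x₂⟩ := h₁.ears ((finite_verts hE).union hT) rfl hb l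
    (fun t ht => ⟨.inr (by simp; exact .inl ⟨t, ht, rfl⟩), .inr (by simp; exact .inr ⟨t, ht, rfl⟩)⟩)
    hnd
    (by
      rintro t ht w hw (h0 | h0)
      · exact hout t ht w hw h0
      · simp only [List.mem_append, List.mem_map, mem_ofPred_eq] at h0
        rcases h0 with ⟨t', ht', h0⟩ | ⟨t', ht', h0⟩
        · exact (hst t' ht' t ht w hw).1 h0
        · exact (hst t' ht' t ht w hw).2 h0) hlen
  have x0 : StraightExt (verts (F : Set (Sym2 V))) F pos curve
      (verts (F : Set (Sym2 V)) ∪ {v | v ∈ l.map Ear.src ++ l.map Ear.tgt}) F pos₁ curve :=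
    ⟨subset_union_left, Subset.rfl, hp₁, fun _ _ => rfl, fun _ h h' => absurd h h'⟩
  have x3 := x0.trans x₂
  have hsub : verts (F ∪ {e | ∃ t ∈ l, e ∈ t.edges} : Set (Sym2 V)) ⊆
      verts (F : Set (Sym2 V)) ∪ {v | v ∈ l.map Ear.src ++ l.map Ear.tgt} ∪
        {w | ∃ t ∈ l, w ∈ t.inner} := by
    rintro v ⟨e, he, hv⟩
    exact r₂.mem e he v hv
  refine ⟨pos₂, curve₂, r₂.mono hsub fun e he v hv => ⟨e, he, hv⟩, ?_, x3.subE, x3.pos_eq,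
    x3.curve_eq, x3.straight⟩
  rintro v ⟨e, he, hv⟩
  exact ⟨e, .inl he, hv⟩

end BRAC

namespace BRAC

open Set Function Polyline

/-! ### Drawings of graphs and of edge sets -/

section Transfer

variable {V V' : Type*} {G : SimpleGraph V} {H : SimpleGraph V'} {U : Type*}

/-- The image of the edges of a graph under a map of the vertices. -/
def edgeImage (G : SimpleGraph V) (ι : V → U) : Set (Sym2 U) := Sym2.map ι '' G.edgeSet

/-- Over a fixed vertex type `U`, graphs can grow edge by edge without a change of types. Only
vertices on edges are recorded; isolated ones can be placed again at any time. -/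
theorem Drawing.exists_racOn (D : Drawing G) (hD : D.IsRAC) {ι : V → U} (hι : Injective ι) :
    ∃ (pos : U → Plane) (curve : Sym2 U → Polyline),
      RACOn (verts (edgeImage G ι)) (edgeImage G ι) pos curve ∧
      (∀ v, pos (ι v) = D.pos v) ∧ ∀ e : G.edgeSet, curve (Sym2.map ι e) = D.curve e := by
  classical
  have hinj : Injective fun e : G.edgeSet => Sym2.map ι (e : Sym2 V) :=
    (Sym2.map.injective hι).comp Subtype.val_injective
  let pos : U → Plane := extend ι D.pos fun _ => 0
  let curve : Sym2 U → Polyline :=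
    extend (fun e : G.edgeSet => Sym2.map ι (e : Sym2 V)) D.curve fun _ => straight 0 0
  have hpos : ∀ v, pos (ι v) = D.pos v := fun v => hι.extend_apply _ _ v
  have hcurve : ∀ e : G.edgeSet, curve (Sym2.map ι e) = D.curve e := fun e => by
    simpa only using hinj.extend_apply D.curve (fun _ => straight 0 0) e
  have hverts : ∀ v ∈ verts (edgeImage G ι), ∃ w, ι w = v := by
    rintro v ⟨_, ⟨e, _, rfl⟩, hv⟩
    obtain ⟨w, -, hw⟩ := Sym2.mem_map.1 hv
    exact ⟨w, hw⟩
  have hint : ∀ e : G.edgeSet, ∀ v, v ∈ (e : Sym2 V) → D.pos v ∈ (D.curve e).carrier := by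
    intro e v hv
    have : D.pos v ∈ Sym2.map D.pos (e : Sym2 V) := Sym2.mem_map.2 ⟨v, hv, rfl⟩
    rw [← D.joins e] at this
    rcases Sym2.mem_iff.1 this with h | h <;> rw [h]
    exacts [start_mem_carrier _, finish_mem_carrier _]
  refine ⟨pos, curve, ⟨?_, fun e he v hv => ⟨e, he, hv⟩, ?_, ?_, ?_, ?_⟩, hpos, hcurve⟩
  · intro v hv w hw h
    obtain ⟨v, rfl⟩ := hverts v hv
    obtain ⟨w, rfl⟩ := hverts w hw
    rw [hpos, hpos] at h
    rw [D.pos_injective h]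
  · rintro _ ⟨e, he, rfl⟩
    rw [hcurve ⟨e, he⟩]; exact D.proper _
  · rintro _ ⟨e, he, rfl⟩
    rw [hcurve ⟨e, he⟩, D.joins, Sym2.map_map]
    congr 1
    funext v; exact (hpos v).symm
  · rintro v hv _ ⟨e, he, rfl⟩ hve
    obtain ⟨v, rfl⟩ := hverts v hv
    rw [hcurve ⟨e, he⟩, hpos]
    have hve' : v ∉ e := fun h => hve (Sym2.mem_map.2 ⟨v, h, rfl⟩)
    intro hc
    -- A drawing only keeps `v` out of the interior of the curve, whereas `RACOn` forbids the whole
    -- carrier. The end points are excluded by the injectivity of the positions.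
    refine D.avoids v ⟨e, he⟩ hve' ⟨hc, fun hends => ?_⟩
    have : D.pos v ∈ s((D.curve ⟨e, he⟩).start, (D.curve ⟨e, he⟩).finish) := by
      simpa using hends
    rw [D.joins] at this
    obtain ⟨w, hw, hwv⟩ := Sym2.mem_map.1 this
    exact hve' (D.pos_injective hwv ▸ hw)
  · rintro _ ⟨e, he, rfl⟩ _ ⟨f, hf, rfl⟩ hef z hz
    rw [hcurve ⟨e, he⟩, hcurve ⟨f, hf⟩] at hz ⊢
    refine hD ⟨e, he⟩ ⟨f, hf⟩ (fun h => hef ?_) z hz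
    rw [Subtype.mk.inj h]

/-- The isolated vertices of `G` are put off the drawing, which is why the positions are only
prescribed at the ends of edges. -/
theorem RACOn.exists_drawing [DecidableEq U] [Finite V] {ι : V → U} (hι : Injective ι)
    {pos : U → Plane} {curve : Sym2 U → Polyline}
    (h : RACOn (verts (edgeImage G ι)) (edgeImage G ι) pos curve) :
    ∃ D : Drawing G, D.IsRAC ∧ (∀ v, ι v ∈ verts (edgeImage G ι) → D.pos v = pos (ι v)) ∧
      ∀ e, D.curve e = curve (Sym2.map ι e) := by
  have hE : (edgeImage G ι).Finite := (toFinite _).image _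
  obtain ⟨pos', h', hp⟩ := h.place_finite (finite_verts hE) hE (finite_range ι)
  have hmem : ∀ e : G.edgeSet, Sym2.map ι e ∈ edgeImage G ι := fun e => ⟨e, e.2, rfl⟩
  have hinj : Injective (Sym2.map ι) := Sym2.map.injective hι
  refine ⟨⟨fun v => pos' (ι v), ?_, fun e => curve (Sym2.map ι e), fun e => h'.proper _ (hmem e),
    ?_, ?_⟩, ?_, fun v hv => hp _ hv, fun e => rfl⟩
  · intro v w hvw
    exact hι (h'.inj (.inr ⟨v, rfl⟩) (.inr ⟨w, rfl⟩) hvw)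
  · intro e
    rw [h'.joins _ (hmem e), Sym2.map_map]; rfl
  · intro v e hve hc
    refine h'.avoids (ι v) (.inr ⟨v, rfl⟩) _ (hmem e) (fun hm => ?_) hc.1
    obtain ⟨w, hw, hwv⟩ := Sym2.mem_map.1 hm
    exact hve (hι hwv ▸ hw)
  · intro e f hef z hz
    exact h'.rac _ (hmem e) _ (hmem f) (fun h0 => hef (Subtype.ext (hinj h0))) z hz

theorem finsum_eq_of_support_subset_range {α γ : Type*} {f : α → ℕ} {g : γ → α} (hg : Injective g)
    (h : ∀ a, a ∉ range g → f a = 0) : ∑ᶠ a, f a = ∑ᶠ c, f (g c) := by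
  rw [← finsum_mem_range hg (f := f), finsum_mem_def, indicator_eq_self.2]
  intro a ha
  by_contra h0
  exact ha (h a h0)

/-- Extendability of edge sets yields extensions of drawings. -/
theorem exists_extends [DecidableEq U] [Finite V] {ι : V → U} (hι : Injective ι)
    (φ : H →g G) (hφ : Injective φ) (hH : ∀ v, ∃ w, H.Adj v w)
    (hext : Extendable (edgeImage H (ι ∘ φ)) (edgeImage G ι))
    {β : G.edgeSet → Fin 4} {β' : H.edgeSet → Fin 4} (hβ : ∀ e, β' e = β (φ.mapEdgeSet e))
    (D' : Drawing H) (hD' : D'.IsRAC) (hr : D'.Respects β') :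
    ∃ D : Drawing G, D.IsRAC ∧ D.Respects β ∧ D.Extends D' φ ∧ D.totalBends = D'.totalBends := by
  obtain ⟨pos, curve, h, hpos, hcurve⟩ := D'.exists_racOn hD' (hι.comp hφ)
  obtain ⟨pos₁, curve₁, h₁, x⟩ := hext pos curve h (by
    rintro _ ⟨e, he, rfl⟩
    rw [hcurve ⟨e, he⟩]
    have := hr ⟨e, he⟩
    omega)
  obtain ⟨D, hD, hDpos, hDcurve⟩ := h₁.exists_drawing hι
  have hmap : ∀ e : H.edgeSet, Sym2.map ι (φ.mapEdgeSet e : Sym2 V) = Sym2.map (ι ∘ φ) e := by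
    intro e
    show Sym2.map ι (Sym2.map φ e) = _
    rw [Sym2.map_map]
  have hold : ∀ e : H.edgeSet, D.curve (φ.mapEdgeSet e) = D'.curve e := by
    intro e
    rw [hDcurve, hmap, x.curve_eq _ ⟨e, e.2, rfl⟩, hcurve]
  have hnew : ∀ e : G.edgeSet, e ∉ range φ.mapEdgeSet → (D.curve e).bends = 0 := by
    intro e he
    rw [hDcurve]
    refine x.straight _ ⟨e, e.2, rfl⟩ ?_
    rintro ⟨f, hf, hfe⟩
    refine he ⟨⟨f, hf⟩, Subtype.ext (Sym2.map.injective hι ?_)⟩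
    rw [hmap]; exact hfe
  refine ⟨D, hD, fun e => ?_, ⟨fun v => ?_, hold⟩, ?_⟩
  · by_cases he : e ∈ range φ.mapEdgeSet
    · obtain ⟨f, rfl⟩ := he
      rw [hold, ← hβ]; exact hr f
    · rw [hnew e he]; omega
  -- Positions are only controlled on vertices with an edge; by `hH`, these are all vertices of `H`.
  · obtain ⟨w, hw⟩ := hH v
    have hv : ι (φ v) ∈ verts (edgeImage H (ι ∘ φ)) :=
      ⟨_, ⟨s(v, w), hw, rfl⟩, by simp⟩
    rw [hDpos _ (x.sub hv), x.pos_eq _ hv]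
    exact hpos v
  · rw [Drawing.totalBends, finsum_eq_of_support_subset_range
      (SimpleGraph.Hom.mapEdgeSet.injective φ hφ) hnew]
    simp only [hold]; rfl

/-- The restriction of a drawing to a subgraph. -/
def Drawing.restrict (D : Drawing G) (φ : H →g G) (hφ : Injective φ) : Drawing H where
  pos v := D.pos (φ v)
  pos_injective := D.pos_injective.comp hφ
  curve e := D.curve (φ.mapEdgeSet e)
  proper e := D.proper _
  joins e := by
    rw [D.joins]
    show Sym2.map D.pos (Sym2.map φ e) = _
    rw [Sym2.map_map]; rfl
  avoids v e hve := D.avoids (φ v) (φ.mapEdgeSet e) fun hm => by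
    obtain ⟨w, hw, hwv⟩ := Sym2.mem_map.1 (show φ v ∈ Sym2.map φ e from hm)
    exact hve (hφ hwv ▸ hw)

theorem Drawing.restrict_isRAC {D : Drawing G} (hD : D.IsRAC) (φ : H →g G) (hφ : Injective φ) :
    (D.restrict φ hφ).IsRAC := fun e f hef z hz =>
  hD (φ.mapEdgeSet e) (φ.mapEdgeSet f)
    (fun h => hef (SimpleGraph.Hom.mapEdgeSet.injective φ hφ h)) z hz

theorem Drawing.totalBends_restrict_le [Finite V] [Finite V'] (D : Drawing G) (φ : H →g G)
    (hφ : Injective φ) : (D.restrict φ hφ).totalBends ≤ D.totalBends := by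
  classical
  have hinj := SimpleGraph.Hom.mapEdgeSet.injective φ hφ
  have := Fintype.ofFinite G.edgeSet
  have := Fintype.ofFinite H.edgeSet
  rw [totalBends, totalBends, finsum_eq_sum_of_fintype, finsum_eq_sum_of_fintype]
  calc ∑ e, ((D.restrict φ hφ).curve e).bends = ∑ e ∈ Finset.univ.image φ.mapEdgeSet, (D.curve e).bends := by
        rw [Finset.sum_image fun x _ y _ h => hinj h]; rfl
    _ ≤ _ := Finset.sum_le_sum_of_subset (Finset.subset_univ _)

theorem Drawing.totalBends_le [Finite V] {D : Drawing G} {β : G.edgeSet → Fin 4}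
    (h : D.Respects β) : D.totalBends ≤ 3 * G.edgeSet.ncard := by
  have := Fintype.ofFinite G.edgeSet
  rw [totalBends, finsum_eq_sum_of_fintype, ← Nat.card_coe_set_eq, Nat.card_eq_fintype_card,
    mul_comm]
  refine Finset.sum_le_card_nsmul _ _ _ fun e _ => ?_
  have := h e
  omega

/-- An instance is equivalent to a subgraph instance from which all drawings extend. -/
theorem Instance.isYes_iff {I I' : Instance} (φ : I'.graph →g I.graph) (hφ : Injective φ)
    (hb : I'.b = min I.b (3 * I'.m)) (hβ : ∀ e, I'.β e = I.β (φ.mapEdgeSet e))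
    (hext : ∀ D' : Drawing I'.graph, D'.IsRAC → D'.Respects I'.β →
      ∃ D : Drawing I.graph, D.IsRAC ∧ D.Respects I.β ∧ D.Extends D' φ ∧
        D.totalBends = D'.totalBends) : I.IsYes ↔ I'.IsYes := by
  constructor
  · rintro ⟨D, h1, h2, h3⟩
    have hr : (D.restrict φ hφ).Respects I'.β := fun e => by rw [hβ]; exact h3 _
    refine ⟨D.restrict φ hφ, D.restrict_isRAC h1 φ hφ, ?_, hr⟩
    rw [hb]
    -- The bound `3m'` holds automatically for drawings that respect the labels.
    exact le_min ((D.totalBends_restrict_le φ hφ).trans h2) (Drawing.totalBends_le hr)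
  · rintro ⟨D', h1, h2, h3⟩
    obtain ⟨D, g1, g2, -, g3⟩ := hext D' h1 h3
    refine ⟨D, g1, ?_, g2⟩
    rw [g3]
    exact h2.trans (hb ▸ min_le_left _ _)

end Transfer

end BRAC

namespace BRAC

open Set Function

/-! ### Indexed edges

The edges are indexed by natural numbers; `U e` and `W e` are the end vertices of the edge `e`. -/

section Indexed

variable (U W : ℕ → ℕ)

/-- The edge `e` is incident to the vertex `x`. -/
def Inc (e x : ℕ) : Prop := U e = x ∨ W e = x

instance (e x : ℕ) : Decidable (Inc U W e x) := by unfold Inc; infer_instance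

/-- The edge `e` joins `x` and `y`. -/
def Joins (e x y : ℕ) : Prop := (U e = x ∧ W e = y) ∨ (U e = y ∧ W e = x)

/-- The edge with index `e`. -/
def sedge (e : ℕ) : Sym2 ℕ := s(U e, W e)

/-- The edges of `A` at the vertex `x`. -/
def star (A : Finset ℕ) (x : ℕ) : Finset ℕ := A.filter fun e => Inc U W e x

/-- The degree of `x`. -/
def deg (A : Finset ℕ) (x : ℕ) : ℕ := (star U W A x).card

/-- The sum of the indices of the edges at `x`. -/
def esum (A : Finset ℕ) (x : ℕ) : ℕ := ∑ e ∈ star U W A x, e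

/-- The edges with index in `A`. -/
def edgesOf (A : Finset ℕ) : Set (Sym2 ℕ) := sedge U W '' A

/-- The indexed edges form a simple graph. -/
structure SimpleOn (A : Finset ℕ) : Prop where
  loopless : ∀ e ∈ A, U e ≠ W e
  inj : InjOn (sedge U W) A

variable {U W} {A B : Finset ℕ} {e x y z : ℕ}

theorem Joins.symm (h : Joins U W e x y) : Joins U W e y x := Or.symm h

theorem Joins.inc_left (h : Joins U W e x y) : Inc U W e x := by
  rcases h with h | h
  exacts [.inl h.1, .inr h.2]

theorem Joins.inc_right (h : Joins U W e x y) : Inc U W e y := h.symm.inc_left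

theorem Inc.joins (h : Inc U W e x) : Joins U W e x (U e + W e - x) := by
  rcases h with rfl | rfl
  · left; omega
  · right; omega

theorem Joins.sedge_eq (h : Joins U W e x y) : sedge U W e = s(x, y) := by
  rcases h with ⟨rfl, rfl⟩ | ⟨rfl, rfl⟩
  exacts [rfl, Sym2.eq_swap]

theorem mem_sedge : x ∈ sedge U W e ↔ Inc U W e x := by
  simp [sedge, Inc, eq_comm]

theorem mem_star : e ∈ star U W A x ↔ e ∈ A ∧ Inc U W e x := Finset.mem_filter

theorem SimpleOn.mono (h : SimpleOn U W A) (hB : B ⊆ A) : SimpleOn U W B :=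
  ⟨fun e he => h.loopless e (hB he), h.inj.mono hB⟩

/-- The sum of the edge indices at a leaf is the index of its only edge, so leaves can be removed
without adjacency lists. -/
theorem star_eq_of_deg_one (h : deg U W A x = 1) : star U W A x = {esum U W A x} := by
  obtain ⟨e, he⟩ := Finset.card_eq_one.1 h
  rw [esum, he, Finset.sum_singleton]

/-- Subtracting one of the two indices from their sum leaves the other one: this is how a chain is
followed through a vertex of degree two. -/
theorem star_eq_of_deg_two (h : deg U W A x = 2) (he : e ∈ A) (hx : Inc U W e x) :
    star U W A x = {e, esum U W A x - e} ∧ e ≠ esum U W A x - e := by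
  obtain ⟨a, b, hab, hs⟩ := Finset.card_eq_two.1 h
  have hsum : esum U W A x = a + b := by rw [esum, hs, Finset.sum_pair hab]
  have hmem : e ∈ star U W A x := mem_star.2 ⟨he, hx⟩
  rw [hs, Finset.mem_insert, Finset.mem_singleton] at hmem
  rcases hmem with rfl | rfl
  · rw [hsum, Nat.add_sub_cancel_left, hs]; exact ⟨rfl, hab⟩
  · rw [hsum, Nat.add_sub_cancel, hs]; exact ⟨Finset.pair_comm _ _, hab.symm⟩

theorem star_erase : star U W (A.erase e) x = (star U W A x).erase e := by
  ext f; simp only [mem_star, Finset.mem_erase]; tauto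

theorem deg_erase (he : e ∈ A) :
    deg U W (A.erase e) x = if Inc U W e x then deg U W A x - 1 else deg U W A x := by
  rw [deg, star_erase]
  split_ifs with h
  · rw [Finset.card_erase_of_mem (mem_star.2 ⟨he, h⟩)]; rfl
  · rw [Finset.erase_eq_of_notMem fun hm => h (mem_star.1 hm).2]; rfl

theorem esum_erase (he : e ∈ A) :
    esum U W (A.erase e) x = if Inc U W e x then esum U W A x - e else esum U W A x := by
  rw [esum, star_erase]
  split_ifs with h
  · rw [esum, ← Finset.add_sum_erase _ _ (mem_star.2 ⟨he, h⟩)]; omega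
  · rw [Finset.erase_eq_of_notMem fun hm => h (mem_star.1 hm).2]; rfl

theorem deg_insert (he : e ∉ A) :
    deg U W (insert e A) x = if Inc U W e x then deg U W A x + 1 else deg U W A x := by
  rw [deg, star, Finset.filter_insert]
  split_ifs with h
  · rw [Finset.card_insert_of_notMem fun hm => he (Finset.mem_filter.1 hm).1]; rfl
  · rfl

theorem esum_insert (he : e ∉ A) :
    esum U W (insert e A) x = if Inc U W e x then esum U W A x + e else esum U W A x := by
  rw [esum, star, Finset.filter_insert]
  split_ifs with h
  · rw [Finset.sum_insert fun hm => he (Finset.mem_filter.1 hm).1, add_comm]; rfl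
  · rfl

theorem deg_le_card : deg U W A x ≤ A.card := Finset.card_filter_le _ _

theorem deg_pos_of_inc (he : e ∈ A) (h : Inc U W e x) : 0 < deg U W A x :=
  Finset.card_pos.2 ⟨e, mem_star.2 ⟨he, h⟩⟩

/-- Removing a leaf edge can be undone in drawings. -/
theorem extendable_erase_leaf (hA : SimpleOn U W A) (h : deg U W A x = 1) :
    Extendable (edgesOf U W (A.erase (esum U W A x))) (edgesOf U W A) := by
  set e := esum U W A x with he
  have hstar := star_eq_of_deg_one h
  have hmem : e ∈ star U W A x := by rw [hstar, ← he]; simp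
  obtain ⟨heA, hex⟩ := mem_star.1 hmem
  have hj := hex.joins
  set y := U e + W e - x
  have hxy : y ≠ x := by
    intro hc
    have := hA.loopless e heA
    rcases hj with ⟨h1, h2⟩ | ⟨h1, h2⟩ <;> omega
  have heq : edgesOf U W A = insert s(y, x) (edgesOf U W (A.erase e)) := by
    rw [← hj.symm.sedge_eq, edgesOf, edgesOf, ← image_insert_eq, ← Finset.coe_insert,
      Finset.insert_erase heA]
  rw [heq]
  refine extendable_leaf ((A.erase e).finite_toSet.image _) hxy ?_
  rintro ⟨_, ⟨f, hf, rfl⟩, hfx⟩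
  rw [Finset.mem_coe, Finset.mem_erase] at hf
  have : f ∈ star U W A x := mem_star.2 ⟨hf.2, mem_sedge.1 hfx⟩
  rw [hstar, Finset.mem_singleton] at this
  exact hf.1 this

/-! ### Trails -/

/-- A nonempty walk from `x` along the edges `es` with the inner vertices `ws` to `y`. -/
inductive Tr (U W : ℕ → ℕ) : ℕ → List ℕ → List ℕ → ℕ → Prop
  | single {e x y : ℕ} (h : Joins U W e x y) : Tr U W x [e] [] y
  | cons {e x w y : ℕ} {es ws : List ℕ} (h : Joins U W e x w) (t : Tr U W w es ws y) :
      Tr U W x (e :: es) (w :: ws) y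

theorem Tr.snoc {es ws : List ℕ} (t : Tr U W x es ws y) (h : Joins U W e y z) :
    Tr U W x (es ++ [e]) (ws ++ [y]) z := by
  induction t with
  | single h' => exact .cons h' (.single h)
  | cons h' _ ih => exact .cons h' (ih h)

theorem Tr.reverse {es ws : List ℕ} (t : Tr U W x es ws y) :
    Tr U W y es.reverse ws.reverse x := by
  induction t with
  | single h => exact .single h.symm
  | cons h _ ih =>
    rw [List.reverse_cons, List.reverse_cons]
    exact ih.snoc h.symm

theorem Tr.length_eq {es ws : List ℕ} (t : Tr U W x es ws y) : es.length = ws.length + 1 := by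
  induction t with
  | single => rfl
  | cons _ _ ih => simp [ih]

theorem Tr.chainEdges_eq {es ws : List ℕ} (t : Tr U W x es ws y) :
    chainEdges x ws y = {f | ∃ e ∈ es, sedge U W e = f} := by
  induction t with
  | single h => ext f; simp [chainEdges, h.sedge_eq, eq_comm]
  | cons h _ ih =>
    ext f
    rw [chainEdges, ih]
    simp [h.sedge_eq, eq_comm]

/-- The number of edges of a trail at a vertex. -/
theorem Tr.countP_eq {es ws : List ℕ} (t : Tr U W x es ws y) (hl : ∀ e ∈ es, U e ≠ W e) (v : ℕ) :
    es.countP (fun e => Inc U W e v) =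
      (if x = v then 1 else 0) + 2 * ws.count v + (if y = v then 1 else 0) := by
  -- A loopless edge counts once at each of its two distinct ends. Along the trail, each visit of an
  -- inner vertex is therefore counted twice.
  have hone : ∀ {e x y : ℕ}, U e ≠ W e → Joins U W e x y →
      (if Inc U W e v then 1 else 0) = (if x = v then 1 else 0) + (if y = v then 1 else 0) := by
    intro e x y hne h
    have : Inc U W e v ↔ x = v ∨ y = v := by
      rcases h with ⟨rfl, rfl⟩ | ⟨rfl, rfl⟩ <;> simp [Inc, or_comm]
    have hxy : x ≠ y := by
      rcases h with ⟨rfl, rfl⟩ | ⟨rfl, rfl⟩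
      exacts [hne, hne.symm]
    by_cases h1 : x = v <;> by_cases h2 : y = v
    · exact absurd (h1.trans h2.symm) hxy
    all_goals simp [this, h1, h2]
  induction t with
  | single h =>
    have := hone (hl _ (by simp)) h
    simp only [List.countP_cons, List.countP_nil, List.count_nil, decide_eq_true_eq]
    omega
  | cons h _ ih =>
    have h1 := hone (hl _ (by simp)) h
    have h2 := ih fun e he => hl e (by simp [he])
    simp only [List.countP_cons, List.count_cons, decide_eq_true_eq, beq_iff_eq] at h2 ⊢
    omega

/-- The edges of a trail at `v` form a subset of the star of `v`; in the case of equality they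
exhaust it. -/
theorem countP_le_deg {es : List ℕ} (hn : es.Nodup) (hs : ∀ e ∈ es, e ∈ A) (v : ℕ) :
    es.countP (fun e => Inc U W e v) ≤ deg U W A v ∧
      (es.countP (fun e => Inc U W e v) = deg U W A v → ∀ e ∈ A, Inc U W e v → e ∈ es) := by
  have hsub : star U W es.toFinset v ⊆ star U W A v := fun e he => by
    rw [mem_star] at he ⊢
    exact ⟨hs e (List.mem_toFinset.1 he.1), he.2⟩
  have hcard : es.countP (fun e => Inc U W e v) = (star U W es.toFinset v).card := by
    rw [List.countP_eq_length_filter, ← List.toFinset_card_of_nodup (hn.filter _)]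
    congr 1
    ext e
    simp [mem_star]
  rw [hcard]
  refine ⟨Finset.card_le_card hsub, fun h e he hi => ?_⟩
  have := Finset.eq_of_subset_of_card_le hsub h.ge
  have h1 : e ∈ star U W A v := mem_star.2 ⟨he, hi⟩
  rw [← this] at h1
  exact List.mem_toFinset.1 (mem_star.1 h1).1

/-- A trail in `A` whose inner vertices have degree two. -/
structure IsChain (U W : ℕ → ℕ) (A : Finset ℕ) (x : ℕ) (es ws : List ℕ) (y : ℕ) : Prop where
  tr : Tr U W x es ws y
  nodup : es.Nodup
  sub : ∀ e ∈ es, e ∈ A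
  deg_eq : ∀ w ∈ ws, deg U W A w = 2

theorem IsChain.reverse {es ws : List ℕ} (h : IsChain U W A x es ws y) :
    IsChain U W A y es.reverse ws.reverse x :=
  ⟨h.tr.reverse, List.nodup_reverse.2 h.nodup, fun e he => h.sub e (List.mem_reverse.1 he),
    fun w hw => h.deg_eq w (List.mem_reverse.1 hw)⟩

/-- The end vertices of a chain are not inner vertices, the inner vertices are distinct, and
all their edges belong to the chain. -/
theorem IsChain.inner {es ws : List ℕ} (hA : SimpleOn U W A) (h : IsChain U W A x es ws y) :
    ws.Nodup ∧ (∀ w ∈ ws, x ≠ w ∧ y ≠ w) ∧ ∀ w ∈ ws, ∀ e ∈ A, Inc U W e w → e ∈ es := by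
  have key : ∀ w ∈ ws, ws.count w = 1 ∧ x ≠ w ∧ y ≠ w ∧ ∀ e ∈ A, Inc U W e w → e ∈ es := by
    intro w hw
    have h1 := h.tr.countP_eq (fun e he => hA.loopless e (h.sub e he)) w
    obtain ⟨h2, h3⟩ := countP_le_deg (U := U) (W := W) h.nodup h.sub w
    rw [h.deg_eq w hw] at h2 h3
    -- One occurrence as inner vertex already uses two edges. As the degree is two, there is no
    -- other occurrence, no end of the chain equals `w`, and no edge at `w` is left over.
    have h4 := List.count_pos_iff.2 hw
    split_ifs at h1 with hx hy hy
    · omega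
    · omega
    · omega
    · exact ⟨by omega, hx, hy, h3 (by omega)⟩
  refine ⟨List.nodup_iff_count_le_one.2 fun w => ?_, fun w hw => ⟨(key w hw).2.1, (key w hw).2.2.1⟩,
    fun w hw => (key w hw).2.2.2⟩
  by_cases hw : w ∈ ws
  · exact (key w hw).1.le
  · rw [List.count_eq_zero_of_not_mem hw]; omega

theorem Tr.exists_inc_left {es ws : List ℕ} (t : Tr U W x es ws y) : ∃ e ∈ es, Inc U W e x := by
  cases t with
  | single h => exact ⟨_, by simp, h.inc_left⟩
  | cons h _ => exact ⟨_, by simp, h.inc_left⟩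

theorem Tr.exists_inc_right {es ws : List ℕ} (t : Tr U W x es ws y) : ∃ e ∈ es, Inc U W e y := by
  obtain ⟨e, he, hi⟩ := t.reverse.exists_inc_left
  exact ⟨e, List.mem_reverse.1 he, hi⟩

end Indexed

end BRAC

namespace BRAC

open Set Function

section Decomposition

variable {U W : ℕ → ℕ} {A B : Finset ℕ} {e x y z : ℕ}

/-! ### Chain decompositions -/

/-- The classes of edges with the same label, `Q` being the set of labels, are the maximal chains;
`len` records their lengths. -/
structure Decomp (U W : ℕ → ℕ) (A Q : Finset ℕ) (lab len : ℕ → ℕ) : Prop where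
  chain : ∀ q ∈ Q, ∃ x es ws y, IsChain U W A x es ws y ∧
    ((deg U W A x ≠ 2 ∧ deg U W A y ≠ 2) ∨ x = y) ∧ (∀ e, e ∈ es ↔ e ∈ A ∧ lab e = q) ∧
    len q = es.length
  lab_mem : ∀ e ∈ A, lab e ∈ Q

theorem chainEdges_append (x : ℕ) (ws : List ℕ) (g y : ℕ) :
    chainEdges x (ws ++ [g]) y = insert s(g, y) (chainEdges x ws g) := by
  induction ws generalizing x with
  | nil => ext; simp [chainEdges]; tauto
  | cons w ws ih =>
    rw [List.cons_append, chainEdges, chainEdges, ih, insert_comm]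

theorem Ear.edges_eq (t : Ear ℕ) :
    t.edges = chainEdges t.src (t.fst :: (t.mid ++ [t.lst])) t.tgt := by
  rw [chainEdges, chainEdges_append, Ear.edges, Ear.leaves, Sym2.eq_swap (a := t.tgt)]
  ext; simp; tauto

/-- Three edges guarantee two inner vertices, which become `fst` and `lst`; `mid` may be empty. -/
theorem exists_ear {x : ℕ} {es ws : List ℕ} {y : ℕ} (h : IsChain U W A x es ws y)
    (hl : 3 ≤ es.length) : ∃ t : Ear ℕ, t.src = x ∧ t.tgt = y ∧ ws = t.fst :: (t.mid ++ [t.lst]) := by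
  have hlen := h.tr.length_eq
  match ws with
  | [] => simp at hlen; omega
  | f :: ws =>
    rcases List.eq_nil_or_concat ws with rfl | ⟨mid, g, rfl⟩
    · simp at hlen; omega
    · exact ⟨⟨x, f, mid, g, y⟩, rfl, rfl, by simp⟩

/-- Long chains can be added to drawings. -/
theorem Decomp.extendable {Q : Finset ℕ} {lab len : ℕ → ℕ} (hA : SimpleOn U W A)
    (h : Decomp U W A Q lab len) {t : ℕ}
    (hlong : ∀ q ∈ Q, t ≤ len q →
      16 * (A.filter fun e => len (lab e) < t).card + 12 * Q.card < len q) (hQ : 0 < Q.card) :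
    Extendable (edgesOf U W (A.filter fun e => len (lab e) < t)) (edgesOf U W A) := by
  classical
  set K := A.filter fun e => len (lab e) < t with hK
  set Q' := Q.filter fun q => t ≤ len q with hQ'
  have hex : ∀ q, ∃ r : Ear ℕ, q ∈ Q' → ∃ es, IsChain U W A r.src es (r.fst :: (r.mid ++ [r.lst])) r.tgt ∧
      (∀ e, e ∈ es ↔ e ∈ A ∧ lab e = q) ∧ len q = es.length := by
    intro q
    by_cases hq : q ∈ Q'
    · rw [hQ', Finset.mem_filter] at hq
      obtain ⟨x, es, ws, y, h1, -, h3, h4⟩ := h.chain q hq.1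
      have := hlong q hq.1 hq.2
      -- There is at least one chain, so a long chain has more than twelve edges.
      obtain ⟨r, rfl, rfl, rfl⟩ := exists_ear h1 (by omega)
      exact ⟨r, fun _ => ⟨es, h1, h3, h4⟩⟩
    · exact ⟨⟨0, 0, [], 0, 0⟩, fun h => absurd h hq⟩
  choose r hr using hex
  have hperm : ∀ q, (r q).inner.Perm ((r q).fst :: ((r q).mid ++ [(r q).lst])) := fun q => by
    rw [Ear.inner]
    exact (List.perm_append_singleton _ _).symm.cons _
  -- edges at inner vertices of an ear belong to it
  have hinner : ∀ q ∈ Q', ∀ w ∈ (r q).inner, ∀ e ∈ A, Inc U W e w → lab e = q := by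
    intro q hq w hw e he hi
    obtain ⟨es, h1, h2, -⟩ := hr q hq
    exact ((h2 e).1 ((h1.inner hA).2.2 w ((hperm q).mem_iff.1 hw) e he hi)).2
  have hinc : ∀ q ∈ Q', ∀ w ∈ (r q).inner, ∃ e ∈ A, Inc U W e w := by
    intro q hq w hw
    obtain ⟨es, h1, -, -⟩ := hr q hq
    have h2 := h1.deg_eq w ((hperm q).mem_iff.1 hw)
    obtain ⟨e, he⟩ := Finset.card_pos.1 (show 0 < (star U W A w).card by
      change 0 < deg U W A w; omega)
    exact ⟨e, mem_star.1 he⟩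
  have hmap : ∀ u ∈ Q'.toList.map r, ∃ q ∈ Q', r q = u := fun u hu => by
    obtain ⟨q, hq, rfl⟩ := List.mem_map.1 hu
    exact ⟨q, Finset.mem_toList.1 hq, rfl⟩
  let F : Finset (Sym2 ℕ) := K.image (sedge U W)
  have hF : (F : Set (Sym2 ℕ)) = edgesOf U W K := Finset.coe_image
  have key := extendable_ears (F := F) (Q'.toList.map r) ?_ ?_ ?_ ?_
  · rw [hF] at key
    convert key using 1
    ext f
    constructor
    · rintro ⟨e, he, rfl⟩
      by_cases ht : len (lab e) < t
      · exact .inl ⟨e, Finset.mem_filter.2 ⟨he, ht⟩, rfl⟩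
      · right
        have hq : lab e ∈ Q' := Finset.mem_filter.2 ⟨h.lab_mem e he, not_lt.1 ht⟩
        refine ⟨r (lab e), List.mem_map_of_mem (Finset.mem_toList.2 hq), ?_⟩
        obtain ⟨es, h1, h2, -⟩ := hr _ hq
        rw [Ear.edges_eq, h1.tr.chainEdges_eq]
        exact ⟨e, (h2 e).2 ⟨he, rfl⟩, rfl⟩
    · rintro (⟨e, he, rfl⟩ | ⟨u, hu, hf⟩)
      · exact ⟨e, (Finset.mem_filter.1 he).1, rfl⟩
      · obtain ⟨q, hq, rfl⟩ := hmap u hu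
        obtain ⟨es, h1, h2, -⟩ := hr q hq
        rw [Ear.edges_eq, h1.tr.chainEdges_eq] at hf
        obtain ⟨e, he, rfl⟩ := hf
        exact ⟨e, ((h2 e).1 he).1, rfl⟩
  · intro u hu u' hu' w hw
    obtain ⟨q, hq, rfl⟩ := hmap u hu
    obtain ⟨q', hq', rfl⟩ := hmap u' hu'
    obtain ⟨es, h1, h2, -⟩ := hr q hq
    by_cases hqq : q = q'
    · subst hqq
      exact (h1.inner hA).2.1 w ((hperm q).mem_iff.1 hw)
    · constructor
      · rintro rfl
        obtain ⟨e, he, hi⟩ := h1.tr.exists_inc_left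
        have h3 := (h2 e).1 he
        exact hqq (h3.2.symm.trans (hinner q' hq' _ hw e h3.1 hi))
      · rintro rfl
        obtain ⟨e, he, hi⟩ := h1.tr.exists_inc_right
        have h3 := (h2 e).1 he
        exact hqq (h3.2.symm.trans (hinner q' hq' _ hw e h3.1 hi))
  · rw [List.flatMap_map, List.nodup_flatMap]
    constructor
    · intro q hq
      obtain ⟨es, h1, -, -⟩ := hr q (Finset.mem_toList.1 hq)
      exact (hperm q).nodup_iff.2 (h1.inner hA).1
    · refine (Finset.nodup_toList Q').imp_of_mem fun {q q'} hq hq' hne => ?_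
      rw [Finset.mem_toList] at hq hq'
      intro w hw hw'
      obtain ⟨e, he, hi⟩ := hinc q hq w hw
      exact hne ((hinner q hq w hw e he hi).symm.trans (hinner q' hq' w hw' e he hi))
  · intro u hu w hw
    obtain ⟨q, hq, rfl⟩ := hmap u hu
    rintro ⟨f, hf, hwf⟩
    rw [hF] at hf
    obtain ⟨e, he, rfl⟩ := hf
    rw [hK, Finset.mem_coe, Finset.mem_filter] at he
    have h3 := hinner q hq w hw e he.1 (mem_sedge.1 hwf)
    rw [h3] at he
    have := (Finset.mem_filter.1 hq).2
    omega
  · intro u hu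
    obtain ⟨q, hq, rfl⟩ := hmap u hu
    obtain ⟨es, h1, -, h3⟩ := hr q hq
    have h4 := h1.tr.length_eq
    have h5 := hlong q (Finset.mem_filter.1 hq).1 (Finset.mem_filter.1 hq).2
    have h6 : F.card ≤ K.card := Finset.card_image_le
    have h7 : Q'.card ≤ Q.card := Finset.card_filter_le _ _
    simp only [List.length_cons, List.length_append, List.length_nil, List.length_map,
      Finset.length_toList] at h4 ⊢
    omega

theorem Decomp.fiber_card {Q : Finset ℕ} {lab len : ℕ → ℕ} (h : Decomp U W A Q lab len) {q : ℕ}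
    (hq : q ∈ Q) : (A.filter fun e => lab e = q).card = len q := by
  obtain ⟨x, es, ws, y, h1, -, h3, h4⟩ := h.chain q hq
  rw [h4, ← List.toFinset_card_of_nodup h1.nodup]
  congr 1
  ext e
  rw [Finset.mem_filter, List.mem_toFinset, h3]

/-- The chains partition the edges, so the number of edges on short chains is the total length of
these chains. It turns the size of the kernel into the sum that the algorithm maintains. -/
theorem Decomp.card_lt {Q : Finset ℕ} {lab len : ℕ → ℕ} (h : Decomp U W A Q lab len) (t : ℕ) :
    (A.filter fun e => len (lab e) < t).card = ∑ q ∈ Q.filter fun q => len q < t, len q := by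
  rw [Finset.card_eq_sum_card_fiberwise (f := lab) (t := Q.filter fun q => len q < t)]
  · refine Finset.sum_congr rfl fun q hq => ?_
    rw [Finset.mem_filter] at hq
    rw [← h.fiber_card hq.1, Finset.filter_filter]
    congr 1
    ext e
    simp only [Finset.mem_filter]
    constructor
    · rintro ⟨h1, -, h2⟩; exact ⟨h1, h2⟩
    · rintro ⟨h1, rfl⟩; exact ⟨h1, hq.2, rfl⟩
  · intro e he
    simp only [Finset.coe_filter, mem_ofPred_eq] at he ⊢
    exact ⟨h.lab_mem e he.1, he.2⟩

/-- The growth of the total length of the short chains. -/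
theorem sum_short_le (Q : Finset ℕ) (len : ℕ → ℕ) (t : ℕ)
    (ht : ∀ s < t, 1 ≤ s → s ≤ 16 * (∑ q ∈ Q.filter fun q => len q < s, len q) + 12 * Q.card) :
    4 * (∑ q ∈ Q.filter fun q => len q < t, len q) + 3 * Q.card ≤
      3 * Q.card * 17 ^ (Q.filter fun q => len q < t).card := by
  induction t with
  | zero => simp
  | succ t ih =>
    have ih := ih fun s hs => ht s (by omega)
    have hsplit : (Q.filter fun q => len q < t + 1) =
        (Q.filter fun q => len q < t) ∪ Q.filter fun q => len q = t := by
      ext q; simp only [Finset.mem_filter, Finset.mem_union]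
      constructor
      · rintro ⟨h1, h2⟩
        rcases Nat.lt_succ_iff_lt_or_eq.1 h2 with h | h
        exacts [.inl ⟨h1, h⟩, .inr ⟨h1, h⟩]
      · rintro (⟨h1, h2⟩ | ⟨h1, h2⟩) <;> exact ⟨h1, by omega⟩
    have hdisj : Disjoint (Q.filter fun q => len q < t) (Q.filter fun q => len q = t) :=
      Finset.disjoint_filter.2 fun q _ h1 h2 => by omega
    have hconst : ∑ q ∈ Q.filter (fun q => len q = t), len q =
        (Q.filter fun q => len q = t).card * t := by
      rw [Finset.sum_congr rfl (g := fun _ => t) fun q hq => (Finset.mem_filter.1 hq).2]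
      simp
    rw [hsplit, Finset.sum_union hdisj, Finset.card_union_of_disjoint hdisj, hconst, pow_add]
    set M := ∑ q ∈ Q.filter fun q => len q < t, len q
    set c := (Q.filter fun q => len q = t).card
    have h1 : t ≤ 16 * M + 12 * Q.card := by
      rcases Nat.eq_zero_or_pos t with h | h
      · omega
      · exact ht t (by omega) h
    have h2 : 1 + 16 * c ≤ 17 ^ c := by
      have := one_add_mul_le_pow (a := (16 : ℤ)) (by norm_num) c
      have h3 : (1 : ℤ) + c * 16 ≤ 17 ^ c := by simpa using this
      zify; linarith
    -- From `t ≤ 16M + 12q` follows `4t ≤ 16(4M + 3q)`; so `c` chains of length `t` multiply `4M +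
    -- 3q` by at most `1 + 16c`, which is at most `17 ^ c` by Bernoulli.
    calc 4 * (M + c * t) + 3 * Q.card ≤ (4 * M + 3 * Q.card) * (1 + 16 * c) := by nlinarith
      _ ≤ (3 * Q.card * 17 ^ (Q.filter fun q => len q < t).card) * 17 ^ c := Nat.mul_le_mul ih h2
      _ = _ := by ring

/-! ### Forests -/

/-- The vertices of the edges in `A`. -/
def verticesOf (U W : ℕ → ℕ) (A : Finset ℕ) : Finset ℕ := A.image U ∪ A.image W

theorem mem_verticesOf : x ∈ verticesOf U W A ↔ ∃ e ∈ A, Inc U W e x := by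
  simp only [verticesOf, Finset.mem_union, Finset.mem_image, Inc]
  constructor
  · rintro (⟨e, he, h⟩ | ⟨e, he, h⟩)
    exacts [⟨e, he, .inl h⟩, ⟨e, he, .inr h⟩]
  · rintro ⟨e, he, h | h⟩
    exacts [.inl ⟨e, he, h⟩, .inr ⟨e, he, h⟩]

/-- The handshake lemma. -/
theorem sum_deg (hA : ∀ e ∈ A, U e ≠ W e) : ∑ v ∈ verticesOf U W A, deg U W A v = 2 * A.card := by
  simp only [deg, star]
  have := Finset.sum_card_bipartiteAbove_eq_sum_card_bipartiteBelow (s := verticesOf U W A) (t := A)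
    fun v e => Inc U W e v
  simp only [Finset.bipartiteAbove, Finset.bipartiteBelow] at this
  rw [this, Finset.sum_const_nat (m := 2), mul_comm]
  intro e he
  have : (verticesOf U W A).filter (fun v => Inc U W e v) = {U e, W e} := by
    ext v
    rw [Finset.mem_filter, Finset.mem_insert, Finset.mem_singleton, mem_verticesOf]
    constructor
    · rintro ⟨-, h | h⟩
      exacts [.inl h.symm, .inr h.symm]
    · rintro (rfl | rfl)
      exacts [⟨⟨e, he, .inl rfl⟩, .inl rfl⟩, ⟨⟨e, he, .inr rfl⟩, .inr rfl⟩]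
  rw [this, Finset.card_pair (hA e he)]

/-- Every nonempty set of edges in `A` has less edges than vertices. -/
def Forest (U W : ℕ → ℕ) (A : Finset ℕ) : Prop :=
  ∀ B ⊆ A, B.Nonempty → B.card < (verticesOf U W B).card

/-- In a forest, there is no closed trail. -/
theorem Forest.ne_of_trail (hA : SimpleOn U W A) (h : Forest U W A) {es ws : List ℕ}
    (t : Tr U W x es ws y) (hn : es.Nodup) (hs : ∀ e ∈ es, e ∈ A) : x ≠ y := by
  rintro rfl
  have hsub : es.toFinset ⊆ A := fun e he => hs e (List.mem_toFinset.1 he)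
  have hne : es.toFinset.Nonempty := by
    obtain ⟨e, he, -⟩ := t.exists_inc_left
    exact ⟨e, List.mem_toFinset.2 he⟩
  have h1 := h _ hsub hne
  have h2 := sum_deg (hA.mono hsub).loopless
  -- In a closed trail the number of edges at a vertex is even, hence at least two if positive. By
  -- the handshake lemma there are then at least as many edges as vertices.
  have h3 : ∀ v ∈ verticesOf U W es.toFinset, 2 ≤ deg U W es.toFinset v := by
    intro v hv
    obtain ⟨e, he, hi⟩ := mem_verticesOf.1 hv
    have h4 := t.countP_eq (fun e he => hA.loopless e (hs e he)) v
    have h5 := (countP_le_deg (U := U) (W := W) hn (fun e he => List.mem_toFinset.2 he) v).1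
    have h6 : 0 < es.countP fun e => Inc U W e v :=
      List.countP_pos_iff.2 ⟨e, List.mem_toFinset.1 he, by simpa using hi⟩
    split_ifs at h4 <;> omega
  have h4 : (verticesOf U W es.toFinset).card • 2 ≤
      ∑ v ∈ verticesOf U W es.toFinset, deg U W es.toFinset v :=
    Finset.card_nsmul_le_sum _ _ _ h3
  rw [smul_eq_mul, h2] at h4
  omega

/-- The number of maximal chains is at most four times the size of a feedback edge set. -/
theorem Decomp.card_le {Q F : Finset ℕ} {lab len : ℕ → ℕ} (hA : SimpleOn U W A)
    (h : Decomp U W A Q lab len) (hdeg : ∀ v, deg U W A v ≠ 1) (hF : F ⊆ A)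
    (hfor : Forest U W (A \ F)) : Q.card ≤ 4 * F.card := by
  classical
  set Qc := Q.filter fun q => ∃ e ∈ F, lab e = q with hQc
  set Qp := Q.filter fun q => ¬ ∃ e ∈ F, lab e = q with hQp
  have hQ : Qc.card + Qp.card = Q.card := Finset.card_filter_add_card_filter_not _
  have h1 : Qc.card ≤ F.card := by
    refine (Finset.card_le_card (t := F.image lab) fun q hq => ?_).trans Finset.card_image_le
    obtain ⟨e, he, h⟩ := (Finset.mem_filter.1 hq).2
    exact Finset.mem_image.2 ⟨e, he, h⟩
  set X := verticesOf U W A with hX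
  set X3 := X.filter fun v => 3 ≤ deg U W A v with hX3
  -- the branch vertices have few incident edges
  have hsum : ∑ v ∈ X3, deg U W A v ≤ 6 * F.card := by
    have g1 : ∑ v ∈ X, deg U W A v = 2 * A.card := sum_deg hA.loopless
    -- Consequently the sum of `deg - 2` over all vertices, which is `2|A| - 2|X|`, is at most
    -- `2|F|`. All summands are nonnegative, and `deg ≤ 3 (deg - 2)` for degrees of at least three,
    -- so the branch vertices have total degree at most `6|F|`.
    have g2 : A.card ≤ X.card + F.card := by
      have : (A \ F).card + F.card = A.card := Finset.card_sdiff_add_card_eq_card hF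
      rcases (A \ F).eq_empty_or_nonempty with h0 | h0
      · rw [h0, Finset.card_empty] at this; omega
      · have h2 := hfor _ (Finset.Subset.refl _) h0
        have h3 : (verticesOf U W (A \ F)).card ≤ X.card := Finset.card_le_card fun v hv => by
          obtain ⟨e, he, hi⟩ := mem_verticesOf.1 hv
          exact mem_verticesOf.2 ⟨e, (Finset.mem_sdiff.1 he).1, hi⟩
        omega
    have g3 : ∑ v ∈ X3, deg U W A v + ∑ v ∈ X.filter (fun v => ¬ 3 ≤ deg U W A v), deg U W A v =
        ∑ v ∈ X, deg U W A v := Finset.sum_filter_add_sum_filter_not _ _ _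
    have g4 : X3.card + (X.filter fun v => ¬ 3 ≤ deg U W A v).card = X.card :=
      Finset.card_filter_add_card_filter_not _
    have g5 : (X.filter fun v => ¬ 3 ≤ deg U W A v).card • 2 ≤
        ∑ v ∈ X.filter (fun v => ¬ 3 ≤ deg U W A v), deg U W A v := by
      refine Finset.card_nsmul_le_sum _ _ _ fun v hv => ?_
      obtain ⟨e, he, hi⟩ := mem_verticesOf.1 (Finset.mem_filter.1 hv).1
      have := deg_pos_of_inc he hi
      have := hdeg v
      omega
    have g6 : X3.card • 3 ≤ ∑ v ∈ X3, deg U W A v :=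
      Finset.card_nsmul_le_sum _ _ _ fun v hv => (Finset.mem_filter.1 hv).2
    rw [smul_eq_mul] at g5 g6
    omega
  -- A chain without an edge of `F` runs inside a forest, so its ends differ; their degrees are
  -- neither one nor two. It accounts for an incidence at each of two branch vertices, and two
  -- incidences per chain give at most `3|F|` such chains.
  have h2 : Qp.card • 2 ≤ ∑ q ∈ Qp, ∑ v ∈ X3, ((star U W A v).filter fun e => lab e = q).card := by
    refine Finset.card_nsmul_le_sum _ _ _ fun q hq => ?_
    rw [hQp, Finset.mem_filter] at hq
    obtain ⟨x, es, ws, y, c1, c2, c3, -⟩ := h.chain q hq.1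
    have hes : ∀ e ∈ es, e ∈ A \ F := fun e he => Finset.mem_sdiff.2
      ⟨c1.sub e he, fun hf => hq.2 ⟨e, hf, ((c3 e).1 he).2⟩⟩
    have hxy : x ≠ y := hfor.ne_of_trail (hA.mono Finset.sdiff_subset) c1.tr c1.nodup hes
    obtain ⟨d1, d2⟩ := c2.resolve_right hxy
    have hmem : ∀ v e, e ∈ es → Inc U W e v → deg U W A v ≠ 2 →
        v ∈ X3 ∧ 1 ≤ ((star U W A v).filter fun e => lab e = q).card := by
      intro v e he hi hd
      have heA := c1.sub e he
      refine ⟨Finset.mem_filter.2 ⟨mem_verticesOf.2 ⟨e, heA, hi⟩, ?_⟩, Finset.card_pos.2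
        ⟨e, Finset.mem_filter.2 ⟨mem_star.2 ⟨heA, hi⟩, ((c3 e).1 he).2⟩⟩⟩
      have := deg_pos_of_inc heA hi
      have := hdeg v
      omega
    obtain ⟨e, he, hi⟩ := c1.tr.exists_inc_left
    obtain ⟨e', he', hi'⟩ := c1.tr.exists_inc_right
    obtain ⟨m1, m2⟩ := hmem x e he hi d1
    obtain ⟨m3, m4⟩ := hmem y e' he' hi' d2
    have hpair : ({x, y} : Finset ℕ) ⊆ X3 := by
      intro v hv
      rw [Finset.mem_insert, Finset.mem_singleton] at hv
      rcases hv with rfl | rfl <;> assumption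
    refine le_trans ?_ (Finset.sum_le_sum_of_subset hpair)
    rw [Finset.sum_pair hxy]; omega
  have h3 : ∑ q ∈ Qp, ∑ v ∈ X3, ((star U W A v).filter fun e => lab e = q).card ≤
      ∑ v ∈ X3, deg U W A v := by
    rw [Finset.sum_comm]
    refine Finset.sum_le_sum fun v _ => ?_
    rw [Finset.sum_card_fiberwise_eq_card_filter]
    exact Finset.card_filter_le _ _
  rw [smul_eq_mul] at h2
  omega

/-- The size bound of the kernel. -/
theorem kernel_size {k q M N : ℕ} (hq : q ≤ 4 * k) (hM : 4 * M + 3 * q ≤ 3 * q * 17 ^ q)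
    (hN : N ≤ 3 * M) : N ≤ (36 * k) ^ (4 * k) := by
  rcases Nat.eq_zero_or_pos k with rfl | hk
  · have : q = 0 := by omega
    subst this
    simp at hM ⊢
    omega
  · have h1 : 17 ^ q ≤ 17 ^ (4 * k) := Nat.pow_le_pow_right (by norm_num) hq
    have h2 : 3 * q * 17 ^ q ≤ 3 * (4 * k) * 17 ^ (4 * k) :=
      Nat.mul_le_mul (Nat.mul_le_mul_left _ hq) h1
    -- Here `4M ≤ 12k · 17 ^ (4k)`, and `N ≤ 3M` counts at most two vertices for each of the `M`
    -- edges.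
    have h3 : N ≤ 9 * k * 17 ^ (4 * k) := by nlinarith
    have h4 : 9 * k ≤ 20 ^ k := by
      clear * - hk
      induction k, hk using Nat.le_induction with
      | base => norm_num
      | succ n hn ih => rw [pow_succ]; omega
    calc N ≤ 9 * k * 17 ^ (4 * k) := h3
      _ ≤ 20 ^ k * 17 ^ (4 * k) := Nat.mul_le_mul_right _ h4
      _ = (20 * 17 ^ 4) ^ k := by rw [mul_pow, pow_mul]
      -- The base `36` is just large enough: `20 · 17 ^ 4 = 1670420` and `36 ^ 4 = 1679616`.
      _ ≤ (36 ^ 4) ^ k := Nat.pow_le_pow_left (by norm_num) _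
      _ = 36 ^ (4 * k) := by rw [pow_mul]
      _ ≤ _ := Nat.pow_le_pow_left (by omega) _

end Decomposition

end BRAC

namespace BRAC

open Set Function

/-! ### Feedback edge sets -/

section Feedback

variable {V V' : Type*} {G : SimpleGraph V} {H : SimpleGraph V'}

theorem exists_fen [Finite V] (G : SimpleGraph V) : ∃ F : Finset (Sym2 V),
    (F : Set (Sym2 V)) ⊆ G.edgeSet ∧ (G.deleteEdges (F : Set (Sym2 V))).IsAcyclic ∧
      F.card = fen G := by
  have hne : {k | ∃ F : Finset (Sym2 V), (F : Set (Sym2 V)) ⊆ G.edgeSet ∧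
      (G.deleteEdges (F : Set (Sym2 V))).IsAcyclic ∧ F.card = k}.Nonempty := by
    refine ⟨_, (toFinite G.edgeSet).toFinset, by simp, ?_, rfl⟩
    have : G.deleteEdges ((toFinite G.edgeSet).toFinset : Set (Sym2 V)) = ⊥ := by
      ext v w; simp
    rw [this]
    exact SimpleGraph.isAcyclic_bot
  exact Nat.sInf_mem hne

theorem fen_le_of_injective [Finite V] (φ : H →g G) (hφ : Injective φ) : fen H ≤ fen G := by
  classical
  obtain ⟨F, hF, hac, hcard⟩ := exists_fen G
  have hinj : Injective (Sym2.map φ) := Sym2.map.injective hφ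
  set F' : Finset (Sym2 V') := (F.preimage (Sym2.map φ) hinj.injOn).filter (· ∈ H.edgeSet) with hF'
  have hle : F'.card ≤ F.card :=
    Finset.card_le_card_of_injOn (Sym2.map φ) (fun e he => by
      have := (Finset.mem_filter.1 he).1
      exact Finset.mem_preimage.1 this) hinj.injOn
  suffices h : (H.deleteEdges (F' : Set (Sym2 V'))).IsAcyclic from
    le_trans (Nat.sInf_le ⟨F', fun e he => (Finset.mem_filter.1 he).2, h, rfl⟩)
      (hle.trans_eq hcard)
  let f : H.deleteEdges (F' : Set (Sym2 V')) →g G.deleteEdges (F : Set (Sym2 V)) :=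
    { toFun := φ
      map_rel' := fun {v w} h => by
        rw [SimpleGraph.deleteEdges_adj] at h ⊢
        refine ⟨φ.map_adj h.1, fun hm => h.2 ?_⟩
        rw [Finset.mem_coe, hF', Finset.mem_filter, Finset.mem_preimage]
        exact ⟨hm, h.1⟩ }
  exact hac.comap f hφ

/-- An acyclic graph extends to a spanning tree of the complete graph, which has one edge less than
vertices. -/
theorem ncard_edgeSet_lt [Finite V] [Nonempty V] (h : G.IsAcyclic) : G.edgeSet.ncard < Nat.card V := by
  obtain ⟨T, hGT, -, hT⟩ :=
    SimpleGraph.connected_top.exists_isTree_le_of_le_of_isAcyclic (le_top (a := G)) h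
  have h1 := (SimpleGraph.isTree_iff_connected_and_card.1 hT).2
  have h2 : G.edgeSet.ncard ≤ T.edgeSet.ncard :=
    ncard_le_ncard (SimpleGraph.edgeSet_mono hGT) (toFinite _)
  rw [Nat.card_coe_set_eq] at h1
  omega

/-- A minimum feedback edge set, for indexed edges. -/
theorem exists_forest [Finite V] {ι : V → ℕ} (hι : Injective ι) {U W : ℕ → ℕ} {A : Finset ℕ}
    (hA : SimpleOn U W A) (hAG : edgesOf U W A ⊆ edgeImage G ι) :
    ∃ F ⊆ A, F.card ≤ fen G ∧ Forest U W (A \ F) := by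
  classical
  obtain ⟨F, hF, hac, hcard⟩ := exists_fen G
  have hinj : Injective (Sym2.map ι) := Sym2.map.injective hι
  refine ⟨A.filter fun e => sedge U W e ∈ F.image (Sym2.map ι), Finset.filter_subset _ _, ?_, ?_⟩
  · rw [← hcard, ← Finset.card_image_of_injective F hinj]
    exact Finset.card_le_card_of_injOn (sedge U W) (fun e he => (Finset.mem_filter.1 he).2)
      (hA.inj.mono fun e he => (Finset.mem_filter.1 he).1)
  intro B hB hne
  have hBA : B ⊆ A := fun e he => (Finset.mem_sdiff.1 (hB he)).1
  have hBs := hA.mono hBA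
  let X := {v : V // ι v ∈ verticesOf U W B}
  -- The edges of `B`, taken as a graph on their own end vertices, embed into `G` minus the feedback
  -- edges; so `H` is acyclic and has fewer edges than vertices.
  let H : SimpleGraph X :=
    { Adj := fun v w => s(ι v.1, ι w.1) ∈ edgesOf U W B
      symm := ⟨fun v w h => by rwa [Sym2.eq_swap]⟩
      loopless := ⟨fun v => by
        rintro ⟨e, he, heq⟩
        refine hBs.loopless e he ?_
        rw [sedge, Sym2.eq_iff] at heq
        omega⟩ }
  have hvinj : Injective fun v : X => ι v.1 := hι.comp Subtype.val_injective
  have hlift : ∀ e ∈ B, ∃ v w : X, s(ι v.1, ι w.1) = sedge U W e ∧ G.Adj v.1 w.1 := by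
    intro e he
    obtain ⟨g, hg, hge⟩ := hAG ⟨e, hBA he, rfl⟩
    induction g with | _ v w =>
    have hmem : ∀ u ∈ s(v, w), ι u ∈ verticesOf U W B := fun u hu =>
      mem_verticesOf.2 ⟨e, he, mem_sedge.1 (by rw [← hge]; exact Sym2.mem_map.2 ⟨u, hu, rfl⟩)⟩
    exact ⟨⟨v, hmem v (by simp)⟩, ⟨w, hmem w (by simp)⟩, hge, hg⟩
  have himg : Sym2.map (fun v : X => ι v.1) '' H.edgeSet = edgesOf U W B := by
    ext f
    constructor
    · rintro ⟨g, hg, rfl⟩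
      induction g with | _ v w => exact hg
    · rintro ⟨e, he, rfl⟩
      obtain ⟨v, w, h, -⟩ := hlift e he
      exact ⟨s(v, w), show s(ι v.1, ι w.1) ∈ edgesOf U W B from ⟨e, he, h.symm⟩, h⟩
  have hHcard : H.edgeSet.ncard = B.card := by
    rw [← ncard_image_of_injective _ (Sym2.map.injective hvinj), himg, edgesOf,
      hBs.inj.ncard_image, ncard_coe_finset]
  have hXcard : Nat.card X ≤ (verticesOf U W B).card := by
    have := Nat.card_le_card_of_injective (fun v : X => (⟨ι v.1, v.2⟩ : verticesOf U W B))
      fun v w h => hvinj (Subtype.mk.inj h)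
    simpa using this
  have hXne : Nonempty X := by
    obtain ⟨e, he⟩ := hne
    obtain ⟨v, -⟩ := hlift e he
    exact ⟨v⟩
  have hHac : H.IsAcyclic := by
    refine hac.comap ⟨Subtype.val, fun {v w} h => ?_⟩ Subtype.val_injective
    obtain ⟨e, he, hs⟩ := h
    obtain ⟨v', w', h', hadj⟩ := hlift e he
    have heq : s(v'.1, w'.1) = s(v.1, w.1) := hinj (h'.trans hs)
    rw [SimpleGraph.deleteEdges_adj]
    refine ⟨?_, fun hm => ?_⟩
    · rw [← SimpleGraph.mem_edgeSet] at hadj ⊢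
      rwa [heq] at hadj
    · refine (Finset.mem_sdiff.1 (hB he)).2 (Finset.mem_filter.2 ⟨hBA he, ?_⟩)
      exact Finset.mem_image.2 ⟨_, hm, hs.symm⟩
  have := ncard_edgeSet_lt hHac
  omega

end Feedback

end BRAC

namespace BRAC

open Set Function

/-! ### Reasoning about programs -/

section WP

variable {w : ℕ} {s : State} {N : ℕ} {Q : ℕ → State → Prop}

/-- Started in the state `s`, the program `p` halts, takes at most `N` steps, and `Q` holds for the
number of unused steps and the final state. -/
def WP (w : ℕ) (p : Program) (Q : ℕ → State → Prop) (N : ℕ) (s : State) : Prop :=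
  ∃ T s', Exec w p s T s' ∧ T ≤ N ∧ Q (N - T) s'

theorem WP.skip (hN : 1 ≤ N) (h : Q (N - 1) s) : WP w .skip Q N s := ⟨_, _, .skip s, hN, h⟩

theorem WP.assign {x : ℕ} {e : Expr} (he : e.Fits w s) (hN : e.cost + 1 ≤ N)
    (h : Q (N - (e.cost + 1)) ⟨update s.reg x (e.eval s), s.mem⟩) : WP w (.assign x e) Q N s :=
  ⟨_, _, .assign s x e he, hN, h⟩

theorem WP.store {a e : Expr} (ha : a.Fits w s) (he : e.Fits w s) (hN : a.cost + e.cost + 1 ≤ N)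
    (h : Q (N - (a.cost + e.cost + 1)) ⟨s.reg, update s.mem (a.eval s) (e.eval s)⟩) :
    WP w (.store a e) Q N s :=
  ⟨_, _, .store s a e ha he, hN, h⟩

theorem WP.seq {p q : Program} (h : WP w p (WP w q Q) N s) : WP w (.seq p q) Q N s := by
  obtain ⟨T, s', h1, h2, T', s'', h3, h4, h5⟩ := h
  exact ⟨_, _, h1.seq h3, by omega, by rwa [Nat.sub_add_eq]⟩

theorem WP.branch {t : Expr} {p q : Program} (hf : t.Fits w s) (hN : t.cost + 1 ≤ N)
    (hp : t.eval s ≠ 0 → WP w p Q (N - (t.cost + 1)) s)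
    (hq : t.eval s = 0 → WP w q Q (N - (t.cost + 1)) s) : WP w (.branch t p q) Q N s := by
  by_cases h : t.eval s = 0
  · obtain ⟨T, s', h1, h2, h3⟩ := hq h
    exact ⟨_, _, .branch_false hf h h1, by omega, by rwa [Nat.sub_add_eq]⟩
  · obtain ⟨T, s', h1, h2, h3⟩ := hp h
    exact ⟨_, _, .branch_true hf h h1, by omega, by rwa [Nat.sub_add_eq]⟩

/-- The invariant may mention the remaining number of steps. Every test costs at least one step, so
this number also serves as the variant, and termination needs no separate argument. -/
theorem WP.loop {t : Expr} {p : Program} (Inv : ℕ → State → Prop)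
    (h : ∀ N s, Inv N s → t.Fits w s ∧ t.cost + 1 ≤ N ∧
      (t.eval s ≠ 0 → WP w p Inv (N - (t.cost + 1)) s) ∧
      (t.eval s = 0 → Q (N - (t.cost + 1)) s)) (hs : Inv N s) : WP w (.loop t p) Q N s := by
  induction N using Nat.strong_induction_on generalizing s with
  | _ N ih =>
    obtain ⟨hf, hN, h1, h2⟩ := h N s hs
    by_cases h0 : t.eval s = 0
    · exact ⟨_, _, .loop_false hf h0, hN, h2 h0⟩
    · obtain ⟨T, s', g1, g2, g3⟩ := h1 h0
      obtain ⟨T', s'', g4, g5, g6⟩ := ih _ (by omega) g3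
      exact ⟨_, _, .loop_true hf h0 g1 g4, by omega, by
        rwa [Nat.sub_add_eq, Nat.sub_add_eq]⟩

/-- The consecutive execution of several programs. -/
def block : List Program → Program
  | [] => .skip
  | p :: ps => .seq p (block ps)

theorem WP.nil (hN : 1 ≤ N) (h : Q (N - 1) s) : WP w (block []) Q N s := WP.skip hN h

theorem WP.cons {p : Program} {ps : List Program} (h : WP w p (WP w (block ps) Q) N s) :
    WP w (block (p :: ps)) Q N s := WP.seq h

end WP

/-! ### The memory layout -/

namespace Expr

instance : Add Expr := ⟨Expr.add⟩
instance : Sub Expr := ⟨Expr.sub⟩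
instance : Mul Expr := ⟨Expr.mul⟩
instance (k : ℕ) : OfNat Expr k := ⟨Expr.const k⟩

variable {s : State} {a b : Expr} {w k : ℕ}

theorem eval_add : (a + b).eval s = a.eval s + b.eval s := rfl
theorem eval_sub : (a - b).eval s = a.eval s - b.eval s := rfl
theorem eval_mul : (a * b).eval s = a.eval s * b.eval s := rfl
theorem eval_ofNat : (no_index (OfNat.ofNat k) : Expr).eval s = k := rfl
theorem eval_reg : (Expr.reg k).eval s = s.reg k := rfl
theorem eval_mem : (Expr.mem a).eval s = s.mem (a.eval s) := rfl
theorem cost_add : (a + b).cost = a.cost + b.cost + 1 := rfl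
theorem cost_sub : (a - b).cost = a.cost + b.cost + 1 := rfl
theorem cost_mul : (a * b).cost = a.cost + b.cost + 1 := rfl
theorem cost_ofNat : (no_index (OfNat.ofNat k) : Expr).cost = 1 := rfl
theorem cost_reg : (Expr.reg k).cost = 1 := rfl
theorem cost_mem : (Expr.mem a).cost = a.cost + 1 := rfl
theorem fits_add : (a + b).Fits w s ↔ a.Fits w s ∧ b.Fits w s ∧ a.eval s + b.eval s ≤ w := Iff.rfl
theorem fits_sub : (a - b).Fits w s ↔ a.Fits w s ∧ b.Fits w s := Iff.rfl
theorem fits_mul : (a * b).Fits w s ↔ a.Fits w s ∧ b.Fits w s ∧ a.eval s * b.eval s ≤ w := Iff.rfl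
theorem fits_ofNat : (no_index (OfNat.ofNat k) : Expr).Fits w s ↔ k ≤ w := Iff.rfl
theorem fits_reg : (Expr.reg k).Fits w s ↔ s.reg k ≤ w := Iff.rfl
theorem fits_mem : (Expr.mem a).Fits w s ↔ a.Fits w s ∧ s.mem (a.eval s) ≤ w := Iff.rfl

end Expr

/-- The update of one entry in a family of arrays. -/
def upd (F : ℕ → ℕ → ℕ) (k i v : ℕ) : ℕ → ℕ → ℕ := update F k (update (F k) i v)

theorem upd_same (F : ℕ → ℕ → ℕ) (k i v : ℕ) : upd F k i v k = update (F k) i v :=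
  update_self _ _ _

theorem upd_ne (F : ℕ → ℕ → ℕ) {k l : ℕ} (h : l ≠ k) (i v : ℕ) : upd F k i v l = F l :=
  update_of_ne h _ _

/-- A memory with a header of three words, three arrays `A 0, A 1, A 2` with `m` entries each, and
eight unbounded arrays `F 0, …, F 7`. -/
def layout (m : ℕ) (h : ℕ → ℕ) (A F : ℕ → ℕ → ℕ) (j : ℕ) : ℕ :=
  if j < 3 then h j else if j < 3 + 3 * m then A ((j - 3) % 3) ((j - 3) / 3)
  else F ((j - (3 + 3 * m)) % 8) ((j - (3 + 3 * m)) / 8)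

section Layout

variable {m : ℕ} {h : ℕ → ℕ} {A F : ℕ → ℕ → ℕ} {k i v : ℕ}

theorem layout_header (hk : k < 3) : layout m h A F k = h k := if_pos hk

theorem layout_input (hk : k < 3) (hi : i < m) : layout m h A F (3 + 3 * i + k) = A k i := by
  rw [layout, if_neg (by omega), if_pos (by omega), show (3 + 3 * i + k - 3) % 3 = k by omega,
    show (3 + 3 * i + k - 3) / 3 = i by omega]

theorem layout_work (hk : k < 8) : layout m h A F (3 + 3 * m + 8 * i + k) = F k i := by
  rw [layout, if_neg (by omega), if_neg (by omega),
    show (3 + 3 * m + 8 * i + k - (3 + 3 * m)) % 8 = k by omega,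
    show (3 + 3 * m + 8 * i + k - (3 + 3 * m)) / 8 = i by omega]

theorem update_layout_header (hk : k < 3) :
    update (layout m h A F) k v = layout m (update h k v) A F := by
  funext j
  by_cases hj : j = k
  · subst hj; rw [update_self, layout_header hk, update_self]
  · rw [update_of_ne hj]
    simp only [layout, update_of_ne hj]

theorem update_layout_input (hk : k < 3) (hi : i < m) :
    update (layout m h A F) (3 + 3 * i + k) v = layout m h (upd A k i v) F := by
  funext j
  by_cases hj : j = 3 + 3 * i + k
  · subst hj; rw [update_self, layout_input hk hi, upd_same, update_self]
  · rw [update_of_ne hj, layout, layout]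
    split_ifs with h1 h2
    · rfl
    · by_cases h3 : (j - 3) % 3 = k
      · rw [h3, upd_same, update_of_ne (by omega)]
      · rw [upd_ne _ h3]
    · rfl

theorem update_layout_work (hk : k < 8) :
    update (layout m h A F) (3 + 3 * m + 8 * i + k) v = layout m h A (upd F k i v) := by
  funext j
  by_cases hj : j = 3 + 3 * m + 8 * i + k
  · subst hj; rw [update_self, layout_work hk, upd_same, update_self]
  · rw [update_of_ne hj, layout, layout]
    split_ifs with h1 h2
    · rfl
    · rfl
    · by_cases h3 : (j - (3 + 3 * m)) % 8 = k
      · rw [h3, upd_same, update_of_ne (by omega)]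
      · rw [upd_ne _ h3]

end Layout

/-- The address of the entry `i` of the input array `k`. -/
def inputAddr (k : ℕ) (i : Expr) : Expr := 3 + 3 * i + .const k

/-- The entry `i` of the input array `k`. -/
def input (k : ℕ) (i : Expr) : Expr := .mem (inputAddr k i)

/-- The address of the entry `i` of the working array `k`; the register `0` holds the address of
the first working array. -/
def workAddr (k : ℕ) (i : Expr) : Expr := .reg 0 + 8 * i + .const k

/-- The entry `i` of the working array `k`. -/
def work (k : ℕ) (i : Expr) : Expr := .mem (workAddr k i)

section Layout

variable {w m : ℕ} {r h : ℕ → ℕ} {A F : ℕ → ℕ → ℕ} {k : ℕ} {i : Expr}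

theorem cost_inputAddr : (inputAddr k i).cost = i.cost + 6 := by
  show 1 + (1 + i.cost + 1) + 1 + 1 + 1 = i.cost + 6; omega

theorem cost_input : (input k i).cost = i.cost + 7 := by
  rw [input, Expr.cost_mem, cost_inputAddr]

theorem cost_workAddr : (workAddr k i).cost = i.cost + 6 := by
  show 1 + (1 + i.cost + 1) + 1 + 1 + 1 = i.cost + 6; omega

theorem cost_work : (work k i).cost = i.cost + 7 := by
  rw [work, Expr.cost_mem, cost_workAddr]

theorem eval_inputAddr {s : State} : (inputAddr k i).eval s = 3 + 3 * i.eval s + k := rfl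

theorem eval_workAddr {s : State} (h0 : s.reg 0 = 3 + 3 * m) :
    (workAddr k i).eval s = 3 + 3 * m + 8 * i.eval s + k := by rw [← h0]; rfl

theorem eval_input (hk : k < 3) (hi : i.eval ⟨r, layout m h A F⟩ < m) :
    (input k i).eval ⟨r, layout m h A F⟩ = A k (i.eval ⟨r, layout m h A F⟩) :=
  layout_input hk hi

theorem eval_work (hk : k < 8) (h0 : r 0 = 3 + 3 * m) :
    (work k i).eval ⟨r, layout m h A F⟩ = F k (i.eval ⟨r, layout m h A F⟩) := by
  rw [work, Expr.eval_mem, eval_workAddr h0]; exact layout_work hk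

theorem fits_inputAddr {s : State} (hk : k < 3) :
    (inputAddr k i).Fits w s ↔ i.Fits w s ∧ 3 + 3 * i.eval s + k ≤ w := by
  simp only [inputAddr, Expr.fits_add, Expr.Fits, Expr.eval]
  constructor
  · rintro ⟨⟨-, ⟨-, h, -⟩, -⟩, -, h'⟩
    exact ⟨h, h'⟩
  · rintro ⟨h, h'⟩
    exact ⟨⟨by omega, ⟨by omega, h, by omega⟩, by omega⟩, by omega, h'⟩

theorem fits_input (hk : k < 3) (hi : i.eval ⟨r, layout m h A F⟩ < m) :
    (input k i).Fits w ⟨r, layout m h A F⟩ ↔ i.Fits w ⟨r, layout m h A F⟩ ∧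
      3 + 3 * i.eval ⟨r, layout m h A F⟩ + k ≤ w ∧ A k (i.eval ⟨r, layout m h A F⟩) ≤ w := by
  rw [input, Expr.fits_mem, fits_inputAddr hk, eval_inputAddr, and_assoc]
  simp only [layout_input hk hi]

theorem fits_workAddr {s : State} (h0 : s.reg 0 = 3 + 3 * m) :
    (workAddr k i).Fits w s ↔ i.Fits w s ∧ 8 ≤ w ∧ 3 + 3 * m + 8 * i.eval s + k ≤ w := by
  simp only [workAddr, Expr.fits_add, Expr.Fits, Expr.eval, h0]
  constructor
  · rintro ⟨⟨-, ⟨h8, h, -⟩, -⟩, -, h'⟩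
    exact ⟨h, h8, h'⟩
  · rintro ⟨h, h8, h'⟩
    exact ⟨⟨by omega, ⟨h8, h, by omega⟩, by omega⟩, by omega, h'⟩

theorem fits_work (hk : k < 8) (h0 : r 0 = 3 + 3 * m) :
    (work k i).Fits w ⟨r, layout m h A F⟩ ↔ i.Fits w ⟨r, layout m h A F⟩ ∧ 8 ≤ w ∧
      3 + 3 * m + 8 * i.eval ⟨r, layout m h A F⟩ + k ≤ w ∧
      F k (i.eval ⟨r, layout m h A F⟩) ≤ w := by
  rw [work, Expr.fits_mem, fits_workAddr (m := m) h0, eval_workAddr (m := m) h0, and_assoc, and_assoc]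
  simp only [layout_work hk]

end Layout

end BRAC

/-! ### Rules for the memory layout; degrees and index sums -/

namespace BRAC

open Set Function

section Rules

variable {w m N : ℕ} {r h : ℕ → ℕ} {A F : ℕ → ℕ → ℕ} {Q : ℕ → State → Prop}

/-- Naming the value `v` separately keeps the states in a simplified form during symbolic execution.
-/
theorem WP.assign_eq {x : ℕ} {e : Expr} {s : State} (v : ℕ) (he : e.Fits w s) (hN : e.cost + 1 ≤ N)
    (hv : e.eval s = v) (h : Q (N - (e.cost + 1)) ⟨update s.reg x v, s.mem⟩) :
    WP w (.assign x e) Q N s := by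
  subst hv; exact WP.assign he hN h

theorem WP.store_work {k : ℕ} {i e : Expr} (iv v : ℕ) (hk : k < 8) (h0 : r 0 = 3 + 3 * m)
    (ha : (workAddr k i).Fits w ⟨r, layout m h A F⟩) (he : e.Fits w ⟨r, layout m h A F⟩)
    (hN : i.cost + e.cost + 7 ≤ N) (hi : i.eval ⟨r, layout m h A F⟩ = iv)
    (hv : e.eval ⟨r, layout m h A F⟩ = v)
    (hQ : Q (N - (i.cost + e.cost + 7)) ⟨r, layout m h A (upd F k iv v)⟩) :
    WP w (.store (workAddr k i) e) Q N ⟨r, layout m h A F⟩ := by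
  have hc := cost_workAddr (k := k) (i := i)
  refine WP.store ha he (by omega) ?_
  rw [eval_workAddr (m := m) h0, hi, hv, hc]
  simp only [update_layout_work hk]
  rwa [show i.cost + 6 + e.cost + 1 = i.cost + e.cost + 7 by omega]

theorem WP.store_input {k : ℕ} {i e : Expr} (iv v : ℕ) (hk : k < 3) (him : iv < m)
    (ha : (inputAddr k i).Fits w ⟨r, layout m h A F⟩) (he : e.Fits w ⟨r, layout m h A F⟩)
    (hN : i.cost + e.cost + 7 ≤ N) (hi : i.eval ⟨r, layout m h A F⟩ = iv)
    (hv : e.eval ⟨r, layout m h A F⟩ = v)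
    (hQ : Q (N - (i.cost + e.cost + 7)) ⟨r, layout m h (upd A k iv v) F⟩) :
    WP w (.store (inputAddr k i) e) Q N ⟨r, layout m h A F⟩ := by
  have hc := cost_inputAddr (k := k) (i := i)
  refine WP.store ha he (by omega) ?_
  rw [eval_inputAddr, hi, hv, hc]
  simp only [update_layout_input hk him]
  rwa [show i.cost + 6 + e.cost + 1 = i.cost + e.cost + 7 by omega]

end Rules

attribute [simp] Expr.eval_add Expr.eval_sub Expr.eval_mul Expr.eval_ofNat Expr.eval_reg
  Expr.cost_add Expr.cost_sub Expr.cost_mul Expr.cost_ofNat Expr.cost_reg Expr.fits_add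
  Expr.fits_sub Expr.fits_mul Expr.fits_ofNat Expr.fits_reg upd_same upd_ne cost_inputAddr
  cost_input cost_workAddr cost_work eval_input eval_work fits_inputAddr fits_input fits_workAddr
  fits_work

/-- The input consists of `m` edges without loops on the vertices `0, …, n - 1`, and the
word size is large enough. -/
structure Valid (w n m R : ℕ) (I : ℕ → ℕ → ℕ) : Prop where
  n_le : n ≤ R
  m_le : m ≤ R
  sq_le : m * m ≤ R
  left_lt : ∀ e < m, I 0 e < n
  right_lt : ∀ e < m, I 1 e < n
  label_le : ∀ e < m, I 2 e ≤ 3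
  le : 1000 * R + 1000 ≤ w
  simple : SimpleOn (I 0) (I 1) (Finset.range m)

/-- At most `m` edges with indices below `m` meet at a vertex. These sums are the reason why words
have to hold numbers of size `m * m`. -/
theorem esum_le {U W : ℕ → ℕ} {A : Finset ℕ} {m : ℕ} (hA : A ⊆ Finset.range m) (x : ℕ) :
    esum U W A x ≤ m * m := by
  have hs : ∀ e ∈ star U W A x, e ≤ m := fun e he =>
    (Finset.mem_range.1 (hA (mem_star.1 he).1)).le
  refine (Finset.sum_le_card_nsmul _ _ _ hs).trans ?_
  rw [smul_eq_mul]
  refine Nat.mul_le_mul_right _ ((deg_le_card (U := U) (W := W)).trans ?_)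
  exact (Finset.card_le_card hA).trans_eq (Finset.card_range m)

theorem deg_le {U W : ℕ → ℕ} {A : Finset ℕ} {m : ℕ} (hA : A ⊆ Finset.range m) (x : ℕ) :
    deg U W A x ≤ m :=
  deg_le_card.trans ((Finset.card_le_card hA).trans_eq (Finset.card_range m))

/-- Computes the degrees and the sums of the incident edge indices. -/
def countPhase : Program := block [
  .assign 3 0,
  .loop (.reg 2 - .reg 3) (block [
    .assign 4 (input 0 (.reg 3)),
    .store (workAddr 0 (.reg 4)) (work 0 (.reg 4) + 1),
    .store (workAddr 1 (.reg 4)) (work 1 (.reg 4) + .reg 3),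
    .assign 4 (input 1 (.reg 3)),
    .store (workAddr 0 (.reg 4)) (work 0 (.reg 4) + 1),
    .store (workAddr 1 (.reg 4)) (work 1 (.reg 4) + .reg 3),
    .assign 3 (.reg 3 + 1)])]

theorem countPhase_wp {w n m R N : ℕ} {r h : ℕ → ℕ} {I F : ℕ → ℕ → ℕ} {Q : ℕ → State → Prop}
    (hv : Valid w n m R I) (r0 : r 0 = 3 + 3 * m) (r1 : r 1 = n) (r2 : r 2 = m)
    (hF : ∀ k i, F k i = 0) (hN : 200 * (m + 1) ≤ N)
    (hQ : ∀ N' r' F', N ≤ N' + 200 * (m + 1) → r' 0 = 3 + 3 * m → r' 1 = n → r' 2 = m →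
      (∀ i, F' 0 i = deg (I 0) (I 1) (Finset.range m) i) →
      (∀ i, F' 1 i = esum (I 0) (I 1) (Finset.range m) i) → (∀ k, 2 ≤ k → ∀ i, F' k i = 0) →
      Q N' ⟨r', layout m h I F'⟩) :
    WP w countPhase Q N ⟨r, layout m h I F⟩ := by
  have hn := hv.n_le
  have hm := hv.m_le
  have hw := hv.le
  refine WP.cons (WP.assign_eq 0 (by simp) (by simp; omega) rfl (WP.cons (WP.loop
    (fun N' s => ∃ r' F' e, s = ⟨r', layout m h I F'⟩ ∧ e ≤ m ∧ N ≤ N' + 3 + 150 * e ∧ r' 0 = 3 + 3 * m ∧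
      r' 1 = n ∧ r' 2 = m ∧ r' 3 = e ∧
      (∀ i, F' 0 i = deg (I 0) (I 1) (Finset.range e) i) ∧
      (∀ i, F' 1 i = esum (I 0) (I 1) (Finset.range e) i) ∧ (∀ k, 2 ≤ k → ∀ i, F' k i = 0))
    ?_ ⟨_, F, 0, rfl, by omega, by simp; omega, by simpa, by simpa, by simpa, by simp, ?_⟩)))
  swap
  · simp [hF, deg, esum, star]
  rintro N' _ ⟨r', F', e, rfl, he, hN', r0, r1, r2, r3, F0, F1, F2⟩
  refine ⟨by simp [r2, r3]; omega, by simp; omega, fun ht => ?_, fun ht => ?_⟩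
  swap
  · simp [r2, r3] at ht
    obtain rfl : e = m := by omega
    exact WP.nil (by simp; omega) (hQ _ _ _ (by simp; omega) r0 r1 r2 F0 F1 F2)
  simp only [Expr.eval_sub, Expr.eval_reg, r2, r3] at ht
  have hem : e < m := by omega
  have hu := hv.left_lt e hem
  have hwn := hv.right_lt e hem
  have hsub : Finset.range e ⊆ Finset.range m := Finset.range_subset_range.2 he
  have hd : ∀ i, F' 0 i ≤ m := fun i => F0 i ▸ deg_le hsub i
  have hes : ∀ i, F' 1 i ≤ R := fun i => F1 i ▸ (esum_le hsub i).trans hv.sq_le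
  have hd' := fun i => (hd i).trans hm
  refine WP.cons (WP.assign_eq (I 0 e) (by simp [r3, hem]; omega) (by simp; omega) (by simp [r3, hem]) ?_)
  have b1 := hd (I 0 e)
  have b2 := hes (I 0 e)
  have b3 := hd (I 1 e)
  have b4 := hes (I 1 e)
  refine WP.cons (WP.store_work (I 0 e) (F' 0 (I 0 e) + 1) (by simp) (by simpa)
    (by simp [r0]; omega) (by simp [r0]; omega) (by simp; omega) (by simp) (by simp [r0]) ?_)
  refine WP.cons (WP.store_work (I 0 e) (F' 1 (I 0 e) + e) (by simp) (by simpa)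
    (by simp [r0]; omega) (by simp [r0, r3]; omega) (by simp; omega) (by simp) (by simp [r0, r3]) ?_)
  -- The two ends differ, so the updates for the second end read values that the first two updates
  -- have not changed.
  have hne := hv.simple.loopless e (Finset.mem_range.2 hem)
  refine WP.cons (WP.assign_eq (I 1 e) (by simp [r3, hem]; omega) (by simp; omega) (by simp [r3, hem]) ?_)
  refine WP.cons (WP.store_work (I 1 e) (F' 0 (I 1 e) + 1) (by simp) (by simpa)
    (by simp [r0]; omega) (by simp [r0, hne.symm]; omega) (by simp; omega) (by simp) (by simp [r0, hne.symm]) ?_)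
  refine WP.cons (WP.store_work (I 1 e) (F' 1 (I 1 e) + e) (by simp) (by simpa)
    (by simp [r0]; omega) (by simp [r0, r3, hne.symm]; omega) (by simp; omega) (by simp) (by simp [r0, r3, hne.symm]) ?_)
  refine WP.cons (WP.assign_eq (e + 1) (by simp [r3]; omega) (by simp; omega) (by simp [r3]) ?_)
  refine WP.nil (by simp; omega) ⟨_, _, e + 1, rfl, hem, by simp; omega, by simpa, by simpa, by simpa,
    by simp, fun i => ?_, fun i => ?_, fun k hk i => ?_⟩
  · rw [Finset.range_add_one, deg_insert (by simp), ← F0]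
    simp [Inc, update_apply, eq_comm]
    grind
  · rw [Finset.range_add_one, esum_insert (by simp), ← F1]
    simp [Inc, update_apply, eq_comm]
    grind
  · rw [upd_ne _ (by omega), upd_ne _ (by omega), upd_ne _ (by omega), upd_ne _ (by omega), F2 k hk]

end BRAC

/-! ### Removal of leaves -/

namespace BRAC

open Set Function

/-- The state of the working arrays while leaves are removed: `A` is the set of the remaining
edges. -/
structure Stripped (m : ℕ) (I F : ℕ → ℕ → ℕ) (A : Finset ℕ) : Prop where
  sub : A ⊆ Finset.range m
  ext : Extendable (edgesOf (I 0) (I 1) A) (edgesOf (I 0) (I 1) (Finset.range m))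
  deg : ∀ i, F 0 i = deg (I 0) (I 1) A i
  esum : ∀ i, F 1 i = esum (I 0) (I 1) A i
  mark : ∀ i, F 2 i = if i < m ∧ i ∉ A then 1 else 0
  zero : ∀ k, 3 ≤ k → ∀ i, F k i = 0

/-- At a leaf `x`, the stored sum is the only edge `e`, and the sum of the ends of `e` minus `x` is
the neighbour. Resetting `x`, lowering the two entries of the neighbour and marking `e` match the
deletion of `e`. -/
theorem Stripped.step {w n m R : ℕ} {I F : ℕ → ℕ → ℕ} {A : Finset ℕ} (hv : Valid w n m R I)
    (h : Stripped m I F A) {x e y : ℕ} (hx : BRAC.deg (I 0) (I 1) A x = 1) (he : F 1 x = e)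
    (hy : I 0 e + I 1 e - x = y) :
    Stripped m I (upd (upd (upd (upd (upd F 0 x 0) 1 x 0) 0 y (F 0 y - 1)) 1 y (F 1 y - e)) 2 e 1)
      (A.erase e) ∧ e ∈ A ∧ y ≠ x ∧ Inc (I 0) (I 1) e y ∧ Inc (I 0) (I 1) e x ∧ 1 ≤ F 0 y := by
  have hA := hv.simple.mono h.sub
  have he' : BRAC.esum (I 0) (I 1) A x = e := by rw [← h.esum, he]
  have hstar := star_eq_of_deg_one hx
  have hmem : e ∈ star (I 0) (I 1) A x := by rw [hstar, he']; simp
  obtain ⟨heA, hex⟩ := mem_star.1 hmem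
  have hj := hex.joins
  rw [hy] at hj
  have hxy : y ≠ x := by
    rintro rfl
    have := hA.loopless e heA
    rcases hj with ⟨h1, h2⟩ | ⟨h1, h2⟩ <;> exact this (h1.trans h2.symm)
  have hinc : ∀ z, Inc (I 0) (I 1) e z ↔ z = x ∨ z = y := by
    intro z
    rcases hj with ⟨h1, h2⟩ | ⟨h1, h2⟩ <;> simp [Inc, h1, h2, eq_comm, or_comm]
  refine ⟨⟨(Finset.erase_subset _ _).trans h.sub, ?_, fun i => ?_, fun i => ?_, fun i => ?_,
    fun k hk i => ?_⟩, heA, hxy, hj.inc_right, hex, ?_⟩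
  · have := extendable_erase_leaf hA hx
    rw [he'] at this
    exact this.trans h.ext
  · rw [deg_erase heA]
    simp only [hinc]
    have := h.deg i
    simp [update_apply]
    grind
  · rw [esum_erase heA]
    simp only [hinc]
    have := h.esum i
    simp [update_apply]
    grind
  · have := h.mark i
    have := Finset.mem_range.1 (h.sub heA)
    simp [update_apply]
    grind
  · rw [upd_ne _ (by omega), upd_ne _ (by omega), upd_ne _ (by omega), upd_ne _ (by omega),
      upd_ne _ (by omega), h.zero k hk]
  · rw [h.deg]; exact deg_pos_of_inc heA hj.inc_right

/-- Removes leaves as long as there are any. -/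
def stripPhase : Program := block [
  .assign 3 0,
  .loop (.reg 1 - .reg 3) (block [
    .assign 4 (.reg 3),
    -- With truncated subtraction, the test is nonzero exactly if the degree is one.
    .loop (1 - ((1 - work 0 (.reg 4)) + (work 0 (.reg 4) - 1))) (block [
      .assign 5 (work 1 (.reg 4)),
      .assign 11 (input 0 (.reg 5) + input 1 (.reg 5) - .reg 4),
      .store (workAddr 0 (.reg 4)) 0,
      .store (workAddr 1 (.reg 4)) 0,
      .store (workAddr 0 (.reg 11)) (work 0 (.reg 11) - 1),
      .store (workAddr 1 (.reg 11)) (work 1 (.reg 11) - .reg 5),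
      .store (workAddr 2 (.reg 5)) 1,
      .assign 4 (.reg 11)]),
    .assign 3 (.reg 3 + 1)])]

/-- Deleting a leaf can only create a new leaf at its neighbour, so the inner loop continues there
at once, whether or not the neighbour has been scanned already. Each round of the inner loop deletes
an edge, so the time is amortized over vertices and edges. -/
theorem stripPhase_wp {w n m R N : ℕ} {r h : ℕ → ℕ} {I F : ℕ → ℕ → ℕ} {Q : ℕ → State → Prop}
    (hv : Valid w n m R I) (r0 : r 0 = 3 + 3 * m) (r1 : r 1 = n) (r2 : r 2 = m)
    (hF : Stripped m I F (Finset.range m)) (hN : 200 * (n + m + 1) ≤ N)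
    (hQ : ∀ N' r' F' A, N ≤ N' + 200 * (n + m + 1) → r' 0 = 3 + 3 * m → r' 1 = n → r' 2 = m →
      Stripped m I F' A → (∀ v, deg (I 0) (I 1) A v ≠ 1) → Q N' ⟨r', layout m h I F'⟩) :
    WP w stripPhase Q N ⟨r, layout m h I F⟩ := by
  have hn := hv.n_le
  have hm := hv.m_le
  have hw := hv.le
  refine WP.cons (WP.assign_eq 0 (by simp) (by simp; omega) rfl (WP.cons (WP.loop
    (fun N' s => ∃ r' F' v A, s = ⟨r', layout m h I F'⟩ ∧ v ≤ n ∧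
      N + 200 * A.card ≤ N' + 3 + 100 * v + 200 * m ∧
      r' 0 = 3 + 3 * m ∧ r' 1 = n ∧ r' 2 = m ∧ r' 3 = v ∧ Stripped m I F' A ∧
      ∀ u < v, deg (I 0) (I 1) A u ≠ 1)
    ?_ ⟨_, F, 0, _, rfl, by omega, by simp; omega, by simpa, by simpa, by simpa, by simp, hF,
      by simp⟩)))
  rintro N' _ ⟨r', F', v, A, rfl, hvn, hN', r0, r1, r2, r3, hS, hdeg⟩
  refine ⟨by simp [r1, r3]; omega, by simp; omega, fun ht => ?_, fun ht => ?_⟩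
  swap
  · simp [r1, r3] at ht
    obtain rfl : v = n := by omega
    refine WP.nil (by simp; omega) (hQ _ _ _ A (by simp; omega) r0 r1 r2 hS fun u hu => ?_)
    refine hdeg u ?_ hu
    by_contra hc
    obtain ⟨e, he⟩ := Finset.card_pos.1 (show 0 < deg (I 0) (I 1) A u by omega)
    obtain ⟨heA, hi⟩ := mem_star.1 he
    have hem := Finset.mem_range.1 (hS.sub heA)
    have h1 := hv.left_lt e hem
    have h2 := hv.right_lt e hem
    rcases hi with hi | hi <;> omega
  simp only [Expr.eval_sub, Expr.eval_reg, r1, r3] at ht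
  refine WP.cons (WP.assign_eq v (by simp [r3]; omega) (by simp; omega) (by simp [r3]) ?_)
  -- Among the scanned vertices, only the current vertex `x` may have degree one.
  refine WP.cons (WP.loop
    (fun N' s => ∃ r' F' x A, s = ⟨r', layout m h I F'⟩ ∧ x < n ∧
      N + 200 * A.card ≤ N' + 9 + 100 * v + 200 * m ∧
      r' 0 = 3 + 3 * m ∧ r' 1 = n ∧ r' 2 = m ∧ r' 3 = v ∧ r' 4 = x ∧ Stripped m I F' A ∧
      ∀ u ≤ v, u ≠ x → deg (I 0) (I 1) A u ≠ 1)
    ?_ ⟨_, F', v, A, rfl, by omega, by simp; omega, by simpa, by simpa, by simpa, by simpa, by simp, hS,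
      fun u hu hne => hdeg u (by omega)⟩)
  clear! A
  clear! N' r'
  rintro N' _ ⟨r', F', x, A, rfl, hxn, hN', r0, r1, r2, r3, r4, hS, hdeg⟩
  have hd : ∀ i, F' 0 i ≤ m := fun i => hS.deg i ▸ deg_le hS.sub i
  have hes : ∀ i, F' 1 i ≤ R := fun i => hS.esum i ▸ (esum_le hS.sub i).trans hv.sq_le
  have hdx := hd x
  have hcard := (Finset.card_le_card hS.sub).trans_eq (Finset.card_range m)
  refine ⟨by simp [r0, r4]; omega, by simp; omega, fun ht => ?_, fun ht => ?_⟩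
  swap
  · simp [r0, r4] at ht
    refine WP.cons (WP.assign_eq (v + 1) (by simp [r3]; omega) (by simp; omega) (by simp [r3]) ?_)
    refine WP.nil (by simp; omega) ⟨_, F', v + 1, A, rfl, by omega, by simp; omega, by simpa,
      by simpa, by simpa, by simp, hS, fun u hu => ?_⟩
    by_cases hux : u = x
    · have := hS.deg u; subst hux; omega
    · exact hdeg u (by omega) hux
  simp [r0, r4] at ht
  have hx1 : F' 0 x = 1 := by omega
  obtain ⟨e, he⟩ : ∃ e, F' 1 x = e := ⟨_, rfl⟩
  obtain ⟨y, hy⟩ : ∃ y, I 0 e + I 1 e - x = y := ⟨_, rfl⟩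
  obtain ⟨hS', heA, hyx, hey, hex, hFy⟩ := hS.step hv (by rw [← hS.deg, hx1]) he hy
  have hem := Finset.mem_range.1 (hS.sub heA)
  have h1 := hv.left_lt e hem
  have h2 := hv.right_lt e hem
  have hyn : y < n := by rcases hey with hi | hi <;> omega
  have hdy := hd y
  have hesy := hes y
  have hcard' := Finset.card_erase_add_one heA
  refine WP.cons (WP.assign_eq e (by simp [r0, r4]; omega) (by simp; omega) (by simp [r0, r4, he]) ?_)
  refine WP.cons (WP.assign_eq y (by simp [r4, hem]; omega) (by simp; omega)
    (by simp [r4, hem, hy]) ?_)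
  refine WP.cons (WP.store_work x 0 (by simp) (by simpa)
    (by simp [r0, r4]; omega) (by simp) (by simp; omega) (by simp [r4]) (by simp) ?_)
  refine WP.cons (WP.store_work x 0 (by simp) (by simpa)
    (by simp [r0, r4]; omega) (by simp) (by simp; omega) (by simp [r4]) (by simp) ?_)
  refine WP.cons (WP.store_work y (F' 0 y - 1) (by simp) (by simpa)
    (by simp [r0]; omega) (by simp [r0, hyx]; omega) (by simp; omega) (by simp) (by simp [r0, hyx]) ?_)
  refine WP.cons (WP.store_work y (F' 1 y - e) (by simp) (by simpa)
    (by simp [r0]; omega) (by simp [r0, hyx]; omega) (by simp; omega) (by simp) (by simp [r0, hyx]) ?_)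
  refine WP.cons (WP.store_work e 1 (by simp) (by simpa)
    (by simp [r0]; omega) (by simp; omega) (by simp; omega) (by simp) (by simp) ?_)
  refine WP.cons (WP.assign_eq y (by simp; omega) (by simp; omega) (by simp) ?_)
  refine WP.nil (by simp; omega) ⟨_, _, y, _, rfl, hyn, by simp; omega, by simpa, by simpa, by simpa,
    by simpa, by simp, hS', fun u hu hne => ?_⟩
  by_cases hux : u = x
  · subst hux
    have := hS.deg u
    rw [deg_erase heA, if_pos hex]; omega
  · rw [deg_erase heA, if_neg]
    · exact hdeg u hu hux
    · rcases hex with hi | hi <;> rcases hey with hj | hj <;> simp [Inc] <;> omega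

end BRAC

/-! ### Tracing a maximal chain -/

namespace BRAC

open Set Function

section Chains

variable {U W : ℕ → ℕ} {A D Q : Finset ℕ} {lab len : ℕ → ℕ}

/-- If both or neither of the ends equal `v`, the chain has an even number of edges at `v`. A
positive even number is at least two, so the chain contains all edges at a vertex of degree two. -/
theorem IsChain.mem_of_even {es ws : List ℕ} {x y v e f : ℕ} (hA : SimpleOn U W A)
    (h : IsChain U W A x es ws y) (hxy : x = v ↔ y = v) (hv : deg U W A v = 2) (he : e ∈ es)
    (hev : Inc U W e v) (hf : f ∈ A) (hfv : Inc U W f v) : f ∈ es := by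
  have h1 := h.tr.countP_eq (fun e he => hA.loopless e (h.sub e he)) v
  obtain ⟨h2, h3⟩ := countP_le_deg (U := U) (W := W) h.nodup h.sub v
  have h4 : 0 < es.countP fun e => Inc U W e v :=
    List.countP_pos_iff.2 ⟨e, he, by simpa using hev⟩
  refine h3 ?_ f hf hfv
  simp only [hxy] at h1
  split_ifs at h1 <;> omega

/-- A chain cannot be prolonged beyond its ends. -/
def Stops (U W : ℕ → ℕ) (A : Finset ℕ) (x y : ℕ) : Prop :=
  (deg U W A x ≠ 2 ∧ deg U W A y ≠ 2) ∨ x = y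

theorem IsChain.mem_of_stops {es ws : List ℕ} {x y v e f : ℕ} (hA : SimpleOn U W A)
    (h : IsChain U W A x es ws y) (hs : Stops U W A x y) (hv : deg U W A v = 2) (he : e ∈ es)
    (hev : Inc U W e v) (hf : f ∈ A) (hfv : Inc U W f v) : f ∈ es := by
  refine IsChain.mem_of_even hA h ?_ hv he hev hf hfv
  rcases hs with ⟨h1, h2⟩ | rfl
  · exact ⟨fun h => absurd (h ▸ hv) h1, fun h => absurd (h ▸ hv) h2⟩
  · rfl

/-- The edges of `D` are decomposed into maximal chains. -/
structure PartialDecomp (U W : ℕ → ℕ) (A D Q : Finset ℕ) (lab len : ℕ → ℕ) : Prop where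
  sub : D ⊆ A
  chain : ∀ q ∈ Q, ∃ x es ws y, IsChain U W A x es ws y ∧ Stops U W A x y ∧
    (∀ e, e ∈ es ↔ e ∈ D ∧ lab e = q) ∧ len q = es.length
  lab_mem : ∀ e ∈ D, lab e ∈ Q

/-- Chains of a partial decomposition are maximal, so none of them stops at a vertex of degree two
while another edge there is free. A new chain thus never runs into an old one at such a vertex. -/
theorem PartialDecomp.closed (hA : SimpleOn U W A) (h : PartialDecomp U W A D Q lab len)
    {v e f : ℕ} (hv : deg U W A v = 2) (he : e ∈ D) (hev : Inc U W e v) (hf : f ∈ A)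
    (hfv : Inc U W f v) : f ∈ D := by
  obtain ⟨x, es, ws, y, h1, h2, h3, -⟩ := h.chain _ (h.lab_mem e he)
  exact ((h3 f).1 (h1.mem_of_stops hA h2 hv ((h3 e).2 ⟨he, rfl⟩) hev hf hfv)).1

theorem PartialDecomp.decomp (h : PartialDecomp U W A A Q lab len) : Decomp U W A Q lab len :=
  ⟨h.chain, h.lab_mem⟩

theorem PartialDecomp.insert (h : PartialDecomp U W A D Q lab len) {x y q : ℕ} {es ws : List ℕ}
    (hc : IsChain U W A x es ws y) (hs : Stops U W A x y) (hd : ∀ e ∈ es, e ∉ D) (hq : q ∉ Q) :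
    PartialDecomp U W A (D ∪ es.toFinset) (insert q Q) (fun e => if e ∈ D then lab e else q)
      (update len q es.length) := by
  refine ⟨Finset.union_subset h.sub fun e he => hc.sub e (List.mem_toFinset.1 he), ?_, ?_⟩
  · intro p hp
    by_cases hpq : p = q
    · subst hpq
      refine ⟨x, es, ws, y, hc, hs, fun e => ?_, by simp⟩
      have := h.lab_mem e
      have := hd e
      simp only [Finset.mem_union, List.mem_toFinset]
      grind
    · obtain ⟨x', es', ws', y', h1, h2, h3, h4⟩ := h.chain p (Finset.mem_of_mem_insert_of_ne hp hpq)
      refine ⟨x', es', ws', y', h1, h2, fun e => ?_, by rw [update_of_ne hpq, h4]⟩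
      have := hd e
      rw [h3]
      simp only [Finset.mem_union, List.mem_toFinset]
      grind
  · intro e he
    have := h.lab_mem e
    simp only [Finset.mem_union, List.mem_toFinset] at he
    simp only [Finset.mem_insert]
    grind

/-- One step in the search for the end of a chain. -/
theorem IsChain.step {a x e f : ℕ} {es ws : List ℕ} (hA : SimpleOn U W A)
    (h : IsChain U W A a es ws x) (he : e ∈ es) (hex : Inc U W e x) (hx : deg U W A x = 2)
    (hf : esum U W A x - e = f) :
    f ∈ A ∧ Inc U W f x ∧ (f ∈ es → x = a) ∧ (f ∉ es → a ≠ x ∧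
      IsChain U W A a (es ++ [f]) (ws ++ [x]) (U f + W f - x)) := by
  obtain ⟨h1, h2⟩ := star_eq_of_deg_two hx (h.sub e he) hex
  rw [hf] at h1 h2
  have hfs : f ∈ star U W A x := by rw [h1]; simp
  obtain ⟨hfA, hfx⟩ := mem_star.1 hfs
  refine ⟨hfA, hfx, fun hfe => ?_, fun hfe => ⟨?_, h.tr.snoc hfx.joins, ?_, ?_, ?_⟩⟩
  -- If `x` were different from the start, the chain would have an odd number of edges at its end
  -- `x`; but `e` and `f` make it at least two, and the degree makes it at most two.
  · have h3 := h.tr.countP_eq (fun e he => hA.loopless e (h.sub e he)) x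
    have h4 := (countP_le_deg (U := U) (W := W) h.nodup h.sub x).1
    have h5 : [e, f].countP (fun e => Inc U W e x) ≤ es.countP fun e => Inc U W e x :=
      (List.subperm_of_subset (by simpa using h2) (by simp [he, hfe])).countP_le _
    have h6 : [e, f].countP (fun e => Inc U W e x) = 2 := by simp [hex, hfx]
    by_contra hc
    rw [if_neg (Ne.symm hc), if_pos rfl] at h3
    omega
  · rintro rfl
    exact hfe (IsChain.mem_of_even hA h Iff.rfl hx he hex hfA hfx)
  · exact List.nodup_append.2 ⟨h.nodup, by simp, by
      rintro b hb c hc rfl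
      rw [List.mem_singleton] at hc
      exact hfe (hc ▸ hb)⟩
  · intro b hb
    rcases List.mem_append.1 hb with hb | hb
    · exact h.sub b hb
    · rw [List.mem_singleton.1 hb]; exact hfA
  · intro b hb
    rcases List.mem_append.1 hb with hb | hb
    · exact h.deg_eq b hb
    · rw [List.mem_singleton.1 hb]; exact hx

end Chains

/-- The marks of the edges: `1` for edges outside `A`, and the increased labels for the edges in
`D`. -/
def marking (m : ℕ) (A D : Finset ℕ) (lab : ℕ → ℕ) (e : ℕ) : ℕ :=
  if e ∈ D then lab e + 2 else if e < m ∧ e ∉ A then 1 else 0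

/-- Follows a chain. The register `4` holds the current end vertex and the register `5` the last
edge, `3` the label of the chain and `8` its length. -/
def walk : Program :=
  -- The test is nonzero exactly if the current vertex has degree two and its other edge carries the
  -- mark zero, that is, is neither deleted nor assigned to a chain.
  .loop (1 - ((2 - work 0 (.reg 4)) + (work 0 (.reg 4) - 2) +
      work 2 (work 1 (.reg 4) - .reg 5))) (block [
    .assign 5 (work 1 (.reg 4) - .reg 5),
    .store (workAddr 2 (.reg 5)) (.reg 3 + 2),
    .assign 8 (.reg 8 + 1),
    .assign 4 (input 0 (.reg 5) + input 1 (.reg 5) - .reg 4)])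

/-- The walk halts at a vertex of degree other than two or back at its start `a`. The condition `a =
x → a = z` records that a chain that is already closed is not moved. Every step consumes an edge of
`A \ D`, which bounds the time. -/
theorem walk_wp {w n m R N : ℕ} {r h : ℕ → ℕ} {I F : ℕ → ℕ → ℕ} {Q : ℕ → State → Prop}
    (hv : Valid w n m R I) (r0 : r 0 = 3 + 3 * m) (r1 : r 1 = n) (r2 : r 2 = m)
    {A D : Finset ℕ} {lab : ℕ → ℕ} {a x e q : ℕ} {es ws : List ℕ} (hA : A ⊆ Finset.range m)
    (hF0 : ∀ i, F 0 i = deg (I 0) (I 1) A i) (hF1 : ∀ i, F 1 i = esum (I 0) (I 1) A i)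
    (hF2 : ∀ i, F 2 i = marking m A (D ∪ es.toFinset) lab i)
    (hlab : ∀ e, lab e ≤ m) (hlq : ∀ e, e ∉ D → lab e = q)
    (hD : ∀ v e f, deg (I 0) (I 1) A v = 2 → e ∈ D → Inc (I 0) (I 1) e v → f ∈ A →
      Inc (I 0) (I 1) f v → f ∈ D)
    (hc : IsChain (I 0) (I 1) A a es ws x) (hes : ∀ e ∈ es, e ∉ D) (he : e ∈ es)
    (hex : Inc (I 0) (I 1) e x) (r3 : r 3 = q) (r4 : r 4 = x) (r5 : r 5 = e)
    (r8 : r 8 = es.length) (hN : 60 + 200 * (A \ D).card ≤ N + 200 * es.length)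
    (hQ : ∀ N' r' F' es' ws' z, N + 200 * es.length ≤ N' + 60 + 200 * es'.length →
      r' 0 = 3 + 3 * m → r' 1 = n → r' 2 = m → r' 3 = q → r' 6 = r 6 → r' 8 = es'.length →
      (∀ i, F' 2 i = marking m A (D ∪ es'.toFinset) lab i) → (∀ k, k ≠ 2 → F' k = F k) →
      IsChain (I 0) (I 1) A a es' ws' z → (∀ e ∈ es', e ∉ D) → es ⊆ es' →
      (deg (I 0) (I 1) A z ≠ 2 ∨ z = a) → (a = x → a = z) → Q N' ⟨r', layout m h I F'⟩) :
    WP w walk Q N ⟨r, layout m h I F⟩ := by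
  have hn := hv.n_le
  have hm := hv.m_le
  have hw := hv.le
  have hAs := hv.simple.mono hA
  refine WP.loop
    (fun N' s => ∃ r' F' es' ws' z e, s = ⟨r', layout m h I F'⟩ ∧
      N + 200 * es.length ≤ N' + 200 * es'.length ∧
      r' 0 = 3 + 3 * m ∧ r' 1 = n ∧ r' 2 = m ∧ r' 3 = q ∧ r' 6 = r 6 ∧ r' 8 = es'.length ∧
      (∀ i, F' 2 i = marking m A (D ∪ es'.toFinset) lab i) ∧ (∀ k, k ≠ 2 → F' k = F k) ∧
      IsChain (I 0) (I 1) A a es' ws' z ∧ (∀ e ∈ es', e ∉ D) ∧ es ⊆ es' ∧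
      r' 4 = z ∧ r' 5 = e ∧ e ∈ es' ∧ Inc (I 0) (I 1) e z ∧ (a = x → a = z))
    ?_ ⟨_, F, es, ws, x, e, rfl, by omega, r0, r1, r2, r3, rfl, r8, hF2, fun _ _ => rfl, hc, hes,
      fun _ h => h, r4, r5, he, hex, id⟩
  clear r0 r1 r2 r3 r4 r5 r8 he hex
  clear! e
  rintro N' _ ⟨r', F', es', ws', z, e, rfl, hN', r0, r1, r2, r3, r6, r8, F2, Fk, hc', hes', hsub,
    r4, r5, he, hez, hax⟩
  have F0 : F' 0 = F 0 := Fk 0 (by omega)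
  have F1 : F' 1 = F 1 := Fk 1 (by omega)
  have hd : F 0 z ≤ m := hF0 z ▸ deg_le hA z
  have hs : F 1 z ≤ R := hF1 z ▸ (esum_le hA z).trans hv.sq_le
  have hmk : ∀ i, F' 2 i ≤ m + 2 := by
    intro i
    have := hlab i
    rw [F2, marking]
    split_ifs <;> omega
  have hmk' := hmk (F 1 z - e)
  have hem := Finset.mem_range.1 (hA (hc'.sub e he))
  have hzn : z < n := by
    have h1 := hv.left_lt e hem
    have h2 := hv.right_lt e hem
    rcases hez with h | h <;> omega
  have hle : ∀ {es ws z}, IsChain (I 0) (I 1) A a es ws z → (∀ e ∈ es, e ∉ D) →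
      es.length ≤ (A \ D).card := fun hc hes => by
    rw [← List.toFinset_card_of_nodup hc.nodup]
    refine Finset.card_le_card fun e he => ?_
    have he := List.mem_toFinset.1 he
    exact Finset.mem_sdiff.2 ⟨hc.sub e he, hes e he⟩
  have hlen := hle hc' hes'
  refine ⟨by simp [r0, r4, r5, F0, F1]; omega, by simp; omega, fun ht => ?_, fun ht => ?_⟩
  all_goals simp [r0, r4, r5, F0, F1] at ht
  swap
  · refine hQ _ _ F' es' ws' z (by simp; omega) r0 r1 r2 r3 r6 r8 F2 Fk hc' hes' hsub ?_ hax
    by_contra hcon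
    -- At a vertex of degree two, the walk was stopped by a mark on the other edge, which belongs to
    -- `A`. By `hD` this edge is not on an earlier chain, so it is on the present one, and then the
    -- chain has closed up.
    rw [not_or, not_not] at hcon
    obtain ⟨h1, h2, h3, -⟩ := hc'.step hAs he hez hcon.1 rfl
    rw [← hF1] at h1 h2 h3
    have hz := hF0 z
    have hne : F' 2 (F 1 z - e) ≠ 0 := by omega
    rw [F2, marking] at hne
    have hmem : F 1 z - e ∈ D ∪ es'.toFinset := by
      by_contra hno
      rw [if_neg hno, if_neg fun h => h.2 h1] at hne
      exact hne rfl
    rcases Finset.mem_union.1 hmem with hmem | hmem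
    · exact hes' e he (hD z _ e hcon.1 hmem h2 (hc'.sub e he) hez)
    · exact hcon.2 (h3 (List.mem_toFinset.1 hmem))
  have hz := hF0 z
  obtain ⟨f, hf⟩ : ∃ f, F 1 z - e = f := ⟨_, rfl⟩
  rw [hf] at ht hmk'
  have hzdeg : deg (I 0) (I 1) A z = 2 := by omega
  obtain ⟨hfA, hfz, -, hstep⟩ := hc'.step (f := f) hAs he hez hzdeg (by rw [← hF1]; exact hf)
  have hfm := Finset.mem_range.1 (hA hfA)
  have hf0 : F' 2 f = 0 := by omega
  rw [F2, marking] at hf0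
  have hfno : f ∉ D ∪ es'.toFinset := by
    intro hno
    rw [if_pos hno] at hf0
    omega
  have hfD : f ∉ D := fun h => hfno (Finset.mem_union_left _ h)
  obtain ⟨haz, hnew⟩ := hstep fun h => hfno (Finset.mem_union_right _ (List.mem_toFinset.2 h))
  have hlf := hlq f hfD
  have hq := hlab f
  have h1 := hv.left_lt f hfm
  have h2 := hv.right_lt f hfm
  have hes'' : ∀ b ∈ es' ++ [f], b ∉ D := by
    intro b hb
    rcases List.mem_append.1 hb with hb | hb
    · exact hes' b hb
    · rw [List.mem_singleton.1 hb]; exact hfD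
  have hlen' := hle hnew hes''
  have hAD := (Finset.card_le_card (Finset.sdiff_subset (s := A) (t := D))).trans
    ((Finset.card_le_card hA).trans_eq (Finset.card_range m))
  rw [List.length_append, List.length_singleton] at hlen'
  refine WP.cons (WP.assign_eq f (by simp [r0, r4, r5, F1]; omega) (by simp; omega)
    (by simp [r0, r4, r5, F1, hf]) ?_)
  refine WP.cons (WP.store_work f (q + 2) (by simp) (by simpa)
    (by simp [r0]; omega) (by simp [r3]; omega) (by simp; omega) (by simp) (by simp [r3]) ?_)
  refine WP.cons (WP.assign_eq (es'.length + 1) (by simp [r8]; omega) (by simp; omega)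
    (by simp [r8]) ?_)
  refine WP.cons (WP.assign_eq (I 0 f + I 1 f - z) (by simp [r4, hfm]; omega) (by simp; omega)
    (by simp [r4, hfm]) ?_)
  refine WP.nil (by simp; omega) ⟨_, _, es' ++ [f], ws' ++ [z], _, f, rfl, by simp; omega,
    by simpa, by simpa, by simpa, by simpa, by simpa, by simp, fun i => ?_, fun k hk => ?_, hnew,
    hes'', fun b hb => List.mem_append_left _ (hsub hb), by simp, by simp, by simp,
    hfz.joins.inc_right, fun h => absurd (hax h) haz⟩
  · simp only [upd_same, update_apply, marking, Finset.mem_union, List.mem_toFinset,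
      List.mem_append, List.mem_singleton]
    by_cases hi : i = f
    · subst hi; simp [hlf]
    · simp only [hi, if_false, or_false]
      rw [F2, marking]
      simp
  · rw [upd_ne _ hk, Fk k hk]

end BRAC

/-! ### The decomposition into maximal chains -/

namespace BRAC

open Set Function

/-- The state of the working arrays while the edges of `A` are decomposed into chains: `D` is the
set of the edges that have been assigned to a chain, and the edges before `e₀` are among them. -/
structure Chained (m : ℕ) (I F : ℕ → ℕ → ℕ) (A D Q : Finset ℕ) (lab : ℕ → ℕ) (e₀ : ℕ) : Prop where
  sub : A ⊆ Finset.range m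
  deg : ∀ i, F 0 i = deg (I 0) (I 1) A i
  esum : ∀ i, F 1 i = esum (I 0) (I 1) A i
  mark : ∀ i, F 2 i = marking m A D lab i
  lab_le : ∀ e, lab e ≤ m
  dec : PartialDecomp (I 0) (I 1) A D Q lab (F 3)
  lt : ∀ q ∈ Q, q < e₀
  len_zero : ∀ q, q ∉ Q → F 3 q = 0
  bucket : ∀ t, F 4 t = ∑ q ∈ Q, if F 3 q = t then F 3 q else 0
  zero : ∀ k, 5 ≤ k → ∀ i, F k i = 0
  done : ∀ e < e₀, e ∈ A → e ∈ D

theorem Stripped.chained {m : ℕ} {I F : ℕ → ℕ → ℕ} {A : Finset ℕ} (h : Stripped m I F A) :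
    Chained m I F A ∅ ∅ (fun _ => 0) 0 :=
  ⟨h.sub, h.deg, h.esum, fun i => by simp [h.mark, marking], by simp, ⟨by simp, by simp, by simp⟩,
    by simp, fun q _ => h.zero 3 le_rfl q, fun t => by simp [h.zero 4 (by omega)],
    fun k hk => h.zero k (by omega), by simp⟩

theorem Chained.len_le {m e₀ : ℕ} {I F : ℕ → ℕ → ℕ} {A D Q : Finset ℕ} {lab : ℕ → ℕ}
    (h : Chained m I F A D Q lab e₀) (q : ℕ) : F 3 q ≤ m := by
  by_cases hq : q ∈ Q
  · obtain ⟨x, es, ws, y, h1, -, -, h4⟩ := h.dec.chain q hq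
    rw [h4, ← List.toFinset_card_of_nodup h1.nodup, ← Finset.card_range m]
    exact Finset.card_le_card fun e he => h.sub (h1.sub e (List.mem_toFinset.1 he))
  · rw [h.len_zero q hq]; omega

theorem Chained.bucket_le {m e₀ : ℕ} {I F : ℕ → ℕ → ℕ} {A D Q : Finset ℕ} {lab : ℕ → ℕ}
    (h : Chained m I F A D Q lab e₀) (he : e₀ ≤ m) (t : ℕ) : F 4 t ≤ m * m := by
  rw [h.bucket]
  refine (Finset.sum_le_card_nsmul Q _ m fun q _ => ?_).trans ?_
  · have := h.len_le q
    split_ifs <;> omega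
  · rw [smul_eq_mul]
    refine Nat.mul_le_mul_right _ ?_
    rw [← Finset.card_range m]
    exact Finset.card_le_card fun q hq => Finset.mem_range.2 ((h.lt q hq).trans_le he)

theorem Chained.card_le {m e₀ : ℕ} {I F : ℕ → ℕ → ℕ} {A D Q : Finset ℕ} {lab : ℕ → ℕ}
    (h : Chained m I F A D Q lab e₀) : Q.card ≤ e₀ := by
  rw [← Finset.card_range e₀]
  exact Finset.card_le_card fun q hq => Finset.mem_range.2 (h.lt q hq)

/-- Decomposes the graph into chains. -/
def chainPhase : Program := block [
  .assign 3 0,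
  .assign 6 0,
  .loop (.reg 2 - .reg 3) (block [
    .branch (work 2 (.reg 3)) .skip (block [
      .store (workAddr 2 (.reg 3)) (.reg 3 + 2),
      .assign 6 (.reg 6 + 1),
      .assign 8 1,
      .assign 4 (input 1 (.reg 3)),
      .assign 5 (.reg 3),
      walk,
      .assign 4 (input 0 (.reg 3)),
      .assign 5 (.reg 3),
      walk,
      .store (workAddr 3 (.reg 3)) (.reg 8),
      .store (workAddr 4 (.reg 8)) (work 4 (.reg 8) + .reg 8)]),
    .assign 3 (.reg 3 + 1)])]

theorem Chained.insert {m e₀ z₁ z₂ : ℕ} {I F F' : ℕ → ℕ → ℕ} {A D Q : Finset ℕ} {lab : ℕ → ℕ}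
    (h : Chained m I F A D Q lab e₀) (hem : e₀ < m) {es ws : List ℕ}
    (hc : IsChain (I 0) (I 1) A z₁ es ws z₂) (hs : Stops (I 0) (I 1) A z₁ z₂)
    (hd : ∀ e ∈ es, e ∉ D) (he : e₀ ∈ es)
    (h2 : ∀ i, F' 2 i = marking m A (D ∪ es.toFinset) (fun e => if e ∈ D then lab e else e₀) i)
    (hk : ∀ k, k ≠ 2 → F' k = F k) :
    Chained m I (upd (upd F' 3 e₀ es.length) 4 es.length (F' 4 es.length + es.length)) A
      (D ∪ es.toFinset) (insert e₀ Q) (fun e => if e ∈ D then lab e else e₀) (e₀ + 1) := by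
  have hq : e₀ ∉ Q := fun hq => (h.lt _ hq).false
  refine ⟨h.sub, fun i => ?_, fun i => ?_, fun i => ?_, fun e => ?_, ?_, fun q hq => ?_,
    fun q hq => ?_, fun t => ?_, fun k hk5 i => ?_, fun e he' heA => ?_⟩
  · simp [hk, h.deg]
  · simp [hk, h.esum]
  · simp [h2]
  · have := h.lab_le e
    split_ifs <;> omega
  · simpa [hk] using h.dec.insert hc hs hd hq
  · rcases Finset.mem_insert.1 hq with rfl | hq
    · omega
    · have := h.lt q hq; omega
  · rw [Finset.mem_insert, not_or] at hq
    simp [hk, update_of_ne hq.1, h.len_zero q hq.2]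
  · rw [Finset.sum_insert hq]
    -- The label `e₀` is new, so the contributions of the old chains to the buckets are unchanged.
    have : ∑ q ∈ Q, (if update (F 3) e₀ es.length q = t then update (F 3) e₀ es.length q else 0) =
        F 4 t := by
      rw [h.bucket]
      refine Finset.sum_congr rfl fun q hq' => ?_
      rw [update_of_ne (ne_of_mem_of_not_mem hq' hq)]
    simp [update_apply] at this
    simp [hk, update_apply]
    rw [this]
    grind
  · rw [upd_ne _ (by omega), upd_ne _ (by omega), hk k (by omega), h.zero k hk5]
  · rw [Finset.mem_union, List.mem_toFinset]
    rcases Nat.lt_succ_iff_lt_or_eq.1 he' with he' | rfl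
    · exact .inl (h.done e he' heA)
    · exact .inr he

set_option maxHeartbeats 1000000 in
-- Every unassigned edge starts a chain labelled by its index, which is prolonged at both ends. The
-- work is charged to the scanned edges and to the edges of the new chains, so it is linear although
-- chains have arbitrary length.
theorem chainPhase_wp {w n m R N : ℕ} {r h : ℕ → ℕ} {I F : ℕ → ℕ → ℕ} {Q : ℕ → State → Prop}
    {A : Finset ℕ} (hv : Valid w n m R I) (r0 : r 0 = 3 + 3 * m) (r1 : r 1 = n) (r2 : r 2 = m)
    (hF : Stripped m I F A) (hN : 1000 * (m + 1) ≤ N)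
    (hQ : ∀ N' r' F' C lab, N ≤ N' + 1000 * (m + 1) → r' 0 = 3 + 3 * m → r' 1 = n → r' 2 = m →
      r' 6 = C.card → Chained m I F' A A C lab m → Q N' ⟨r', layout m h I F'⟩) :
    WP w chainPhase Q N ⟨r, layout m h I F⟩ := by
  have hn := hv.n_le
  have hm := hv.m_le
  have hw := hv.le
  have hAs := hv.simple.mono hF.sub
  refine WP.cons (WP.assign_eq 0 (by simp) (by simp; omega) rfl (WP.cons (WP.assign_eq 0 (by simp)
    (by simp; omega) rfl (WP.cons (WP.loop
    (fun N' s => ∃ r' F' e D C lab, s = ⟨r', layout m h I F'⟩ ∧ e ≤ m ∧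
      N ≤ N' + 10 + 500 * e + 200 * D.card ∧
      r' 0 = 3 + 3 * m ∧ r' 1 = n ∧ r' 2 = m ∧ r' 3 = e ∧ r' 6 = C.card ∧
      Chained m I F' A D C lab e)
    ?_ ⟨_, F, 0, ∅, ∅, _, rfl, by omega, by simp; omega, by simpa, by simpa, by simpa, by simp,
      by simp, hF.chained⟩)))))
  clear r0 r1 r2
  rintro N' _ ⟨r', F', e, D, C, lab, rfl, he, hN', r0, r1, r2, r3, r6, hC⟩
  have hDA := Finset.card_le_card hC.dec.sub
  have hAm := (Finset.card_le_card hF.sub).trans_eq (Finset.card_range m)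
  refine ⟨by simp [r2, r3]; omega, by simp; omega, fun ht => ?_, fun ht => ?_⟩
  all_goals simp [r2, r3] at ht
  swap
  · obtain rfl : e = m := by omega
    obtain rfl : D = A := hC.dec.sub.antisymm fun e he =>
      hC.done e (Finset.mem_range.1 (hF.sub he)) he
    exact WP.nil (by simp; omega) (hQ _ _ _ _ _ (by simp; omega) r0 r1 r2 r6 hC)
  have hem : e < m := by omega
  have hmk : F' 2 e ≤ m + 2 := by
    have := hC.lab_le e
    rw [hC.mark, marking]
    split_ifs <;> omega
  refine WP.cons (WP.branch (by simp [r0, r3]; omega) (by simp; omega) (fun hb => ?_)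
    fun hb => ?_)
  all_goals simp [r0, r3, hC.mark, marking] at hb
  · refine WP.skip (by simp; omega) (WP.cons (WP.assign_eq (e + 1) (by simp [r3]; omega)
      (by simp; omega) (by simp [r3]) (WP.nil (by simp; omega)
      ⟨_, F', e + 1, D, C, lab, rfl, by omega, by simp; omega, by simpa, by simpa, by simpa, by simp,
        by simpa, { hC with lt := fun q hq => (hC.lt q hq).trans (by omega), done := ?_ }⟩)))
    intro f hf hfA
    rcases Nat.lt_succ_iff_lt_or_eq.1 hf with hf | rfl
    · exact hC.done f hf hfA
    · by_contra hno
      simp [hno, hfA] at hb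
  have heD : e ∉ D := by
    intro h; simp [h] at hb
  have heA : e ∈ A := by
    by_contra h
    simp [heD, h, hem] at hb
  have hu := hv.left_lt e hem
  have hwn := hv.right_lt e hem
  have hCm := hC.card_le
  have hsd := Finset.card_sdiff_add_card_eq_card hC.dec.sub
  have hlab := hC.lab_le
  refine WP.cons (WP.store_work e (e + 2) (by simp) (by simpa)
    (by simp [r0, r3]; omega) (by simp [r3]; omega) (by simp; omega) (by simp [r3])
    (by simp [r3]) ?_)
  refine WP.cons (WP.assign_eq (C.card + 1) (by simp [r6]; omega) (by simp; omega)
    (by simp [r6]) ?_)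
  refine WP.cons (WP.assign_eq 1 (by simp; omega) (by simp; omega) (by simp) ?_)
  refine WP.cons (WP.assign_eq (I 1 e) (by simp [r3, hem]; omega) (by simp; omega)
    (by simp [r3, hem]) ?_)
  refine WP.cons (WP.assign_eq e (by simp [r3]; omega) (by simp; omega) (by simp [r3]) ?_)
  have hj : Joins (I 0) (I 1) e (I 0 e) (I 1 e) := .inl ⟨rfl, rfl⟩
  refine WP.cons (walk_wp hv (A := A) (D := D) (lab := fun f => if f ∈ D then lab f else e)
    (a := I 0 e) (x := I 1 e) (e := e) (q := e) (es := [e]) (ws := []) (by simpa) (by simpa)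
    (by simpa) hF.sub (by simpa using hC.deg) (by simpa using hC.esum) (fun i => ?_) (fun f => ?_)
    (fun f hf => by simp [hf]) (fun v e f h1 h2 h3 h4 h5 => hC.dec.closed hAs h1 h2 h3 h4 h5)
    ⟨.single hj, by simp, by simpa, by simp⟩ (by simpa) (by simp) hj.inc_right (by simpa) (by simp)
    (by simp) (by simp) (by simp; omega) ?_)
  · simp [update_apply, hC.mark, marking]
    grind
  · have := hlab f
    split_ifs <;> omega
  intro N₁ r₁ F₁ es₁ ws₁ z₁ hN₁ r0 r1 r2 r3 r6 r8 hF2 hFk hc₁ hes₁ hsub₁ hz₁ _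
  have he₁ : e ∈ es₁ := hsub₁ (by simp)
  simp at r6 hN₁
  have hle : ∀ {es ws y z}, IsChain (I 0) (I 1) A y es ws z → (∀ e ∈ es, e ∉ D) →
      es.length ≤ (A \ D).card := fun hc hes => by
    rw [← List.toFinset_card_of_nodup hc.nodup]
    refine Finset.card_le_card fun e he => ?_
    have he := List.mem_toFinset.1 he
    exact Finset.mem_sdiff.2 ⟨hc.sub e he, hes e he⟩
  have hlen₁ := hle hc₁ hes₁
  refine WP.cons (WP.assign_eq (I 0 e) (by simp [r3, hem]; omega) (by simp; omega)
    (by simp [r3, hem]) ?_)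
  refine WP.cons (WP.assign_eq e (by simp [r3]; omega) (by simp; omega) (by simp [r3]) ?_)
  have hFk' : ∀ k, k ≠ 2 → F₁ k = F' k := fun k hk => by rw [hFk k hk, upd_ne _ hk]
  -- The second walk prolongs the reversed chain, which now starts at `z₁` and ends with the initial
  -- edge. If the first walk came back to `I 0 e`, the chain is closed and stays so.
  refine WP.cons (walk_wp hv (A := A) (D := D) (lab := fun f => if f ∈ D then lab f else e)
    (a := z₁) (x := I 0 e) (e := e) (q := e) (es := es₁.reverse) (ws := ws₁.reverse) (by simpa)
    (by simpa) (by simpa) hF.sub (fun i => by rw [hFk' 0 (by omega), hC.deg])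
    (fun i => by rw [hFk' 1 (by omega), hC.esum]) (fun i => by rw [hF2, List.toFinset_reverse])
    (fun f => ?_) (fun f hf => by simp [hf])
    (fun v e f h1 h2 h3 h4 h5 => hC.dec.closed hAs h1 h2 h3 h4 h5) hc₁.reverse
    (fun f hf => hes₁ f (List.mem_reverse.1 hf)) (List.mem_reverse.2 he₁) hj.inc_left (by simpa)
    (by simp) (by simp) (by simpa) (by simp; omega) ?_)
  · have := hlab f
    split_ifs <;> omega
  clear r0 r1 r2 r3 r8
  intro N₂ r₂ F₂ es₂ ws₂ z₂ hN₂ r0 r1 r2 r3 r6' r8 hF2' hFk₂ hc₂ hes₂ hsub₂ hz₂ hz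
  simp at r6' hN₂
  have he₂ : e ∈ es₂ := hsub₂ (List.mem_reverse.2 he₁)
  have hlen₂ := hle hc₂ hes₂
  have hends : Stops (I 0) (I 1) A z₁ z₂ := by
    rcases hz₁ with h1 | h1
    · rcases hz₂ with h2 | h2
      · exact .inl ⟨h1, h2⟩
      · exact .inr h2.symm
    · exact .inr (hz h1)
  have hnew := hC.insert hem hc₂ hends hes₂ he₂ hF2' fun k hk => by rw [hFk₂ k hk, hFk' k hk]
  have hb : F₂ 4 es₂.length ≤ R := by
    rw [hFk₂ 4 (by omega), hFk' 4 (by omega)]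
    exact (hC.bucket_le he _).trans hv.sq_le
  have hcard : (D ∪ es₂.toFinset).card = D.card + es₂.length := by
    rw [Finset.card_union_of_disjoint, List.toFinset_card_of_nodup hc₂.nodup]
    exact Finset.disjoint_right.2 fun f hf => hes₂ f (List.mem_toFinset.1 hf)
  have hins : (insert e C).card = C.card + 1 :=
    Finset.card_insert_of_notMem fun h => (hC.lt _ h).false
  refine WP.cons (WP.store_work e es₂.length (by simp) (by simpa)
    (by simp [r0, r3]; omega) (by simp [r8]; omega) (by simp; omega) (by simp [r3])
    (by simp [r8]) ?_)
  refine WP.cons (WP.store_work es₂.length (F₂ 4 es₂.length + es₂.length) (by simp) (by simpa)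
    (by simp [r0, r8]; omega) (by simp [r0, r8]; omega) (by simp; omega) (by simp [r8])
    (by simp [r0, r8]) ?_)
  refine WP.nil (by simp; omega) ?_
  refine WP.cons (WP.assign_eq (e + 1) (by simp [r3]; omega) (by simp; omega) (by simp [r3]) ?_)
  exact WP.nil (by simp; omega) ⟨_, _, e + 1, _, _, _, rfl, by omega, by simp; omega, by simpa,
    by simpa, by simpa, by simp, by simp; omega, hnew⟩

end BRAC

/-! ### The length threshold -/

namespace BRAC

open Set Function

/-- Determines up to which length the chains are kept. -/
def scanPhase : Program := block [
  .assign 3 1,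
  .assign 7 0,
  -- The test is nonzero exactly if `t ≤ m` and `t ≤ 16M + 12q`, where `M` is the total length of
  -- the chains shorter than `t`.
  .loop (1 - ((.reg 3 - .reg 2) + (.reg 3 - (16 * .reg 7 + 12 * .reg 6)))) (block [
    .assign 7 (.reg 7 + work 4 (.reg 3)),
    .assign 3 (.reg 3 + 1)])]

/-- All smaller lengths passed the test, which yields the growth bound for the kept chains. At `t`
it fails: either `t` exceeds all lengths and no chain is dropped, or every dropped chain is long
enough to be redrawn. -/
theorem scanPhase_wp {w n m R N : ℕ} {r h : ℕ → ℕ} {I F : ℕ → ℕ → ℕ} {Q : ℕ → State → Prop}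
    {A C : Finset ℕ} {lab : ℕ → ℕ} (hv : Valid w n m R I) (r0 : r 0 = 3 + 3 * m) (r1 : r 1 = n)
    (r2 : r 2 = m) (r6 : r 6 = C.card) (hF : Chained m I F A A C lab m) (hN : 100 * (m + 1) ≤ N)
    (hQ : ∀ N' r' t, N ≤ N' + 100 * (m + 1) → r' 0 = 3 + 3 * m → r' 1 = n → r' 2 = m →
      r' 3 = t → t ≤ m + 1 →
      (∀ s < t, 1 ≤ s → s ≤ 16 * (∑ q ∈ C.filter fun q => F 3 q < s, F 3 q) + 12 * C.card) →
      (m < t ∨ 16 * (∑ q ∈ C.filter fun q => F 3 q < t, F 3 q) + 12 * C.card < t) →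
      Q N' ⟨r', layout m h I F⟩) :
    WP w scanPhase Q N ⟨r, layout m h I F⟩ := by
  have hm := hv.m_le
  have hw := hv.le
  have hC := hF.card_le
  have hS : ∀ t, (∑ q ∈ C.filter fun q => F 3 q < t, F 3 q) ≤ R := by
    intro t
    refine (Finset.sum_le_card_nsmul _ _ m fun q _ => hF.len_le q).trans
      (le_trans ?_ hv.sq_le)
    exact Nat.mul_le_mul_right _ ((Finset.card_filter_le _ _).trans hC)
  -- Raising the threshold by one adds exactly the bucket of the length `t`; so the scan takes
  -- constant time per length.
  have hstep : ∀ t, (∑ q ∈ C.filter fun q => F 3 q < t + 1, F 3 q) =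
      (∑ q ∈ C.filter fun q => F 3 q < t, F 3 q) + F 4 t := by
    intro t
    rw [hF.bucket, Finset.sum_filter, Finset.sum_filter, ← Finset.sum_add_distrib]
    refine Finset.sum_congr rfl fun q _ => ?_
    split_ifs <;> omega
  have h1 : (∑ q ∈ C.filter fun q => F 3 q < 1, F 3 q) = 0 := by
    refine Finset.sum_eq_zero fun q hq => ?_
    have := (Finset.mem_filter.1 hq).2
    omega
  have hb := fun t => (hF.bucket_le le_rfl t).trans hv.sq_le
  refine WP.cons (WP.assign_eq 1 (by simp; omega) (by simp; omega) rfl (WP.cons (WP.assign_eq 0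
    (by simp) (by simp; omega) rfl (WP.cons (WP.loop
    (fun N' s => ∃ r' t, s = ⟨r', layout m h I F⟩ ∧ 1 ≤ t ∧ t ≤ m + 1 ∧ N + 50 ≤ N' + 10 + 50 * t ∧
      r' 0 = 3 + 3 * m ∧ r' 1 = n ∧ r' 2 = m ∧ r' 3 = t ∧ r' 6 = C.card ∧
      r' 7 = (∑ q ∈ C.filter fun q => F 3 q < t, F 3 q) ∧
      ∀ s < t, 1 ≤ s → s ≤ 16 * (∑ q ∈ C.filter fun q => F 3 q < s, F 3 q) + 12 * C.card)
    ?_ ⟨_, 1, rfl, le_rfl, by omega, by simp; omega, by simpa, by simpa, by simpa, by simp,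
      by simpa, by rw [h1]; simp, by omega⟩)))))
  clear r0 r1 r2 r6
  rintro N' _ ⟨r', t, rfl, ht1, htm, hN', r0, r1, r2, r3, r6, r7, hs⟩
  have hSt := hS t
  refine ⟨by simp [r2, r3, r6, r7]; omega, by simp; omega, fun ht => ?_, fun ht => ?_⟩
  all_goals simp [r2, r3, r6, r7] at ht
  swap
  · exact WP.nil (by simp; omega) (hQ _ _ t (by simp; omega) r0 r1 r2 r3 htm hs (by omega))
  have := hb t
  have h2 := hstep t
  refine WP.cons (WP.assign_eq (∑ q ∈ C.filter fun q => F 3 q < t + 1, F 3 q)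
    (by simp [r0, r3, r7]; omega) (by simp; omega) (by rw [h2]; simp [r0, r3, r7]) ?_)
  refine WP.cons (WP.assign_eq (t + 1) (by simp [r3]; omega) (by simp; omega) (by simp [r3]) ?_)
  refine WP.nil (by simp; omega) ⟨_, t + 1, rfl, by omega, by omega, by simp; omega, by simpa,
    by simpa, by simpa, by simp, by simpa, by simp, fun s hst hs1 => ?_⟩
  rcases Nat.lt_succ_iff_lt_or_eq.1 hst with hst | rfl
  · exact hs s hst hs1
  · omega

/-! ### Output -/

/-- Appends `x` unless it is there already. -/
def addNew (vs : List ℕ) (x : ℕ) : List ℕ := if x ∈ vs then vs else vs ++ [x]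

/-- The increased position of `x` in the list, and zero if it does not occur. -/
def position (vs : List ℕ) (x : ℕ) : ℕ := if x ∈ vs then vs.idxOf x + 1 else 0

theorem mem_addNew {vs : List ℕ} {x y : ℕ} : y ∈ addNew vs x ↔ y ∈ vs ∨ y = x := by
  unfold addNew
  split_ifs with h
  · exact ⟨.inl, fun hy => hy.elim id fun hy => hy ▸ h⟩
  · simp

theorem nodup_addNew {vs : List ℕ} (hv : vs.Nodup) (x : ℕ) : (addNew vs x).Nodup := by
  unfold addNew
  split_ifs with h
  · exact hv
  · exact List.nodup_append.2 ⟨hv, by simp, by rintro a ha b hb rfl; simp_all⟩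

theorem length_addNew_le (vs : List ℕ) (x : ℕ) : (addNew vs x).length ≤ vs.length + 1 := by
  unfold addNew
  split_ifs <;> simp

theorem idxOf_addNew {vs : List ℕ} {x y : ℕ} (hy : y ∈ vs) :
    (addNew vs x).idxOf y = vs.idxOf y := by
  unfold addNew
  split_ifs with h
  · rfl
  · exact List.idxOf_append_of_mem hy

/-- Gives a number to the vertex in the register `k`. -/
def number (k : ℕ) : Program :=
  .branch (work 5 (.reg k)) .skip (block [
    .assign 10 (.reg 10 + 1),
    .store (workAddr 5 (.reg k)) (.reg 10)])

theorem number_wp {w m R N k x : ℕ} {r h : ℕ → ℕ} {I F : ℕ → ℕ → ℕ} {Q : ℕ → State → Prop}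
    {vs : List ℕ} (hw : 1000 * R + 1000 ≤ w) (hm : m ≤ R) (hx : x ≤ R) (hvs : vs.length ≤ 2 * R)
    (hk : k ≠ 10) (r0 : r 0 = 3 + 3 * m) (rk : r k = x) (r10 : r 10 = vs.length)
    (hF : ∀ i, F 5 i = position vs i) (hN : 40 ≤ N)
    (hQ : ∀ N' r' F', N ≤ N' + 40 → (∀ j, j ≠ 10 → r' j = r j) →
      r' 10 = (addNew vs x).length → (∀ i, F' 5 i = position (addNew vs x) i) →
      (∀ j, j ≠ 5 → F' j = F j) → Q N' ⟨r', layout m h I F'⟩) :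
    WP w (number k) Q N ⟨r, layout m h I F⟩ := by
  have hp : position vs x ≤ vs.length + 1 := by
    have := List.idxOf_le_length (l := vs) (a := x)
    unfold position
    split_ifs <;> omega
  refine WP.branch (by simp [r0, rk, hF]; omega) (by simp; omega) (fun ht => ?_) fun ht => ?_
  all_goals simp [r0, rk, hF, position] at ht
  · refine WP.skip (by simp; omega) (hQ _ _ _ (by simp; omega) (fun _ _ => rfl) ?_ ?_
      fun _ _ => rfl)
    · rw [addNew, if_pos ht, r10]
    · rw [addNew, if_pos ht]; exact hF
  · refine WP.cons (WP.assign_eq (vs.length + 1) (by simp [r10]; omega) (by simp; omega)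
      (by simp [r10]) ?_)
    refine WP.cons (WP.store_work x (vs.length + 1) (by simp) (by simpa)
      (by simp [r0, hk, rk]; omega) (by simp; omega) (by simp; omega) (by simp [hk, rk])
      (by simp) ?_)
    refine WP.nil (by simp; omega) (hQ _ _ _ (by simp; omega) (fun j hj => by simp [hj]) ?_
      (fun i => ?_) fun j hj => by rw [upd_ne _ hj])
    · simp [addNew, ht]
    · simp only [upd_same, update_apply, addNew, if_neg ht, position, List.mem_append,
        List.mem_singleton]
      by_cases hi : i = x
      · subst hi
        simp [List.idxOf_append_of_notMem ht]
      · simp only [hi, if_false, or_false]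
        rw [hF, position]
        split_ifs with h
        · rw [List.idxOf_append_of_mem h]
        · rfl

end BRAC

/-! ### Writing the kernel -/

namespace BRAC

open Set Function

theorem WP.store_header {w m N : ℕ} {r h : ℕ → ℕ} {A F : ℕ → ℕ → ℕ} {Q : ℕ → State → Prop} {k : ℕ}
    {e : Expr} (v : ℕ) (hk : k < 3) (hkw : k ≤ w) (he : e.Fits w ⟨r, layout m h A F⟩)
    (hN : e.cost + 2 ≤ N) (hv : e.eval ⟨r, layout m h A F⟩ = v)
    (hQ : Q (N - (e.cost + 2)) ⟨r, layout m (update h k v) A F⟩) :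
    WP w (.store (.const k) e) Q N ⟨r, layout m h A F⟩ := by
  refine WP.store hkw he (by show 1 + e.cost + 1 ≤ N; omega) ?_
  show Q (N - (1 + e.cost + 1)) ⟨r, update (layout m h A F) k _⟩
  rw [hv, update_layout_header hk]
  rwa [show 1 + e.cost + 1 = e.cost + 2 by omega]

/-- Writes the kept edges, with their end vertices renumbered. -/
def writeEdge : Program := block [
  .assign 4 (input 0 (.reg 3)),
  .assign 5 (input 1 (.reg 3)),
  .assign 8 (input 2 (.reg 3)),
  number 4,
  number 5,
  .store (inputAddr 0 (.reg 9)) (work 5 (.reg 4) - 1),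
  .store (inputAddr 1 (.reg 9)) (work 5 (.reg 5) - 1),
  .store (inputAddr 2 (.reg 9)) (.reg 8),
  .assign 9 (.reg 9 + 1)]

/-- The state of the output: the edges `ks` have been written to the first entries of the arrays
`J`, with the vertices numbered by their positions in `vs`; the input `I` is unchanged from the
entry `e` on. -/
structure Written (I J : ℕ → ℕ → ℕ) (ks vs : List ℕ) (e : ℕ) : Prop where
  edges_nodup : ks.Nodup
  edges_lt : ∀ f ∈ ks, f < e
  length_le : ks.length ≤ e
  verts_nodup : vs.Nodup
  mem_verts : ∀ v, v ∈ vs ↔ ∃ f ∈ ks, Inc (I 0) (I 1) f v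
  verts_le : vs.length ≤ 2 * ks.length
  left : ∀ j (hj : j < ks.length), J 0 j = vs.idxOf (I 0 ks[j])
  right : ∀ j (hj : j < ks.length), J 1 j = vs.idxOf (I 1 ks[j])
  label : ∀ j (hj : j < ks.length), J 2 j = I 2 ks[j]
  unchanged : ∀ k j, e ≤ j → J k j = I k j

/-- Appending vertices to the list does not change earlier positions, so the words written before
remain correct. Since `ks.length ≤ e`, writing in place does not reach the input entries after `e`.
-/
theorem Written.step {I J : ℕ → ℕ → ℕ} {ks vs : List ℕ} {e : ℕ} (h : Written I J ks vs e) :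
    Written I (upd (upd (upd J 0 ks.length ((addNew (addNew vs (I 0 e)) (I 1 e)).idxOf (I 0 e)))
      1 ks.length ((addNew (addNew vs (I 0 e)) (I 1 e)).idxOf (I 1 e))) 2 ks.length (I 2 e))
      (ks ++ [e]) (addNew (addNew vs (I 0 e)) (I 1 e)) (e + 1) := by
  have hmem : ∀ j (hj : j < ks.length), I 0 ks[j] ∈ vs ∧ I 1 ks[j] ∈ vs := fun j hj =>
    ⟨(h.mem_verts _).2 ⟨_, List.getElem_mem hj, .inl rfl⟩,
      (h.mem_verts _).2 ⟨_, List.getElem_mem hj, .inr rfl⟩⟩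
  have hget : ∀ j (hj : j < (ks ++ [e]).length),
      (∃ hj' : j < ks.length, (ks ++ [e])[j] = ks[j]) ∨ (j = ks.length ∧ (ks ++ [e])[j] = e) := by
    intro j hj
    by_cases hj' : j < ks.length
    · exact .inl ⟨hj', List.getElem_append_left hj'⟩
    · rw [List.length_append, List.length_singleton] at hj
      obtain rfl : j = ks.length := by omega
      exact .inr ⟨rfl, by simp⟩
  refine ⟨?_, fun f hf => ?_, by simpa using h.length_le, nodup_addNew (nodup_addNew h.verts_nodup _) _,
    fun v => ?_, ?_, fun j hj => ?_, fun j hj => ?_, fun j hj => ?_, fun k j hj => ?_⟩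
  · exact List.nodup_append.2 ⟨h.edges_nodup, by simp, by
      rintro a ha b hb rfl
      rw [List.mem_singleton] at hb
      exact (hb ▸ h.edges_lt a ha).false⟩
  · rcases List.mem_append.1 hf with hf | hf
    · exact (h.edges_lt f hf).trans (by omega)
    · rw [List.mem_singleton.1 hf]; omega
  · simp only [mem_addNew, h.mem_verts, List.mem_append, List.mem_singleton, or_and_right,
      exists_or, exists_eq_left, Inc]
    grind
  · have h1 := length_addNew_le vs (I 0 e)
    have h2 := length_addNew_le (addNew vs (I 0 e)) (I 1 e)
    have := h.verts_le
    simp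
    omega
  · rcases hget j hj with ⟨hj', h1⟩ | ⟨rfl, h1⟩ <;> rw [h1]
    · have := (hmem j hj').1
      rw [idxOf_addNew (mem_addNew.2 (.inl this)), idxOf_addNew this, ← h.left j hj']
      simp [hj'.ne]
    · simp
  · rcases hget j hj with ⟨hj', h1⟩ | ⟨rfl, h1⟩ <;> rw [h1]
    · have := (hmem j hj').2
      rw [idxOf_addNew (mem_addNew.2 (.inl this)), idxOf_addNew this, ← h.right j hj']
      simp [hj'.ne]
    · simp
  · rcases hget j hj with ⟨hj', h1⟩ | ⟨rfl, h1⟩ <;> rw [h1]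
    · rw [← h.label j hj']
      simp [hj'.ne]
    · simp
  · have hl := h.length_le
    have hne : j ≠ ks.length := by omega
    have hu := h.unchanged k j (by omega)
    rw [← hu]
    unfold upd
    simp only [update_apply]
    grind

theorem writeEdge_wp {w n m R N e : ℕ} {r h : ℕ → ℕ} {I J F : ℕ → ℕ → ℕ} {Q : ℕ → State → Prop}
    {ks vs : List ℕ} (hv : Valid w n m R I) (hW : Written I J ks vs e) (hem : e < m)
    (r0 : r 0 = 3 + 3 * m) (r3 : r 3 = e) (r9 : r 9 = ks.length) (r10 : r 10 = vs.length)
    (hF : ∀ i, F 5 i = position vs i) (hN : 200 ≤ N)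
    (hQ : ∀ N' r' J' F' vs', N ≤ N' + 200 → r' 0 = 3 + 3 * m → r' 1 = r 1 → r' 2 = r 2 →
      r' 3 = e → r' 9 = ks.length + 1 → r' 10 = vs'.length → r' 12 = r 12 →
      (∀ i, F' 5 i = position vs' i) → (∀ j, j ≠ 5 → F' j = F j) →
      Written I J' (ks ++ [e]) vs' (e + 1) → Q N' ⟨r', layout m h J' F'⟩) :
    WP w writeEdge Q N ⟨r, layout m h J F⟩ := by
  have hm := hv.m_le
  have hn := hv.n_le
  have hw := hv.le
  have hu := hv.left_lt e hem
  have hwn := hv.right_lt e hem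
  have hl := hv.label_le e hem
  have hkl := hW.length_le
  have hvl := hW.verts_le
  have u0 := hW.unchanged 0 e le_rfl
  have u1 := hW.unchanged 1 e le_rfl
  have u2 := hW.unchanged 2 e le_rfl
  -- All three words of the entry `e` are loaded before anything is written, because the output
  -- position may coincide with `e`.
  refine WP.cons (WP.assign_eq (I 0 e) (by simp [r3, hem]; omega) (by simp; omega)
    (by simp [r3, hem, u0]) ?_)
  refine WP.cons (WP.assign_eq (I 1 e) (by simp [r3, hem]; omega) (by simp; omega)
    (by simp [r3, hem, u1]) ?_)
  refine WP.cons (WP.assign_eq (I 2 e) (by simp [r3, hem]; omega) (by simp; omega)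
    (by simp [r3, hem, u2]) ?_)
  have hlen₁ := length_addNew_le vs (I 0 e)
  have hlen₂ := length_addNew_le (addNew vs (I 0 e)) (I 1 e)
  refine WP.cons (number_wp (x := I 0 e) (vs := vs) hw hm (by omega) (by omega) (by omega)
    (by simpa) (by simp) (by simpa) hF (by simp; omega) ?_)
  intro N₁ r₁ F₁ hN₁ hr₁ h10 hF₁ hFj₁
  refine WP.cons (number_wp (x := I 1 e) (vs := addNew vs (I 0 e)) hw hm (by omega) (by omega)
    (by omega) (by simpa [hr₁]) (by simp [hr₁]) (by simpa) hF₁ (by simp at hN₁; omega) ?_)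
  intro N₂ r₂ F₂ hN₂ hr₂ h10 hF₂ hFj₂
  simp at hN₁
  have hmem0 : I 0 e ∈ addNew (addNew vs (I 0 e)) (I 1 e) := by simp [mem_addNew]
  have hmem1 : I 1 e ∈ addNew (addNew vs (I 0 e)) (I 1 e) := by simp [mem_addNew]
  have hp0 : F₂ 5 (I 0 e) = (addNew (addNew vs (I 0 e)) (I 1 e)).idxOf (I 0 e) + 1 := by
    rw [hF₂, position, if_pos hmem0]
  have hp1 : F₂ 5 (I 1 e) = (addNew (addNew vs (I 0 e)) (I 1 e)).idxOf (I 1 e) + 1 := by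
    rw [hF₂, position, if_pos hmem1]
  have hi0 := List.idxOf_lt_length_of_mem hmem0
  have hi1 := List.idxOf_lt_length_of_mem hmem1
  have s0 : r₂ 0 = 3 + 3 * m := by simp [hr₂, hr₁, r0]
  have s3 : r₂ 3 = e := by simp [hr₂, hr₁, r3]
  have s4 : r₂ 4 = I 0 e := by simp [hr₂, hr₁]
  have s5 : r₂ 5 = I 1 e := by simp [hr₂, hr₁]
  have s8 : r₂ 8 = I 2 e := by simp [hr₂, hr₁]
  have s9 : r₂ 9 = ks.length := by simp [hr₂, hr₁, r9]
  refine WP.cons (WP.store_input ks.length _ (by simp) (by omega) (by simp [s9]; omega)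
    (by simp [s0, s4, hp0]; omega) (by simp; omega) (by simp [s9]) (by simp [s0, s4, hp0]; rfl) ?_)
  refine WP.cons (WP.store_input ks.length _ (by simp) (by omega) (by simp [s9]; omega)
    (by simp [s0, s5, hp1]; omega) (by simp; omega) (by simp [s9]) (by simp [s0, s5, hp1]; rfl) ?_)
  refine WP.cons (WP.store_input ks.length (I 2 e) (by simp) (by omega) (by simp [s9]; omega)
    (by simp [s8]; omega) (by simp; omega) (by simp [s9]) (by simp [s8]) ?_)
  refine WP.cons (WP.assign_eq (ks.length + 1) (by simp [s9]; omega) (by simp; omega)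
    (by simp [s9]) ?_)
  exact WP.nil (by simp; omega) (hQ _ _ _ _ _ (by simp; omega) (by simpa) (by simp [hr₂, hr₁])
    (by simp [hr₂, hr₁]) (by simpa) (by simp) (by simpa) (by simp [hr₂, hr₁]) hF₂
    (fun j hj => by rw [hFj₂ j hj, hFj₁ j hj]) hW.step)

/-- Writes the output. -/
def writePhase : Program := block [
  .assign 12 (.reg 3),
  .assign 3 0,
  .assign 9 0,
  .assign 10 0,
  .loop (.reg 2 - .reg 3) (block [
    -- The test succeeds exactly if the mark is at least two, so that the edge lies on a chain, and
    -- the length of that chain is less than the threshold.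
    .branch (1 - ((2 - work 2 (.reg 3)) + (work 3 (work 2 (.reg 3) - 2) + 1 - .reg 12)))
      writeEdge .skip,
    .assign 3 (.reg 3 + 1)]),
  -- With truncated subtraction, `b - (b - 3m')` is the minimum of `b` and `3m'`.
  .store (.const 2) (.mem (.const 2) - (.mem (.const 2) - 3 * .reg 9)),
  .store (.const 0) (.reg 10),
  .store (.const 1) (.reg 9)]

theorem writePhase_wp {w n m R N t : ℕ} {r h : ℕ → ℕ} {I F : ℕ → ℕ → ℕ} {Q : ℕ → State → Prop}
    {A C : Finset ℕ} {lab : ℕ → ℕ} (hv : Valid w n m R I) (r0 : r 0 = 3 + 3 * m) (r2 : r 2 = m)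
    (r3 : r 3 = t) (ht : t ≤ m + 1) (hb : h 2 ≤ R)
    (hF : Chained m I F A A C lab m) (hN : 400 * (m + 1) ≤ N)
    (hQ : ∀ N' r' h' J F' ks vs, N ≤ N' + 400 * (m + 1) → h' 0 = vs.length → h' 1 = ks.length →
      h' 2 = min (h 2) (3 * ks.length) → Written I J ks vs m →
      (∀ e, e ∈ ks ↔ e ∈ A ∧ F 3 (lab e) < t) → Q N' ⟨r', layout m h' J F'⟩) :
    WP w writePhase Q N ⟨r, layout m h I F⟩ := by
  have hm := hv.m_le
  have hw := hv.le
  have hmk : ∀ i, F 2 i ≤ m + 2 := by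
    intro i
    have := hF.lab_le i
    rw [hF.mark, marking]
    split_ifs <;> omega
  refine WP.cons (WP.assign_eq t (by simp [r3]; omega) (by simp; omega) (by simp [r3])
    (WP.cons (WP.assign_eq 0 (by simp) (by simp; omega) rfl
    (WP.cons (WP.assign_eq 0 (by simp) (by simp; omega) rfl
    (WP.cons (WP.assign_eq 0 (by simp) (by simp; omega) rfl (WP.cons (WP.loop
    (fun N' s => ∃ r' J F' e ks vs, s = ⟨r', layout m h J F'⟩ ∧ e ≤ m ∧ N ≤ N' + 20 + 300 * e ∧
      r' 0 = 3 + 3 * m ∧ r' 2 = m ∧ r' 3 = e ∧ r' 9 = ks.length ∧ r' 10 = vs.length ∧ r' 12 = t ∧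
      (∀ i, F' 5 i = position vs i) ∧ (∀ j, j ≠ 5 → F' j = F j) ∧ Written I J ks vs e ∧
      ∀ f, f ∈ ks ↔ (f ∈ A ∧ F 3 (lab f) < t) ∧ f < e)
    ?_ ⟨_, I, F, 0, [], [], rfl, by omega, by simp; omega, by simpa, by simpa, by simp, by simp,
      by simp, by simp, by simp [position, hF.zero], fun _ _ => rfl,
      ⟨by simp, by simp, by simp, by simp, by simp, by simp, by simp, by simp, by simp,
        fun _ _ _ => rfl⟩, by simp⟩)))))))))
  clear r0 r2 r3
  rintro N' _ ⟨r', J, F', e, ks, vs, rfl, he, hN', r0, r2, r3, r9, r10, r12, F5, Fj, hW, hks⟩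
  have hkl := hW.length_le
  have hvl := hW.verts_le
  have F2 : F' 2 = F 2 := Fj 2 (by omega)
  have F3 : F' 3 = F 3 := Fj 3 (by omega)
  refine ⟨by simp [r2, r3]; omega, by simp; omega, fun ht' => ?_, fun ht' => ?_⟩
  all_goals simp [r2, r3] at ht'
  swap
  · obtain rfl : e = m := by omega
    refine WP.cons (WP.store_header (min (h 2) (3 * ks.length)) (by omega) (by omega)
      (by simp [r9, Expr.Fits, Expr.eval, layout_header]; omega) (by simp [Expr.cost]; omega)
      (by simp [r9, Expr.eval, layout_header]; omega) ?_)
    refine WP.cons (WP.store_header vs.length (by omega) (by omega) (by simp [r10]; omega)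
      (by simp [Expr.cost]; omega) (by simp [r10]) ?_)
    refine WP.cons (WP.store_header ks.length (by omega) (by omega) (by simp [r9]; omega)
      (by simp [Expr.cost]; omega) (by simp [r9]) ?_)
    refine WP.nil (by simp [Expr.cost]; omega) (hQ _ _ _ _ _ ks vs (by simp [Expr.cost]; omega)
      (by simp) (by simp) (by simp) hW fun f => ?_)
    rw [hks]
    exact and_iff_left_of_imp fun h => Finset.mem_range.1 (hF.sub h.1)
  have hem : e < m := by omega
  have b1 := hmk e
  have b2 := hF.len_le (F 2 e - 2)
  have hiff : 1 - ((2 - F 2 e) + (F 3 (F 2 e - 2) + 1 - t)) = 0 ↔ ¬ (e ∈ A ∧ F 3 (lab e) < t) := by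
    rw [hF.mark, marking]
    by_cases heA : e ∈ A
    · simp [heA]; omega
    · simp [heA, hem]
  refine WP.cons (WP.branch (by simp [r0, r3, r12, F2, F3]; omega) (by simp; omega) (fun hb => ?_)
    fun hb => ?_)
  · have hkeep : e ∈ A ∧ F 3 (lab e) < t := by
      by_contra hno
      refine hb ?_
      simp only [Expr.eval_sub, Expr.eval_add, Expr.eval_ofNat, Expr.eval_reg]
      simpa [r0, r3, r12, F2, F3] using hiff.2 hno
    refine writeEdge_wp hv hW hem r0 r3 r9 r10 F5 (by simp; omega) ?_
    intro N₁ r₁ J₁ F₁ vs₁ hN₁ s0 s1 s2 s3 s9 s10 s12 G5 Gj hW₁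
    simp at hN₁
    refine WP.cons (WP.assign_eq (e + 1) (by simp [s3]; omega) (by simp; omega) (by simp [s3]) ?_)
    refine WP.nil (by simp; omega) ⟨_, J₁, F₁, e + 1, ks ++ [e], vs₁, rfl, by omega, by simp; omega,
      by simpa, by simp [s2, r2], by simp, by simpa, by simpa, by simp [s12, r12], G5,
      fun j hj => by rw [Gj j hj, Fj j hj], hW₁, fun f => ?_⟩
    rw [List.mem_append, hks, List.mem_singleton]
    constructor
    · rintro (⟨h1, h2⟩ | rfl)
      exacts [⟨h1, by omega⟩, ⟨hkeep, by omega⟩]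
    · rintro ⟨h1, h2⟩
      rcases Nat.lt_succ_iff_lt_or_eq.1 h2 with h2 | h2
      exacts [.inl ⟨h1, h2⟩, .inr h2]
  · have hkeep : ¬ (e ∈ A ∧ F 3 (lab e) < t) := by
      refine hiff.1 ?_
      simpa [r0, r3, r12, F2, F3] using hb
    refine WP.skip (by simp; omega) (WP.cons (WP.assign_eq (e + 1) (by simp [r3]; omega)
      (by simp; omega) (by simp [r3]) ?_))
    refine WP.nil (by simp; omega) ⟨_, J, F', e + 1, ks, vs, rfl, by omega, by simp; omega,
      by simpa, by simpa, by simp, by simpa, by simpa, by simpa, F5, Fj,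
      { hW with
        edges_lt := fun f hf => (hW.edges_lt f hf).trans (by omega)
        length_le := by omega
        unchanged := fun k j hj => hW.unchanged k j (by omega) }, fun f => ?_⟩
    rw [hks]
    constructor
    · rintro ⟨h1, h2⟩
      exact ⟨h1, by omega⟩
    · rintro ⟨h1, h2⟩
      rcases Nat.lt_succ_iff_lt_or_eq.1 h2 with h2 | rfl
      exacts [⟨h1, h2⟩, absurd h1 hkeep]

end BRAC

/-! ### The complete algorithm -/

namespace BRAC

open Set Function

/-- The kernelization algorithm. -/
def kernelize : Program := block [
  .assign 1 (.mem (.const 0)),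
  .assign 2 (.mem (.const 1)),
  .assign 0 (3 + 3 * .reg 2),
  countPhase, stripPhase, chainPhase, scanPhase, writePhase]

theorem kernelize_wp {w n m R N : ℕ} {r h : ℕ → ℕ} {I F : ℕ → ℕ → ℕ} {Q : ℕ → State → Prop}
    (hv : Valid w n m R I) (h0 : h 0 = n) (h1 : h 1 = m) (h2 : h 2 ≤ R) (hF : ∀ k i, F k i = 0)
    (hN : 3000 * (n + m + 1) ≤ N)
    (hQ : ∀ N' r' h' J F' A C lab len t ks vs, A ⊆ Finset.range m →
      Extendable (edgesOf (I 0) (I 1) A) (edgesOf (I 0) (I 1) (Finset.range m)) →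
      (∀ v, deg (I 0) (I 1) A v ≠ 1) → Decomp (I 0) (I 1) A C lab len → (∀ q, len q ≤ m) →
      (∀ s < t, 1 ≤ s → s ≤ 16 * (∑ q ∈ C.filter fun q => len q < s, len q) + 12 * C.card) →
      (m < t ∨ 16 * (∑ q ∈ C.filter fun q => len q < t, len q) + 12 * C.card < t) →
      h' 0 = vs.length → h' 1 = ks.length → h' 2 = min (h 2) (3 * ks.length) →
      Written I J ks vs m → (∀ e, e ∈ ks ↔ e ∈ A ∧ len (lab e) < t) →
      Q N' ⟨r', layout m h' J F'⟩) :
    WP w kernelize Q N ⟨r, layout m h I F⟩ := by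
  have hm := hv.m_le
  have hn := hv.n_le
  have hw := hv.le
  refine WP.cons (WP.assign_eq n (by simp [Expr.Fits, Expr.eval, layout_header]; omega)
    (by simp [Expr.cost]; omega) (by simp [Expr.eval, layout_header, h0]) ?_)
  refine WP.cons (WP.assign_eq m (by simp [Expr.Fits, Expr.eval, layout_header]; omega)
    (by simp [Expr.cost]; omega) (by simp [Expr.eval, layout_header, h1]) ?_)
  refine WP.cons (WP.assign_eq (3 + 3 * m) (by simp; omega) (by simp [Expr.cost]; omega) (by simp) ?_)
  refine WP.cons (countPhase_wp hv (by simp) (by simp) (by simp) hF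
    (by simp [Expr.cost]; omega) ?_)
  intro N₁ r₁ F₁ hN₁ a0 a1 a2 hd hs hz
  simp [Expr.cost] at hN₁
  refine WP.cons (stripPhase_wp hv a0 a1 a2 ⟨subset_rfl, Extendable.refl _, hd, hs,
    fun i => by rw [hz 2 le_rfl, if_neg (by simp)], fun k hk => hz k (by omega)⟩ (by omega) ?_)
  clear a0 a1 a2
  intro N₂ r₂ F₂ A hN₂ a0 a1 a2 hS hdeg
  refine WP.cons (chainPhase_wp hv a0 a1 a2 hS (by omega) ?_)
  clear a0 a1 a2
  intro N₃ r₃ F₃ C lab hN₃ a0 a1 a2 a6 hC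
  refine WP.cons (scanPhase_wp hv a0 a1 a2 a6 hC (by omega) ?_)
  clear a0 a1 a2 a6
  intro N₄ r₄ t hN₄ a0 a1 a2 a3 ht hshort hlong
  refine WP.cons (writePhase_wp hv a0 a2 a3 ht h2 hC (by omega) ?_)
  intro N₅ r₅ h' J F₅ ks vs hN₅ b0 b1 b2 hW hks
  exact WP.nil (by omega) (hQ _ _ _ _ _ A C lab (F₃ 3) t ks vs hS.sub hS.ext hdeg hC.dec.decomp
    hC.len_le hshort hlong b0 b1 b2 hW hks)

/-! ### Encodings -/

theorem getD_flatMap {α : Type*} (f : ℕ → α → ℕ) (L : List α) {j k : ℕ} (hk : k < 3)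
    (hj : j < L.length) :
    (L.flatMap fun d => [f 0 d, f 1 d, f 2 d]).getD (3 * j + k) 0 = f k L[j] := by
  induction L generalizing j with
  | nil => simp at hj
  | cons a L ih =>
    rw [List.flatMap_cons]
    cases j with
    | zero =>
      rw [List.getD_append _ _ _ _ (by simpa using hk)]
      interval_cases k <;> rfl
    | succ j =>
      rw [List.getD_append_right _ _ _ _ (by simp; omega)]
      have := ih (j := j) (by simpa using hj)
      simp only [List.length_cons, List.length_nil, List.getElem_cons_succ]
      rw [← this]
      congr 1
      omega

theorem length_flatMap {α : Type*} (f : ℕ → α → ℕ) (L : List α) :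
    (L.flatMap fun d => [f 0 d, f 1 d, f 2 d]).length = 3 * L.length := by
  induction L with
  | nil => rfl
  | cons a L ih => rw [List.flatMap_cons, List.length_append, ih]; simp; omega

/-- The memory behind the input is zero, so the working arrays need no initialization. -/
theorem input_eq_layout {w : List ℕ} {m : ℕ} (hw : w.length = 3 + 3 * m) :
    State.input w = ⟨fun _ => 0, layout m (fun k => w.getD k 0)
      (fun k e => w.getD (3 + 3 * e + k) 0) fun _ _ => 0⟩ := by
  unfold State.input
  congr 1
  funext j
  rw [layout]
  split_ifs with h1 h2
  · rfl
  · congr 1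
    omega
  · exact List.getD_eq_default _ _ (by omega)

/-- The words that describe a dart of an instance. -/
def dartWord (I : Instance) (k : ℕ) (d : I.graph.Dart) : ℕ :=
  if k = 0 then (d.fst : ℕ) else if k = 1 then (d.snd : ℕ) else I.β ⟨d.edge, d.edge_mem⟩

/-- The edges of an instance are listed by `L`, and `A 0`, `A 1`, `A 2` hold their end points and
labels. -/
structure Listing (I : Instance) (L : List I.graph.Dart) (A : ℕ → ℕ → ℕ) : Prop where
  nodup : (L.map SimpleGraph.Dart.edge).Nodup
  mem : ∀ e, e ∈ L.map SimpleGraph.Dart.edge ↔ e ∈ I.graph.edgeSet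
  eq : ∀ k j (hj : j < L.length), k < 3 → A k j = dartWord I k L[j]

namespace Listing

variable {I : Instance} {L : List I.graph.Dart} {A : ℕ → ℕ → ℕ}

theorem sedge_eq (h : Listing I L A) {j : ℕ} (hj : j < L.length) :
    sedge (A 0) (A 1) j = Sym2.map Fin.val L[j].edge := by
  rw [sedge, h.eq 0 j hj (by omega), h.eq 1 j hj (by omega)]
  rfl

theorem inj (h : Listing I L A) {i j : ℕ} (hi : i < L.length) (hj : j < L.length)
    (he : L[i].edge = L[j].edge) : i = j := by
  refine (h.nodup.getElem_inj_iff (hi := by simpa) (hj := by simpa)).1 ?_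
  rw [List.getElem_map, List.getElem_map, he]

theorem simpleOn (h : Listing I L A) : SimpleOn (A 0) (A 1) (Finset.range L.length) := by
  refine ⟨fun j hj => ?_, fun i hi j hj hij => ?_⟩
  · have hj := Finset.mem_range.1 hj
    rw [h.eq 0 j hj (by omega), h.eq 1 j hj (by omega)]
    exact fun hc => L[j].adj.ne (Fin.val_injective hc)
  · have hi := Finset.mem_range.1 (Finset.mem_coe.1 hi)
    have hj := Finset.mem_range.1 (Finset.mem_coe.1 hj)
    rw [h.sedge_eq hi, h.sedge_eq hj] at hij
    exact h.inj hi hj (Sym2.map.injective Fin.val_injective hij)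

theorem edgesOf_eq (h : Listing I L A) :
    edgesOf (A 0) (A 1) (Finset.range L.length) = edgeImage I.graph Fin.val := by
  ext f
  constructor
  · rintro ⟨j, hj, rfl⟩
    have hj := Finset.mem_range.1 (Finset.mem_coe.1 hj)
    exact ⟨_, L[j].edge_mem, (h.sedge_eq hj).symm⟩
  · rintro ⟨e, he, rfl⟩
    obtain ⟨j, hj, rfl⟩ := List.mem_iff_getElem.1 ((h.mem e).2 he)
    rw [List.length_map] at hj
    exact ⟨j, by simpa using hj, by rw [h.sedge_eq hj, List.getElem_map]⟩

theorem length_eq (h : Listing I L A) : L.length = I.m := by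
  classical
  have : I.graph.edgeSet = ((L.map SimpleGraph.Dart.edge).toFinset : Set _) := by
    ext e; simp [← h.mem e]
  rw [Instance.m, this, ncard_coe_finset, List.toFinset_card_of_nodup h.nodup, List.length_map]

end Listing

theorem Instance.IsEncoding.exists_listing {I : Instance} {w : List ℕ} (h : I.IsEncoding w) :
    ∃ L : List I.graph.Dart, Listing I L (fun k e => w.getD (3 + 3 * e + k) 0) ∧
      w.length = 3 + 3 * L.length ∧ w.getD 0 0 = I.n ∧ w.getD 1 0 = L.length ∧ w.getD 2 0 = I.b := by
  obtain ⟨L, h1, h2, rfl⟩ := h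
  refine ⟨L, ⟨h1, h2, fun k j hj hk => ?_⟩, ?_, rfl, rfl, rfl⟩
  · rw [List.getD_append_right _ _ _ _ (by simp; omega)]
    have := getD_flatMap (dartWord I) L hk hj
    rw [← this]
    congr 1
    simp; omega
  · rw [List.length_append, add_comm]
    have := length_flatMap (dartWord I) L
    exact (congrArg₂ (· + ·) this rfl).trans (add_comm _ _)

/-- A memory that starts with the description of an instance. -/
theorem Listing.exists_holds {I : Instance} {L : List I.graph.Dart} {A F : ℕ → ℕ → ℕ} {r h : ℕ → ℕ}
    {m : ℕ} (hL : Listing I L A) (hm : L.length ≤ m) (h0 : h 0 = I.n) (h1 : h 1 = L.length)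
    (h2 : h 2 = I.b) : ∃ w, I.IsEncoding w ∧ State.Holds ⟨r, layout m h A F⟩ w := by
  refine ⟨_, ⟨L, hL.nodup, hL.mem, rfl⟩, fun i hi => ?_⟩
  have hlen := length_flatMap (dartWord I) L
  rw [← List.getD_eq_getElem _ 0]
  by_cases hi3 : i < 3
  · show layout m h A F i = _
    rw [layout_header hi3]
    interval_cases i
    exacts [h0, h1, h2]
  · rw [List.length_append] at hi
    have hi' : i < 3 + 3 * L.length := lt_of_lt_of_eq hi (congrArg₂ (· + ·) rfl hlen)
    obtain ⟨j, k, hk, rfl⟩ : ∃ j k, k < 3 ∧ i = 3 + 3 * j + k :=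
      ⟨(i - 3) / 3, (i - 3) % 3, by omega, by omega⟩
    show layout m h A F _ = _
    rw [layout_input hk (by omega), hL.eq k j (by omega) hk,
      List.getD_append_right _ _ _ _ (by simp; omega)]
    have := getD_flatMap (dartWord I) L hk (j := j) (by omega)
    rw [← this]
    congr 1
    simp; omega

end BRAC

namespace BRAC

open Set Function

/-! ### The kernel as an instance -/

/-- The instance given by the edges `ks` of `I` on the vertices `vs`. -/
theorem exists_kernel {I : Instance} {L : List I.graph.Dart} {A J : ℕ → ℕ → ℕ} {ks vs : List ℕ}
    (hL : Listing I L A) (hW : Written A J ks vs L.length) :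
    ∃ (I' : Instance) (L' : List I'.graph.Dart) (φ : I'.graph →g I.graph), Listing I' L' J ∧
      I'.n = vs.length ∧ L'.length = ks.length ∧ I'.b = min I.b (3 * ks.length) ∧
      Injective φ ∧ (∀ e, I'.β e = I.β (φ.mapEdgeSet e)) ∧ (∀ v, ∃ w, I'.graph.Adj v w) ∧
      edgeImage I'.graph (Fin.val ∘ φ) = edgesOf (A 0) (A 1) ks.toFinset := by
  classical
  have hsub : edgesOf (A 0) (A 1) ks.toFinset ⊆ edgeImage I.graph Fin.val := by
    rw [← hL.edgesOf_eq]
    exact image_mono fun e he => Finset.mem_coe.2 (Finset.mem_range.2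
      (hW.edges_lt e (List.mem_toFinset.1 (Finset.mem_coe.1 he))))
  have hvn : ∀ i : Fin vs.length, vs[i] < I.n := by
    intro i
    obtain ⟨f, hf, hi⟩ := (hW.mem_verts vs[i]).1 (List.getElem_mem i.2)
    obtain ⟨g, -, hge⟩ := hsub ⟨f, List.mem_toFinset.2 hf, rfl⟩
    have := mem_sedge.2 hi
    rw [← hge] at this
    obtain ⟨v, -, hv⟩ := Sym2.mem_map.1 this
    exact hv ▸ v.2
  -- New vertices are positions in `vs`. Every entry of `vs` lies on a kept edge, so the kernel has
  -- no isolated vertices.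
  let ψ : Fin vs.length → Fin I.n := fun i => ⟨vs[i], hvn i⟩
  have hψ : Injective ψ := fun i j hij =>
    Fin.ext ((hW.verts_nodup.getElem_inj_iff).1 (Fin.mk.inj hij))
  have hval : Injective fun i : Fin vs.length => (ψ i : ℕ) := Fin.val_injective.comp hψ
  have hloop : ∀ e ∈ ks, A 0 e ≠ A 1 e := fun e he =>
    hL.simpleOn.loopless e (Finset.mem_range.2 (hW.edges_lt e he))
  let G : SimpleGraph (Fin vs.length) :=
    { Adj := fun i j => s((ψ i : ℕ), (ψ j : ℕ)) ∈ edgesOf (A 0) (A 1) ks.toFinset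
      symm := ⟨fun i j h => by rwa [Sym2.eq_swap]⟩
      loopless := ⟨fun i => by
        rintro ⟨e, he, heq⟩
        refine hloop e (List.mem_toFinset.1 he) ?_
        rw [sedge, Sym2.eq_iff] at heq
        omega⟩ }
  let φ : G →g I.graph :=
    { toFun := ψ
      map_rel' := fun {i j} h => by
        obtain ⟨g, hg, hge⟩ := hsub h
        have : g = s(ψ i, ψ j) := Sym2.map.injective Fin.val_injective hge
        rw [this] at hg
        exact hg }
  have hpos : ∀ v (hv : v ∈ vs), (ψ ⟨vs.idxOf v, List.idxOf_lt_length_of_mem hv⟩ : ℕ) = v :=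
    fun v hv => List.getElem_idxOf _
  have hmem : ∀ e ∈ ks, A 0 e ∈ vs ∧ A 1 e ∈ vs := fun e he =>
    ⟨(hW.mem_verts _).2 ⟨e, he, .inl rfl⟩, (hW.mem_verts _).2 ⟨e, he, .inr rfl⟩⟩
  have himg : edgeImage G (Fin.val ∘ φ) = edgesOf (A 0) (A 1) ks.toFinset := by
    ext f
    constructor
    · rintro ⟨g, hg, rfl⟩
      induction g with | _ i j => exact hg
    · rintro ⟨e, he, rfl⟩
      have hek := List.mem_toFinset.1 (Finset.mem_coe.1 he)
      obtain ⟨m0, m1⟩ := hmem e hek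
      have heq : s((ψ ⟨_, List.idxOf_lt_length_of_mem m0⟩ : ℕ),
          (ψ ⟨_, List.idxOf_lt_length_of_mem m1⟩ : ℕ)) = sedge (A 0) (A 1) e := by
        rw [hpos _ m0, hpos _ m1]; rfl
      refine ⟨s(⟨_, List.idxOf_lt_length_of_mem m0⟩, ⟨_, List.idxOf_lt_length_of_mem m1⟩), ?_, heq⟩
      show s((ψ _ : ℕ), (ψ _ : ℕ)) ∈ edgesOf (A 0) (A 1) ks.toFinset
      rw [heq]
      exact ⟨e, he, rfl⟩
  -- Darts keep the orientation in which the end points of the edge were written.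
  have hdart : ∀ j : Fin ks.length, ∃ d : G.Dart, (d.fst : ℕ) = J 0 j ∧ (d.snd : ℕ) = J 1 j ∧
      Sym2.map (fun i => (ψ i : ℕ)) d.edge = sedge (A 0) (A 1) ks[j] := by
    intro j
    have hek := List.getElem_mem j.2
    obtain ⟨m0, m1⟩ := hmem _ hek
    have heq : s((ψ ⟨_, List.idxOf_lt_length_of_mem m0⟩ : ℕ),
        (ψ ⟨_, List.idxOf_lt_length_of_mem m1⟩ : ℕ)) = sedge (A 0) (A 1) ks[j] := by
      rw [hpos _ m0, hpos _ m1]; rfl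
    refine ⟨⟨(⟨_, List.idxOf_lt_length_of_mem m0⟩, ⟨_, List.idxOf_lt_length_of_mem m1⟩), ?_⟩,
      (hW.left j j.2).symm, (hW.right j j.2).symm, heq⟩
    show s((ψ _ : ℕ), (ψ _ : ℕ)) ∈ _
    rw [heq]
    exact ⟨_, List.mem_toFinset.2 hek, rfl⟩
  choose d hd0 hd1 hd using hdart
  refine ⟨⟨vs.length, G, min I.b (3 * ks.length), fun e => I.β (φ.mapEdgeSet e)⟩, List.ofFn d, φ,
    ⟨?_, ?_, ?_⟩, rfl, by simp, rfl, hψ, fun _ => rfl, fun i => ?_, himg⟩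
  · rw [List.map_ofFn, List.nodup_ofFn]
    intro i j hij
    have h1 : sedge (A 0) (A 1) ks[i] = sedge (A 0) (A 1) ks[j] := by
      rw [← hd, ← hd]; exact congrArg _ hij
    have h2 := hL.simpleOn.inj
      (Finset.mem_coe.2 (Finset.mem_range.2 (hW.edges_lt _ (List.getElem_mem i.2))))
      (Finset.mem_coe.2 (Finset.mem_range.2 (hW.edges_lt _ (List.getElem_mem j.2)))) h1
    exact Fin.ext (hW.edges_nodup.getElem_inj_iff.1 h2)
  · intro e
    rw [List.map_ofFn, List.mem_ofFn]
    constructor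
    · rintro ⟨j, rfl⟩
      exact (d j).edge_mem
    · intro he
      have : Sym2.map (Fin.val ∘ φ) e ∈ edgesOf (A 0) (A 1) ks.toFinset := himg ▸ ⟨e, he, rfl⟩
      obtain ⟨f, hf, hfe⟩ := this
      obtain ⟨j, hj, rfl⟩ := List.mem_iff_getElem.1 (List.mem_toFinset.1 (Finset.mem_coe.1 hf))
      exact ⟨⟨j, hj⟩, Sym2.map.injective hval ((hd ⟨j, hj⟩).trans hfe)⟩
  · intro k j hj hk
    have hj' : j < ks.length := by simpa using hj
    rw [List.getElem_ofFn]
    interval_cases k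
    · exact (hd0 ⟨j, hj'⟩).symm
    · exact (hd1 ⟨j, hj'⟩).symm
    · have hlt := hW.edges_lt _ (List.getElem_mem hj')
      rw [hW.label j hj', hL.eq 2 _ hlt (by omega)]
      show ((I.β _ : Fin 4) : ℕ) = ((I.β _ : Fin 4) : ℕ)
      congr 2
      refine Subtype.ext (Sym2.map.injective Fin.val_injective ?_)
      rw [← hL.sedge_eq hlt]
      refine (hd ⟨j, hj'⟩).symm.trans ?_
      show _ = Sym2.map Fin.val (Sym2.map φ (d ⟨j, hj'⟩).edge)
      rw [Sym2.map_map]; rfl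
  · obtain ⟨f, hf, hi⟩ := (hW.mem_verts vs[i]).1 (List.getElem_mem i.2)
    have h2 : A 0 f + A 1 f - vs[i] ∈ vs := (hW.mem_verts _).2 ⟨f, hf, hi.joins.inc_right⟩
    refine ⟨⟨_, List.idxOf_lt_length_of_mem h2⟩, ?_⟩
    show s((ψ _ : ℕ), (ψ _ : ℕ)) ∈ _
    rw [hpos _ h2]
    exact ⟨f, List.mem_toFinset.2 hf, hi.joins.sedge_eq⟩

/-- In the first case no chain reaches the length `t`, so nothing is dropped. In the second, each
dropped chain has length at least `t` and hence exceeds the bound required for redrawing. -/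
theorem Decomp.extendable_short {U W : ℕ → ℕ} {A Q : Finset ℕ} {lab len : ℕ → ℕ}
    (hA : SimpleOn U W A) (h : Decomp U W A Q lab len) {m t : ℕ} (hlen : ∀ q, len q ≤ m)
    (ht : m < t ∨ 16 * (∑ q ∈ Q.filter fun q => len q < t, len q) + 12 * Q.card < t) :
    Extendable (edgesOf U W (A.filter fun e => len (lab e) < t)) (edgesOf U W A) := by
  rcases Q.eq_empty_or_nonempty with rfl | hQ
  · have : A = ∅ := Finset.eq_empty_of_forall_notMem fun e he => by simpa using h.lab_mem e he
    subst this
    exact Extendable.refl _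
  · refine h.extendable hA (fun q _ hq => ?_) (Finset.card_pos.2 hQ)
    rw [h.card_lt]
    have := hlen q
    omega

/-- The left side is at most `2000 Z ^ 2`, and `2000 ≤ 2 ^ 11`. So words of size `Z ^ 13` hold all
intermediate values, which are bounded in terms of `Z ^ 2`. -/
theorem thousand_mul_sq_le {Z c : ℕ} (hZ : 2 ≤ Z) (hc : 13 ≤ c) :
    1000 * Z ^ 2 + 1000 ≤ Z ^ c := by
  have h1 : 1 ≤ Z ^ 2 := Nat.one_le_pow _ _ (by omega)
  have h2 : 2 ^ 11 ≤ Z ^ 11 := Nat.pow_le_pow_left hZ 11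
  calc 1000 * Z ^ 2 + 1000 ≤ 2 ^ 11 * Z ^ 2 := by omega
    _ ≤ Z ^ 11 * Z ^ 2 := Nat.mul_le_mul_right _ h2
    _ = Z ^ 13 := by rw [← pow_add]
    _ ≤ Z ^ c := Nat.pow_le_pow_right (by omega) hc

theorem Listing.valid {I : Instance} {L : List I.graph.Dart} {A : ℕ → ℕ → ℕ} (h : Listing I L A)
    {c : ℕ} (hc : 13 ≤ c) : Valid ((I.n + I.m + I.b + 2) ^ c) I.n L.length ((I.n + I.m + I.b + 2) ^ 2) A := by
  have hm := h.length_eq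
  refine ⟨?_, ?_, ?_, fun e he => ?_, fun e he => ?_, fun e he => ?_, thousand_mul_sq_le (by omega) hc,
    h.simpleOn⟩
  · exact le_trans (by omega) (Nat.le_self_pow two_ne_zero _)
  · exact le_trans (by omega) (Nat.le_self_pow two_ne_zero _)
  · rw [hm, sq]; exact Nat.mul_le_mul (by omega) (by omega)
  · rw [h.eq 0 e he (by omega)]; exact L[e].fst.2
  · rw [h.eq 1 e he (by omega)]; exact L[e].snd.2
  · rw [h.eq 2 e he (by omega)]; exact Nat.le_of_lt_succ (I.β _).2

/-- The program output is identified with a kernel instance whose edges are those on chains below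
the threshold. Its drawings extend first by the long chains and then by the stripped leaves. The
constant `3000` is needed for the running time only; the word size would allow a much smaller
exponent. -/
theorem kernelize_spec {I : Instance} {w : List ℕ} (hw : I.IsEncoding w) {c : ℕ} (hc : 3000 ≤ c) :
    WP ((I.n + I.m + I.b + 2) ^ c) kernelize (fun _ s => ∃ (I' : Instance) (w' : List ℕ),
      I'.IsEncoding w' ∧ s.Holds w' ∧ (I.IsYes ↔ I'.IsYes) ∧
        I'.n + I'.m ≤ (36 * fen I.graph) ^ (4 * fen I.graph) ∧ fen I'.graph ≤ fen I.graph ∧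
        I'.b = min I.b (3 * I'.m) ∧
        ∃ φ : I'.graph →g I.graph, Injective φ ∧ (∀ e, I'.β e = I.β (φ.mapEdgeSet e)) ∧
          ∀ D' : Drawing I'.graph, D'.IsRAC → D'.Respects I'.β →
            ∃ D : Drawing I.graph, D.IsRAC ∧ D.Respects I.β ∧ D.Extends D' φ ∧
              D.totalBends = D'.totalBends) (c * (I.n + I.m + 1)) (State.input w) := by
  classical
  obtain ⟨L, hL, hlen, h0, h1, h2⟩ := hw.exists_listing
  have hm := hL.length_eq
  rw [input_eq_layout hlen]
  refine kernelize_wp (hL.valid (by omega)) h0 h1 ?_ (fun _ _ => rfl)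
    (by rw [hm]; exact Nat.mul_le_mul_right _ hc) ?_
  · rw [h2]; exact le_trans (by omega) (Nat.le_self_pow two_ne_zero _)
  intro N' r' h' J F' A C lab len t ks vs hAm hext hdeg hdec hlenm hshort hlong g0 g1 g2 hW hks
  obtain ⟨I', L', φ, hL', hn', hm', hb', hφ, hβ, hadj, himg⟩ := exists_kernel hL hW
  obtain ⟨w', hw', hs⟩ := hL'.exists_holds (r := r') (F := F') (h := h') (m := L.length)
    (hm'.trans_le hW.length_le) (g0.trans hn'.symm) (g1.trans hm'.symm) (by rw [g2, hb', h2])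
  have hA := hL.simpleOn.mono hAm
  have hK : ks.toFinset = A.filter fun e => len (lab e) < t := by
    ext e; rw [List.mem_toFinset, hks, Finset.mem_filter]
  have hm'' : I'.m = ks.length := hL'.length_eq.symm.trans hm'
  have hb'' : I'.b = min I.b (3 * I'.m) := by rw [hb', hm'']
  have hex : ∀ D' : Drawing I'.graph, D'.IsRAC → D'.Respects I'.β →
      ∃ D : Drawing I.graph, D.IsRAC ∧ D.Respects I.β ∧ D.Extends D' φ ∧
        D.totalBends = D'.totalBends := by
    refine exists_extends Fin.val_injective φ hφ hadj ?_ hβ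
    rw [himg, hK, ← hL.edgesOf_eq]
    exact (hdec.extendable_short hA hlenm hlong).trans hext
  refine ⟨I', w', hw', hs, Instance.isYes_iff φ hφ hb'' hβ hex, ?_, fen_le_of_injective φ hφ, hb'',
    φ, hφ, hβ, hex⟩
  -- For the size, a minimum feedback edge set of the whole graph is restricted to the edges that
  -- survive the stripping; it bounds the number of chains there.
  obtain ⟨F, hF, hFc, hfor⟩ := exists_forest (G := I.graph) Fin.val_injective hA
    (hL.edgesOf_eq ▸ image_mono (Finset.coe_subset.2 hAm))
  have hC := hdec.card_le hA hdeg hF hfor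
  have hcard : ks.length = ∑ q ∈ C.filter fun q => len q < t, len q := by
    rw [← hdec.card_lt, ← hK, List.toFinset_card_of_nodup hW.edges_nodup]
  have hv := hW.verts_le
  refine kernel_size (hC.trans (Nat.mul_le_mul_left 4 hFc)) (M := ks.length) ?_ (by omega)
  rw [hcard]
  refine (sum_short_le C len t hshort).trans (Nat.mul_le_mul_left _ ?_)
  exact Nat.pow_le_pow_right (by omega) (Finset.card_filter_le _ _)

end BRAC

theorem theorem7 :
    ∃ (P : BRAC.Program) (c : ℕ), ∀ (I : BRAC.Instance) (w : List ℕ), I.IsEncoding w →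
      -- in linear time, on words of logarithmically many bits, the program outputs an instance
      ∃ (T : ℕ) (s : BRAC.State) (I' : BRAC.Instance) (w' : List ℕ),
        BRAC.Exec ((I.n + I.m + I.b + 2) ^ c) P (BRAC.State.input w) T s ∧
        T ≤ c * (I.n + I.m + 1) ∧
        I'.IsEncoding w' ∧ s.Holds w' ∧
        -- which is equivalent and small
        (I.IsYes ↔ I'.IsYes) ∧
        I'.n + I'.m ≤ (36 * BRAC.fen I.graph) ^ (4 * BRAC.fen I.graph) ∧
        BRAC.fen I'.graph ≤ BRAC.fen I.graph ∧
        I'.b = min I.b (3 * I'.m) ∧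
        -- and lives on a subgraph all of whose drawings extend without additional bends
        ∃ φ : I'.graph →g I.graph, Function.Injective φ ∧
          (∀ e, I'.β e = I.β (φ.mapEdgeSet e)) ∧
          ∀ D' : BRAC.Drawing I'.graph, D'.IsRAC → D'.Respects I'.β →
            ∃ D : BRAC.Drawing I.graph, D.IsRAC ∧ D.Respects I.β ∧ D.Extends D' φ ∧
              D.totalBends = D'.totalBends := by
  refine ⟨BRAC.kernelize, 3000, fun I w hw => ?_⟩
  obtain ⟨T, s, hex, hT, I', w', h⟩ := BRAC.kernelize_spec hw le_rfl
  exact ⟨T, s, I', w', hex, hT, h⟩
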